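/- Let $S \subset \mathbb{R}^2$ be a finite set. A \emph{geometric triangulation} of $S$ is a simplicial complex in $\mathbb{R}^2$ whose vertex set is $S$ and whose underlying space is the convex hull of $S$. A geometric triangulation $D$ of $S$ is a \emph{Delaunay triangulation} if no point of $S$ lies strictly inside the circumcircle of a triangle of $D$. For a triangle $\Delta$ with edge lengths $a, b, c$, let $|\Delta|$ be its area and $R_\Delta$ its circumradius, and put $\mathrm{Rf}(\Delta) = \frac{|\Delta|}{12}(a^2+b^2+c^2)$ and $p(\Delta) = abc$. If $\Delta$ is acute, let $\mathrm{Vf}(\Delta) = \int_{\Delta} \min_{v} \|x - v\|^2 \, dx$, the minimum being over the three vertices $v$ of $\Delta$; otherwise let $\mathrm{Vf}(\Delta) = \frac{|\Delta|}{12}(a^2+b^2+c^2-4R_\Delta^2)$. For a geometric triangulation $K$ of $S$ let $\mathrm{Rf}(K)$ and $\mathrm{Vf}(K)$ be the sums of $\mathrm{Rf}(\Delta)$ and $\mathrm{Vf}(\Delta)$ over all triangles $\Delta$ of $K$, and for real $\alpha$ let $R_\alpha(K) = \sum_{\Delta \in K} R_\Delta^{\alpha}\, |\Delta|$. Then: 1.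 $S$ has a Delaunay triangulation. If no four points of $S$ lie on a common circle, then the triangles of any Delaunay triangulation of $S$ are exactly the (nondegenerate) triangles spanned by three points of $S$ whose circumcircle has no point of $S$ strictly inside. 2. For every Delaunay triangulation $D$ and every geometric triangulation $K$ of $S$, $R_2(D) \le R_2(K)$ and $R_1(D) \le R_1(K)$. 3. For every geometric triangulation $K$ of $S$, $R_2(K) = 3\,\mathrm{Rf}(K) - 3\,\mathrm{Vf}(K)$ and $R_1(K) = \frac14 \sum_{\Delta \in K} p(\Delta)$. -/

import Mathlib

/-- The Euclidean plane. -/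
abbrev Plane : Type := EuclideanSpace ℝ (Fin 2)

/-! ### Quantities attached to a triangle, given as the finite set of its three vertices -/

/-- The area of the triangle with vertex set `t`: the Lebesgue measure of its convex hull. -/
noncomputable def triangleArea (t : Finset Plane) : ℝ :=
  (MeasureTheory.volume (convexHull ℝ (t : Set Plane))).toReal

/-- The radius of a circle through all points of `t`. For the three vertices of a triangle there
is exactly one such circle, and the set below has exactly one element. -/
noncomputable def triangleCircumradius (t : Finset Plane) : ℝ :=
  sInf {r : ℝ | ∃ c : Plane, ∀ p ∈ t, dist p c = r}

/-- For a nondegenerate triangle, `triangleCircumradius` is Mathlib's circumradius. -/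
theorem triangleCircumradius_eq (T : Affine.Triangle ℝ Plane) (t : Finset Plane)
    (h : (t : Set Plane) = Set.range T.points) : triangleCircumradius t = T.circumradius := by
  have hspan : affineSpan ℝ (Set.range T.points) = ⊤ :=
    T.independent.affineSpan_eq_top_iff_card_eq_finrank_add_one.2 (by simp)
  have hmem : ∀ p : Plane, p ∈ t ↔ ∃ i, T.points i = p := fun p => by
    rw [← Finset.mem_coe, h, Set.mem_range]
  have hset : {r : ℝ | ∃ c : Plane, ∀ p ∈ t, dist p c = r} = {T.circumradius} := by
    ext r
    simp only [Set.mem_ofPred_eq, Set.mem_singleton_iff]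
    constructor
    · rintro ⟨c, hc⟩
      exact T.eq_circumradius_of_dist_eq (by rw [hspan]; trivial)
        (fun i => hc _ ((hmem _).2 ⟨i, rfl⟩))
    · rintro rfl
      refine ⟨T.circumcenter, fun p hp => ?_⟩
      obtain ⟨i, rfl⟩ := (hmem p).1 hp
      exact T.dist_circumcenter_eq_circumradius i
  rw [triangleCircumradius, hset, csInf_singleton]

/-- The edges of the triangle `t`: its two-element subsets. -/
def triangleEdges (t : Finset Plane) : Finset (Finset Plane) := t.powersetCard 2

/-- The length of the edge `e = {p, q}`: the diameter of `{p, q}`, which is `dist p q`. -/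
noncomputable def edgeLength (e : Finset Plane) : ℝ := Metric.diam (e : Set Plane)

/-- The sum `a² + b² + c²` of the squared edge lengths. -/
noncomputable def sumSqEdges (t : Finset Plane) : ℝ := ∑ e ∈ triangleEdges t, edgeLength e ^ 2

/-- The product `a b c` of the edge lengths. -/
noncomputable def prodEdges (t : Finset Plane) : ℝ := ∏ e ∈ triangleEdges t, edgeLength e

/-- All angles of the triangle `t` are acute. -/
def IsAcute (t : Finset Plane) : Prop :=
  ∀ A ∈ t, ∀ B ∈ t, ∀ C ∈ t, A ≠ B → B ≠ C → C ≠ A →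
    EuclideanGeometry.angle A B C < Real.pi / 2

/-- The Rajan functional of a triangle. -/
noncomputable def rajanTriangle (t : Finset Plane) : ℝ :=
  triangleArea t / 12 * sumSqEdges t

open Classical in
/-- The Voronoi functional of a triangle: for an acute triangle the integral over the triangle of
the squared distance to the nearest vertex, and for a triangle that is not acute the expression
`area / 12 * (a² + b² + c² - 4 R²)`. -/
noncomputable def voronoiTriangle (t : Finset Plane) : ℝ :=
  if IsAcute t then
    ∫ x in convexHull ℝ (t : Set Plane), Metric.infDist x (t : Set Plane) ^ 2
  else
    triangleArea t / 12 * (sumSqEdges t - 4 * triangleCircumradius t ^ 2)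

/-! ### Geometric triangulations -/

/-- A geometric triangulation of `S`: a simplicial complex in the plane with vertex set `S` and
underlying space the convex hull of `S`. -/
structure GeometricTriangulation (S : Finset Plane) extends
    Geometry.SimplicialComplex ℝ Plane where
  vertices_eq : toSimplicialComplex.vertices = (S : Set Plane)
  space_eq : toSimplicialComplex.space = convexHull ℝ (S : Set Plane)

/-- No four points of `S` lie on a common circle. -/
def NoFourCocircular (S : Finset Plane) : Prop :=
  ∀ (c : Plane) (r : ℝ), ∀ t ⊆ S, (∀ p ∈ t, dist p c = r) → t.card ≤ 3

open Classical in
/-- The triangles spanned by three points of `S` whose circumcircle encloses no point of `S`. -/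
noncomputable def delaunayTriangles (S : Finset Plane) : Finset (Finset Plane) :=
  {t ∈ S.powersetCard 3 | AffineIndependent ℝ ((↑) : t → Plane) ∧
    ∃ (c : Plane) (r : ℝ), (∀ p ∈ t, dist p c = r) ∧ ∀ q ∈ S, r ≤ dist q c}

namespace GeometricTriangulation

open Classical in
/-- The triangles (two-dimensional simplices) of a geometric triangulation. -/
noncomputable def triangles {S : Finset Plane} (K : GeometricTriangulation S) :
    Finset (Finset Plane) :=
  {t ∈ S.powersetCard 3 | t ∈ K.faces}

theorem mem_triangles {S : Finset Plane} (K : GeometricTriangulation S) (t : Finset Plane) :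
    t ∈ K.triangles ↔ t ∈ K.faces ∧ t.card = 3 := by
  classical
  simp only [triangles, Finset.mem_filter, Finset.mem_powersetCard]
  constructor
  · rintro ⟨⟨-, h⟩, h'⟩
    exact ⟨h', h⟩
  · rintro ⟨h, h'⟩
    refine ⟨⟨fun p hp => ?_, h'⟩, h⟩
    have hp' : p ∈ K.toSimplicialComplex.vertices :=
      K.down_closed h (Finset.singleton_subset_iff.2 hp) (Finset.singleton_nonempty p)
    rw [K.vertices_eq] at hp'
    exact hp'

/-- `K` is a Delaunay triangulation of `S`: no point of `S` is enclosed by the circumcircle of a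
triangle of `K`. -/
def IsDelaunay {S : Finset Plane} (K : GeometricTriangulation S) : Prop :=
  K.triangles ⊆ delaunayTriangles S

/-- The functional `R_α`: the sum over all triangles of (circumradius)^α times area. -/
noncomputable def radiusFunctional {S : Finset Plane} (α : ℝ) (K : GeometricTriangulation S) : ℝ :=
  ∑ t ∈ K.triangles, triangleCircumradius t ^ α * triangleArea t

/-- The Rajan functional of a geometric triangulation. -/
noncomputable def rajan {S : Finset Plane} (K : GeometricTriangulation S) : ℝ :=
  ∑ t ∈ K.triangles, rajanTriangle t

/-- The Voronoi functional of a geometric triangulation. -/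
noncomputable def voronoi {S : Finset Plane} (K : GeometricTriangulation S) : ℝ :=
  ∑ t ∈ K.triangles, voronoiTriangle t

end GeometricTriangulation

/-! Optimality is a flip argument phrased as a minimization. `IsTriangulation` keeps of a
triangulation only its set of triangles; there are finitely many such sets, so a weight such as the
sum of R^α · area attains its minimum. If a set is not Delaunay, `exists_flippable` finds two of its
triangles `a b c` and `a b d` forming a convex quadrilateral with `d` inside the circle through `a,
b, c`. Exchanging the diagonal `a b` for `c d` gives a triangulation again (`IsTriangulation.flip`),
and for α = 1, 2 the weight drops (`radiusWeight_one_lt`, `radiusWeight_two_lt`). Hence every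
minimizer is Delaunay.

The weight drops for the following reason. Let the diagonals cross in z = αa + βb = γc + δd, and put
P = αβ|ab|², Q = γδ|cd|². By the power of the point z, `d` is inside the circle exactly when Q < P.
The difference of the R_2 weights factors with P - Q as a factor and a positive cofactor. For R_1,
where R · area = abc/4, the condition says that the angles at `c` and `d` add up to more than π, and
a strict form of the diagonal formulas for cyclic quadrilaterals compares the products of side
lengths.

The minimizer need not be the given Delaunay triangulation. But the difference of the powers of a
point with respect to two circles is affine in the point, and this forces overlapping triangles with
empty circumcircles onto one circle (`exists_circle_of_common_point`). Therefore all Delaunay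
triangulations have the same R_α, and they have the same triangles when no four points are
cocircular.

Existence uses the lower convex hull of points lifted to the heights |p|². Cocircular points may
make its faces larger than triangles, so the heights are perturbed to generic ones; the strict
inequalities that exclude non-Delaunay triangles survive a small perturbation
(`exists_delaunay_height`). Collinear sets are handled by adding a point off the line and deleting
it afterwards.

For the identities, cutting an acute triangle at its circumcenter and edge midpoints gives pieces
with constant nearest vertex; the integral turns out to be the same expression that defines Vf for
the other triangles. -/

/-! ### Orientation and barycentric coordinates. -/

/-- Twice the signed area of the triangle `a b c`. -/
def orient (a b c : Plane) : ℝ :=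
  (b 0 - a 0) * (c 1 - a 1) - (b 1 - a 1) * (c 0 - a 0)

theorem plane_ext {x y : Plane} (h0 : x 0 = y 0) (h1 : x 1 = y 1) : x = y := by
  ext i
  fin_cases i
  · exact h0
  · exact h1

theorem dist_sq_plane (p q : Plane) : dist p q ^ 2 = (p 0 - q 0) ^ 2 + (p 1 - q 1) ^ 2 := by
  rw [EuclideanSpace.dist_eq, Real.sq_sqrt (by positivity), Fin.sum_univ_two, Real.dist_eq,
    Real.dist_eq, sq_abs, sq_abs]

theorem orient_swap (a b c : Plane) : orient b a c = -orient a b c := by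
  unfold orient; ring

theorem orient_rotate (a b c : Plane) : orient b c a = orient a b c := by
  unfold orient; ring

theorem orient_self_right (a b : Plane) : orient a b b = 0 := by unfold orient; ring

theorem orient_self_mid (a b : Plane) : orient a b a = 0 := by unfold orient; ring

theorem orient_add (a b c x : Plane) :
    orient x b c + orient a x c + orient a b x = orient a b c := by
  unfold orient; ring

theorem orient_combination₃ {p q a b c x : Plane} {α β γ : ℝ} (h : α + β + γ = 1)
    (hx : α • a + β • b + γ • c = x) :
    orient p q x = α * orient p q a + β * orient p q b + γ * orient p q c := by
  subst hx
  obtain rfl : α = 1 - β - γ := by linarith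
  simp only [orient, PiLp.add_apply, PiLp.smul_apply, smul_eq_mul]
  ring

theorem orient_lineMap (p q x y : Plane) (τ : ℝ) :
    orient p q (AffineMap.lineMap x y τ) = (1 - τ) * orient p q x + τ * orient p q y := by
  simp only [AffineMap.lineMap_apply_module, orient, PiLp.add_apply, PiLp.smul_apply, smul_eq_mul]
  ring

theorem mem_convexHull_triple {a b c x : Plane} :
    x ∈ convexHull ℝ ({a, b, c} : Set Plane) ↔
      ∃ α β γ : ℝ, 0 ≤ α ∧ 0 ≤ β ∧ 0 ≤ γ ∧ α + β + γ = 1 ∧ α • a + β • b + γ • c = x := by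
  constructor
  · intro h
    rw [convexHull_insert (by simp), mem_convexJoin] at h
    obtain ⟨a', ha', y, hy, hx⟩ := h
    rw [Set.mem_singleton_iff] at ha'
    subst ha'
    rw [convexHull_pair] at hy
    obtain ⟨s, t, hs, ht, hst, rfl⟩ := hy
    obtain ⟨u, v, hu, hv, huv, rfl⟩ := hx
    refine ⟨u, v * s, v * t, hu, by positivity, by positivity, ?_, ?_⟩
    · linear_combination huv + v * hst
    · simp only [smul_add, smul_smul, add_assoc]
  · rintro ⟨α, β, γ, hα, hβ, hγ, h1, rfl⟩
    have := (convex_convexHull ℝ ({a, b, c} : Set Plane)).sum_mem (t := Finset.univ)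
      (w := ![α, β, γ]) (z := ![a, b, c])
      (by intro i _; fin_cases i <;> simpa) (by simpa [Fin.sum_univ_three])
      (by intro i _; apply subset_convexHull; fin_cases i <;> simp)
    simpa [Fin.sum_univ_three] using this

theorem orient_combination_eq {a b c : Plane} (x : Plane) (h : orient a b c ≠ 0) :
    (orient x b c / orient a b c) • a + (orient a x c / orient a b c) • b +
      (orient a b x / orient a b c) • c = x := by
  apply plane_ext <;>
  · simp only [PiLp.add_apply, PiLp.smul_apply, smul_eq_mul]
    field_simp
    unfold orient
    ring

theorem orient_of_combination {a b c x : Plane} {α β γ : ℝ} (h : α + β + γ = 1)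
    (hx : α • a + β • b + γ • c = x) :
    orient x b c = α * orient a b c ∧ orient a x c = β * orient a b c ∧
      orient a b x = γ * orient a b c := by
  subst hx
  obtain rfl : α = 1 - β - γ := by linarith
  simp only [orient, PiLp.add_apply, PiLp.smul_apply, smul_eq_mul]
  refine ⟨?_, ?_, ?_⟩ <;> ring

theorem mem_convexHull_triple_iff_orient {a b c x : Plane} (h : 0 < orient a b c) :
    x ∈ convexHull ℝ ({a, b, c} : Set Plane) ↔
      0 ≤ orient x b c ∧ 0 ≤ orient a x c ∧ 0 ≤ orient a b x := by
  rw [mem_convexHull_triple]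
  constructor
  · rintro ⟨α, β, γ, hα, hβ, hγ, h1, hx⟩
    obtain ⟨e1, e2, e3⟩ := orient_of_combination h1 hx
    rw [e1, e2, e3]
    exact ⟨by positivity, by positivity, by positivity⟩
  · rintro ⟨h1, h2, h3⟩
    exact ⟨_, _, _, div_nonneg h1 h.le, div_nonneg h2 h.le, div_nonneg h3 h.le,
      by rw [← add_div, ← add_div, orient_add, div_self h.ne'], orient_combination_eq x h.ne'⟩

theorem collinear_iff_orient {a b c : Plane} :
    Collinear ℝ ({a, b, c} : Set Plane) ↔ orient a b c = 0 := by
  rw [collinear_iff_of_mem (p₀ := a) (by simp)]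
  constructor
  · rintro ⟨v, hv⟩
    obtain ⟨r, hr⟩ := hv b (by simp)
    obtain ⟨s, hs⟩ := hv c (by simp)
    rw [hr, hs]
    simp only [orient, vadd_eq_add, PiLp.add_apply, PiLp.smul_apply, smul_eq_mul]
    ring
  · intro h
    by_cases hab : b = a
    · refine ⟨c - a, ?_⟩
      intro p hp
      simp only [Set.mem_insert_iff, Set.mem_singleton_iff] at hp
      rcases hp with rfl | rfl | rfl
      · exact ⟨0, by simp⟩
      · exact ⟨0, by simp [hab]⟩
      · exact ⟨1, by simp⟩
    · have hd : (b 0 - a 0) ^ 2 + (b 1 - a 1) ^ 2 ≠ 0 := by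
        rw [← dist_sq_plane]
        exact pow_ne_zero 2 (dist_ne_zero.2 hab)
      refine ⟨b - a, ?_⟩
      intro p hp
      simp only [Set.mem_insert_iff, Set.mem_singleton_iff] at hp
      rcases hp with rfl | rfl | rfl
      · exact ⟨0, by simp⟩
      · exact ⟨1, by simp⟩
      -- The coefficient of the orthogonal projection of `p - a` onto `b - a`.
      · refine ⟨((b 0 - a 0) * (p 0 - a 0) + (b 1 - a 1) * (p 1 - a 1)) /
          ((b 0 - a 0) ^ 2 + (b 1 - a 1) ^ 2), ?_⟩
        unfold orient at h
        apply plane_ext <;>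
          simp only [vadd_eq_add, PiLp.add_apply, PiLp.smul_apply, PiLp.sub_apply, smul_eq_mul] <;>
          field_simp
        · linear_combination (-(b 1 - a 1)) * h
        · linear_combination (b 0 - a 0) * h

open Classical in
theorem affineIndependent_triple_iff {a b c : Plane} (hab : a ≠ b) (hac : a ≠ c) (hbc : b ≠ c) :
    AffineIndependent ℝ ((↑) : ({a, b, c} : Finset Plane) → Plane) ↔ orient a b c ≠ 0 := by
  rw [Ne, ← collinear_iff_orient, ← affineIndependent_iff_not_collinear_set]
  have hinj : Function.Injective ![a, b, c] := by
    intro i j hij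
    fin_cases i <;> fin_cases j
    exacts [rfl, (hab hij).elim, (hac hij).elim, (hab hij.symm).elim, rfl, (hbc hij).elim,
      (hac hij.symm).elim, (hbc hij.symm).elim, rfl]
  constructor
  · intro h
    have hmem : ∀ i, ![a, b, c] i ∈ ({a, b, c} : Finset Plane) := by
      intro i
      rw [Finset.mem_insert, Finset.mem_insert, Finset.mem_singleton]
      fin_cases i
      · exact Or.inl rfl
      · exact Or.inr (Or.inl rfl)
      · exact Or.inr (Or.inr rfl)
    let e : Fin 3 ↪ ({a, b, c} : Finset Plane) :=
      ⟨fun i => ⟨![a, b, c] i, hmem i⟩, fun i j hij => hinj (Subtype.ext_iff.1 hij)⟩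
    exact h.comp_embedding e
  · intro h
    have h2 := h.range
    let e : ({a, b, c} : Finset Plane) ↪ Set.range ![a, b, c] :=
      ⟨fun x => ⟨x.1, by
        obtain ⟨x, hx⟩ := x
        simp only [Finset.mem_insert, Finset.mem_singleton] at hx
        rcases hx with rfl | rfl | rfl
        · exact ⟨0, rfl⟩
        · exact ⟨1, rfl⟩
        · exact ⟨2, rfl⟩⟩, fun x y hxy => Subtype.ext (congrArg Subtype.val hxy :)⟩
    exact h2.comp_embedding e

theorem ne_of_orient_ne_zero {a b c : Plane} (h : orient a b c ≠ 0) : a ≠ b ∧ a ≠ c ∧ b ≠ c := by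
  refine ⟨?_, ?_, ?_⟩ <;> rintro rfl <;> apply h <;> unfold orient <;> ring

open Classical in
/-- A two-dimensional simplex, as a finite set of points. -/
def IsTriangle (t : Finset Plane) : Prop :=
  t.card = 3 ∧ AffineIndependent ℝ ((↑) : t → Plane)

open Classical in
theorem isTriangle_of_orient {a b c : Plane} (h : orient a b c ≠ 0) :
    IsTriangle ({a, b, c} : Finset Plane) := by
  obtain ⟨h1, h2, h3⟩ := ne_of_orient_ne_zero h
  exact ⟨Finset.card_eq_three.2 ⟨a, b, c, h1, h2, h3, rfl⟩, (affineIndependent_triple_iff h1 h2 h3).2 h⟩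

open Classical in
theorem IsTriangle.exists_orient_pos {t : Finset Plane} (h : IsTriangle t) :
    ∃ a b c : Plane, t = {a, b, c} ∧ 0 < orient a b c := by
  obtain ⟨h3, hi⟩ := h
  obtain ⟨a, b, c, hab, hac, hbc, rfl⟩ := Finset.card_eq_three.1 h3
  rw [affineIndependent_triple_iff hab hac hbc] at hi
  rcases lt_or_gt_of_ne hi with h | h
  · refine ⟨b, a, c, ?_, by rw [orient_swap]; linarith⟩
    ext x
    simp only [Finset.mem_insert, Finset.mem_singleton]
    tauto
  · exact ⟨a, b, c, rfl, h⟩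

open Classical in
theorem IsTriangle.exists_orient_pos_of_mem {t : Finset Plane} (h : IsTriangle t) {p : Plane}
    (hp : p ∈ t) : ∃ a b : Plane, t = {a, b, p} ∧ 0 < orient a b p := by
  obtain ⟨a, b, c, rfl, hpos⟩ := h.exists_orient_pos
  simp only [Finset.mem_insert, Finset.mem_singleton] at hp
  rcases hp with rfl | rfl | rfl
  · refine ⟨b, c, ?_, by rwa [orient_rotate]⟩
    ext x; simp only [Finset.mem_insert, Finset.mem_singleton]; tauto
  · refine ⟨c, a, ?_, by rwa [← orient_rotate]⟩
    ext x; simp only [Finset.mem_insert, Finset.mem_singleton]; tauto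
  · exact ⟨_, _, rfl, hpos⟩

/-! ### Integration over triangles. -/

open MeasureTheory in
/-- Integration over a triangle in affine coordinates. -/
theorem setIntegral_triangle (a b c : Plane) (h : orient a b c ≠ 0) (f : Plane → ℝ) (hf : Continuous f) :
    ∫ x in convexHull ℝ ({a, b, c} : Set Plane), f x =
      |orient a b c| * ∫ s in (0 : ℝ)..1, ∫ t in (0 : ℝ)..(1 - s),
        f (a + s • (b - a) + t • (c - a)) := by
  -- The linear map taking the standard basis to `b - a`, `c - a`. Its determinant is `orient a b
  -- c`, and translated by `a` it carries the standard simplex to the triangle.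
  set Λ : Plane →L[ℝ] Plane :=
    (EuclideanSpace.proj 0 : Plane →L[ℝ] ℝ).smulRight (b - a) +
      (EuclideanSpace.proj 1 : Plane →L[ℝ] ℝ).smulRight (c - a) with hΛ
  have hΛa : ∀ x, Λ x = x 0 • (b - a) + x 1 • (c - a) := fun x => by simp [hΛ]
  have hdet : Λ.det = orient a b c := by
    rw [ContinuousLinearMap.det, ← LinearMap.det_toMatrix (EuclideanSpace.basisFun (Fin 2) ℝ).toBasis,
      Matrix.det_fin_two]
    simp [LinearMap.toMatrix_apply, hΛa, orient]
    ring
  set Δ : Set Plane := {x | 0 ≤ x 0 ∧ 0 ≤ x 1 ∧ x 0 + x 1 ≤ 1} with hΔ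
  have himg : convexHull ℝ ({a, b, c} : Set Plane) = (fun x => a + Λ x) '' Δ := by
    ext y
    rw [mem_convexHull_triple]
    constructor
    · rintro ⟨α, β, γ, hα, hβ, hγ, h1, rfl⟩
      refine ⟨!₂[β, γ], ⟨by simpa, by simpa, by simp; linarith⟩, ?_⟩
      obtain rfl : α = 1 - β - γ := by linarith
      simp only [hΛa]
      simp
      module
    · rintro ⟨x, ⟨h0, h1, h2⟩, rfl⟩
      refine ⟨1 - x 0 - x 1, x 0, x 1, by linarith, h0, h1, by ring, ?_⟩
      simp only [hΛa]
      module
  have hclosed : IsClosed Δ := by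
    have : Δ = {x | 0 ≤ x 0} ∩ ({x | 0 ≤ x 1} ∩ {x | x 0 + x 1 ≤ 1}) := rfl
    rw [this]
    refine (isClosed_le ?_ ?_).inter ((isClosed_le ?_ ?_).inter (isClosed_le ?_ ?_)) <;> fun_prop
  have hinj : Set.InjOn (fun x => a + Λ x) Δ := by
    intro x _ y _ hxy
    have h1 : Λ x = Λ y := by simpa using hxy
    rw [hΛa, hΛa] at h1
    have e0 := congrArg (fun z : Plane => z 0) h1
    have e1 := congrArg (fun z : Plane => z 1) h1
    simp only [PiLp.add_apply, PiLp.smul_apply, PiLp.sub_apply, smul_eq_mul] at e0 e1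
    unfold orient at h
    apply plane_ext <;> apply mul_right_cancel₀ h
    · linear_combination (c 1 - a 1) * e0 - (c 0 - a 0) * e1
    · linear_combination (b 0 - a 0) * e1 - (b 1 - a 1) * e0
  rw [himg, integral_image_eq_integral_abs_det_fderiv_smul volume hclosed.measurableSet
    (f' := fun _ => Λ) (fun x _ => (Λ.hasFDerivAt.const_add a).hasFDerivWithinAt) hinj]
  simp only [hdet, smul_eq_mul, hΛa]
  rw [integral_const_mul]
  congr 1
  set g : ℝ × ℝ → ℝ := fun p => f (a + p.1 • (b - a) + p.2 • (c - a)) with hg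
  have hgc : Continuous g := by fun_prop
  set Δ' : Set (ℝ × ℝ) := {p | 0 ≤ p.1 ∧ 0 ≤ p.2 ∧ p.1 + p.2 ≤ 1} with hΔ'
  have hmp : MeasurePreserving (fun x : Plane => (x 0, x 1)) volume volume :=
    (volume_preserving_finTwoArrow ℝ).comp
      (EuclideanSpace.volume_preserving_symm_measurableEquiv_toLp (Fin 2))
  have hemb : MeasurableEmbedding (fun x : Plane => (x 0, x 1)) :=
    ((MeasurableEquiv.toLp 2 (Fin 2 → ℝ)).symm.trans MeasurableEquiv.finTwoArrow).measurableEmbedding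
  have hpre : Δ = (fun x : Plane => (x 0, x 1)) ⁻¹' Δ' := rfl
  have hclosed' : IsClosed Δ' := by
    have : Δ' = {p | 0 ≤ p.1} ∩ ({p | 0 ≤ p.2} ∩ {p | p.1 + p.2 ≤ 1}) := rfl
    rw [this]
    refine (isClosed_le ?_ ?_).inter ((isClosed_le ?_ ?_).inter (isClosed_le ?_ ?_)) <;> fun_prop
  have hcompact' : IsCompact Δ' := by
    refine (isCompact_Icc (a := ((0 : ℝ), (0 : ℝ))) (b := (1, 1))).of_isClosed_subset hclosed' ?_
    rintro ⟨s, t⟩ ⟨h1, h2, h3⟩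
    simp only at h1 h2 h3
    exact ⟨⟨h1, h2⟩, ⟨by simp only; linarith, by simp only; linarith⟩⟩
  have e1 : ∫ x in Δ, f (a + (x 0 • (b - a) + x 1 • (c - a))) = ∫ p in Δ', g p := by
    rw [← hmp.setIntegral_preimage_emb hemb, ← hpre]
    simp only [hg, add_assoc]
  rw [e1, ← integral_indicator hclosed'.measurableSet, Measure.volume_eq_prod, integral_prod]
  · rw [intervalIntegral.integral_of_le zero_le_one, ← integral_Icc_eq_integral_Ioc,
      ← integral_indicator measurableSet_Icc]
    refine integral_congr_ae (Filter.Eventually.of_forall fun s => ?_)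
    simp only
    by_cases hs : s ∈ Set.Icc (0 : ℝ) 1
    · rw [Set.indicator_of_mem hs, intervalIntegral.integral_of_le (by linarith [hs.2]),
        ← integral_Icc_eq_integral_Ioc, ← integral_indicator measurableSet_Icc]
      refine integral_congr_ae (Filter.Eventually.of_forall fun t => ?_)
      simp only
      by_cases ht : t ∈ Set.Icc (0 : ℝ) (1 - s)
      · rw [Set.indicator_of_mem ht, Set.indicator_of_mem]
        exact ⟨hs.1, ht.1, by simp only; linarith [ht.2]⟩
      · rw [Set.indicator_of_notMem ht, Set.indicator_of_notMem]
        rintro ⟨h1, h2, h3⟩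
        exact ht ⟨h2, by simp only at h3; linarith⟩
    · rw [Set.indicator_of_notMem hs]
      have : ∀ t, Δ'.indicator g (s, t) = 0 := fun t => by
        rw [Set.indicator_of_notMem]
        rintro ⟨h1, h2, h3⟩
        simp only at h1 h2 h3
        exact hs ⟨h1, by linarith⟩
      simp [this]
  · rw [← Measure.volume_eq_prod, integrable_indicator_iff hclosed'.measurableSet]
    exact hgc.continuousOn.integrableOn_compact hcompact'

open MeasureTheory in
theorem volume_triangle (a b c : Plane) (h : orient a b c ≠ 0) :
    (volume (convexHull ℝ ({a, b, c} : Set Plane))).toReal = |orient a b c| / 2 := by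
  have := setIntegral_triangle a b c h (fun _ => 1) continuous_const
  simp only [integral_const, smul_eq_mul, mul_one, intervalIntegral.integral_const, sub_zero] at this
  rw [measureReal_restrict_apply_univ] at this
  rw [← measureReal_def, this]
  have : ∫ x in (0 : ℝ)..1, (1 - x) = 1 / 2 := by
    rw [intervalIntegral.integral_sub (by simp) (by simp)]
    simp
    norm_num
  rw [this]; ring

theorem integral_cubic (k₀ k₁ k₂ k₃ u : ℝ) :
    ∫ t in (0 : ℝ)..u, (k₀ + k₁ * t + k₂ * t ^ 2 + k₃ * t ^ 3) =
      k₀ * u + k₁ * u ^ 2 / 2 + k₂ * u ^ 3 / 3 + k₃ * u ^ 4 / 4 := by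
  have hd : ∀ t ∈ Set.uIcc 0 u, HasDerivAt
      (fun u : ℝ => k₀ * u + k₁ * u ^ 2 / 2 + k₂ * u ^ 3 / 3 + k₃ * u ^ 4 / 4)
      (k₀ + k₁ * t + k₂ * t ^ 2 + k₃ * t ^ 3) t := fun t _ => by
    have := ((((hasDerivAt_id t).const_mul k₀).add (((hasDerivAt_pow 2 t).const_mul k₁).div_const 2)).add
      (((hasDerivAt_pow 3 t).const_mul k₂).div_const 3)).add
      (((hasDerivAt_pow 4 t).const_mul k₃).div_const 4)
    refine this.congr_deriv ?_
    push_cast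
    ring
  rw [intervalIntegral.integral_eq_sub_of_hasDerivAt hd
    (Continuous.intervalIntegrable (by fun_prop) _ _)]
  ring

open MeasureTheory in
theorem setIntegral_triangle_dist_sq (a b c : Plane) (h : orient a b c ≠ 0) :
    ∫ x in convexHull ℝ ({a, b, c} : Set Plane), dist x a ^ 2 =
      |orient a b c| / 12 * (dist b a ^ 2 + dist c a ^ 2 +
        ((b 0 - a 0) * (c 0 - a 0) + (b 1 - a 1) * (c 1 - a 1))) := by
  rw [setIntegral_triangle a b c h _ (by fun_prop), div_mul_eq_mul_div, mul_div_assoc]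
  congr 1
  have key : ∀ s t : ℝ, dist (a + s • (b - a) + t • (c - a)) a ^ 2 =
      s ^ 2 * dist b a ^ 2 + 2 * s * ((b 0 - a 0) * (c 0 - a 0) + (b 1 - a 1) * (c 1 - a 1)) * t +
        dist c a ^ 2 * t ^ 2 := fun s t => by
    simp only [dist_sq_plane, PiLp.add_apply, PiLp.smul_apply, PiLp.sub_apply, smul_eq_mul]
    ring
  simp only [key]
  set P := dist b a ^ 2
  set Q := dist c a ^ 2
  set D := (b 0 - a 0) * (c 0 - a 0) + (b 1 - a 1) * (c 1 - a 1)
  have inner : ∀ s : ℝ, ∫ t in (0 : ℝ)..(1 - s), (s ^ 2 * P + 2 * s * D * t + Q * t ^ 2) =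
      (Q / 3) + (D - Q) * s + (P - 2 * D + Q) * s ^ 2 + (D - P - Q / 3) * s ^ 3 := fun s => by
    have := integral_cubic (s ^ 2 * P) (2 * s * D) Q 0 (1 - s)
    simp only [zero_mul, add_zero] at this
    rw [this]; ring
  simp only [inner]
  rw [integral_cubic]
  ring

/-! ### Circumradius, edge lengths and area. -/

/-- The square of abc = 4R · area, which needs no sign of the orientation. Cramer's rule solves the
two bisector equations for the center relative to `a`; the squares of its coordinates add up to r².
The formula also shows that the radius is determined by the vertices. -/
theorem circumradius_sq_mul_orient_sq {a b c o : Plane} {r : ℝ} (ha : dist a o = r) (hb : dist b o = r)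
    (hc : dist c o = r) :
    4 * r ^ 2 * orient a b c ^ 2 = (dist a b * dist b c * dist c a) ^ 2 := by
  have ea := dist_sq_plane a o
  have eb := dist_sq_plane b o
  have ec := dist_sq_plane c o
  rw [ha] at ea; rw [hb] at eb; rw [hc] at ec
  rw [mul_pow, mul_pow, dist_sq_plane, dist_sq_plane, dist_sq_plane]
  unfold orient
  generalize a 0 = a0, a 1 = a1, b 0 = b0, b 1 = b1, c 0 = c0, c 1 = c1, o 0 = o0, o 1 = o1 at *
  set X := (b0 - a0) * (c1 - a1) - (b1 - a1) * (c0 - a0) with hX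
  set B := (b0 - a0) ^ 2 + (b1 - a1) ^ 2 with hB
  set C := (c0 - a0) ^ 2 + (c1 - a1) ^ 2 with hC
  have h1 : 2 * (o0 - a0) * (b0 - a0) + 2 * (o1 - a1) * (b1 - a1) = B := by
    rw [hB]; linear_combination eb - ea
  have h2 : 2 * (o0 - a0) * (c0 - a0) + 2 * (o1 - a1) * (c1 - a1) = C := by
    rw [hC]; linear_combination ec - ea
  have h3 : 2 * (o0 - a0) * X = B * (c1 - a1) - C * (b1 - a1) := by
    rw [hX, ← h1, ← h2]; ring
  have h4 : 2 * (o1 - a1) * X = C * (b0 - a0) - B * (c0 - a0) := by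
    rw [hX, ← h1, ← h2]; ring
  calc 4 * r ^ 2 * X ^ 2 = (2 * (o0 - a0) * X) ^ 2 + (2 * (o1 - a1) * X) ^ 2 := by rw [ea]; ring
    _ = _ := by rw [h3, h4, hB, hC]; ring

theorem exists_circumcenter {a b c : Plane} (h : orient a b c ≠ 0) :
    ∃ o : Plane, dist b o = dist a o ∧ dist c o = dist a o := by
  set B := (b 0 - a 0) ^ 2 + (b 1 - a 1) ^ 2 with hB
  set C := (c 0 - a 0) ^ 2 + (c 1 - a 1) ^ 2 with hC
  -- Cramer's solution of the equations of the perpendicular bisectors of `a b` and `a c`.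
  refine ⟨!₂[a 0 + (B * (c 1 - a 1) - C * (b 1 - a 1)) / (2 * orient a b c),
    a 1 + (C * (b 0 - a 0) - B * (c 0 - a 0)) / (2 * orient a b c)], ?_, ?_⟩ <;>
  · rw [← sq_eq_sq₀ dist_nonneg dist_nonneg, dist_sq_plane, dist_sq_plane]
    simp only [Matrix.cons_val_zero, Matrix.cons_val_one]
    rw [hB, hC]
    field_simp
    unfold orient
    ring

open Classical in
theorem circumradius_unique {a b c o : Plane} {r : ℝ} (h : orient a b c ≠ 0)
    (ho : ∀ p ∈ ({a, b, c} : Finset Plane), dist p o = r) :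
    triangleCircumradius {a, b, c} = r := by
  have hset : {r : ℝ | ∃ c' : Plane, ∀ p ∈ ({a, b, c} : Finset Plane), dist p c' = r} = {r} := by
    ext s
    simp only [Set.mem_ofPred_eq, Set.mem_singleton_iff]
    constructor
    · rintro ⟨o', ho'⟩
      have e1 := circumradius_sq_mul_orient_sq (ho a (by simp)) (ho b (by simp)) (ho c (by simp))
      have e2 := circumradius_sq_mul_orient_sq (ho' a (by simp)) (ho' b (by simp)) (ho' c (by simp))
      have hr : 0 ≤ r := ho a (by simp) ▸ dist_nonneg
      have hs : 0 ≤ s := ho' a (by simp) ▸ dist_nonneg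
      rw [← e2] at e1
      have := mul_right_cancel₀ (pow_ne_zero 2 h) e1
      rw [← sq_eq_sq₀ hs hr]
      linarith
    · rintro rfl
      exact ⟨o, ho⟩
  rw [triangleCircumradius, hset, csInf_singleton]

open Classical in
theorem IsTriangle.circumradius_eq {t : Finset Plane} (ht : IsTriangle t) {o : Plane} {r : ℝ}
    (ho : ∀ p ∈ t, dist p o = r) : triangleCircumradius t = r := by
  obtain ⟨a, b, c, rfl, h⟩ := ht.exists_orient_pos
  exact circumradius_unique h.ne' ho

open Classical in
theorem IsTriangle.exists_circumcircle {t : Finset Plane} (ht : IsTriangle t) :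
    ∃ o : Plane, ∀ p ∈ t, dist p o = triangleCircumradius t := by
  obtain ⟨a, b, c, rfl, h⟩ := ht.exists_orient_pos
  obtain ⟨o, hb, hc⟩ := exists_circumcenter h.ne'
  have : ∀ p ∈ ({a, b, c} : Finset Plane), dist p o = dist a o := by
    intro p hp
    simp only [Finset.mem_insert, Finset.mem_singleton] at hp
    rcases hp with rfl | rfl | rfl
    exacts [rfl, hb, hc]
  exact ⟨o, by rwa [circumradius_unique h.ne' this]⟩

theorem IsTriangle.circumradius_nonneg {t : Finset Plane} (ht : IsTriangle t) :
    0 ≤ triangleCircumradius t := by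
  obtain ⟨o, ho⟩ := ht.exists_circumcircle
  obtain ⟨p, hp⟩ := Finset.card_pos.1 (by rw [ht.1]; norm_num : 0 < t.card)
  exact ho p hp ▸ dist_nonneg

open Classical in
theorem triangleEdges_triple {a b c : Plane} (hab : a ≠ b) (hac : a ≠ c) (hbc : b ≠ c) :
    triangleEdges {a, b, c} = {{a, b}, {b, c}, {c, a}} := by
  rw [triangleEdges]
  ext e
  simp only [Finset.mem_powersetCard, Finset.mem_insert, Finset.mem_singleton]
  constructor
  · rintro ⟨hs, hc⟩
    obtain ⟨x, y, hxy, rfl⟩ := Finset.card_eq_two.1 hc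
    have hx := hs (Finset.mem_insert_self x {y})
    have hy := hs (Finset.mem_insert_of_mem (Finset.mem_singleton_self y))
    simp only [Finset.mem_insert, Finset.mem_singleton] at hx hy
    rcases hx with rfl | rfl | rfl <;> rcases hy with rfl | rfl | rfl <;>
      simp_all [Finset.pair_comm]
  · rintro (rfl | rfl | rfl)
    · exact ⟨by intro x; simp; tauto, Finset.card_pair hab⟩
    · exact ⟨by intro x; simp; tauto, Finset.card_pair hbc⟩
    · exact ⟨by intro x; simp; tauto, Finset.card_pair hac.symm⟩

open Classical in
theorem edgeLength_pair (a b : Plane) : edgeLength {a, b} = dist a b := by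
  rw [edgeLength, Finset.coe_pair, Metric.diam_pair]

open Classical in
theorem pairs_ne {a b c : Plane} (hab : a ≠ b) (hac : a ≠ c) (hbc : b ≠ c) :
    ({a, b} : Finset Plane) ∉ ({{b, c}, {c, a}} : Finset (Finset Plane)) ∧
      ({b, c} : Finset Plane) ∉ ({{c, a}} : Finset (Finset Plane)) := by
  have h1 : ({a, b} : Finset Plane) ≠ {b, c} := fun h => by
    have : a ∈ ({b, c} : Finset Plane) := h ▸ by simp
    simp [hab, hac] at this
  have h2 : ({a, b} : Finset Plane) ≠ {c, a} := fun h => by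
    have : b ∈ ({c, a} : Finset Plane) := h ▸ by simp
    simp [hab.symm, hbc] at this
  have h3 : ({b, c} : Finset Plane) ≠ {c, a} := fun h => by
    have : b ∈ ({c, a} : Finset Plane) := h ▸ by simp
    simp [hab.symm, hbc] at this
  simp [h1, h2, h3]

open Classical in
theorem prodEdges_triple {a b c : Plane} (hab : a ≠ b) (hac : a ≠ c) (hbc : b ≠ c) :
    prodEdges {a, b, c} = dist a b * dist b c * dist c a := by
  obtain ⟨h1, h2⟩ := pairs_ne hab hac hbc
  rw [prodEdges, triangleEdges_triple hab hac hbc, Finset.prod_insert h1, Finset.prod_insert h2,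
    Finset.prod_singleton, edgeLength_pair, edgeLength_pair, edgeLength_pair, mul_assoc]

open Classical in
theorem sumSqEdges_triple {a b c : Plane} (hab : a ≠ b) (hac : a ≠ c) (hbc : b ≠ c) :
    sumSqEdges {a, b, c} = dist a b ^ 2 + dist b c ^ 2 + dist c a ^ 2 := by
  obtain ⟨h1, h2⟩ := pairs_ne hab hac hbc
  rw [sumSqEdges, triangleEdges_triple hab hac hbc, Finset.sum_insert h1, Finset.sum_insert h2,
    Finset.sum_singleton, edgeLength_pair, edgeLength_pair, edgeLength_pair, add_assoc]

open Classical in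
theorem triangleArea_triple {a b c : Plane} (h : orient a b c ≠ 0) :
    triangleArea {a, b, c} = |orient a b c| / 2 := by
  rw [triangleArea, ← volume_triangle a b c h]
  simp

theorem IsTriangle.area_pos {t : Finset Plane} (ht : IsTriangle t) : 0 < triangleArea t := by
  obtain ⟨a, b, c, rfl, h⟩ := ht.exists_orient_pos
  rw [triangleArea_triple h.ne', abs_of_pos h]
  positivity

theorem IsTriangle.circumradius_mul_area {t : Finset Plane} (ht : IsTriangle t) :
    triangleCircumradius t * triangleArea t = 1 / 4 * prodEdges t := by
  have h0 := ht.circumradius_nonneg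
  obtain ⟨o, ho⟩ := ht.exists_circumcircle
  obtain ⟨a, b, c, rfl, h⟩ := ht.exists_orient_pos
  obtain ⟨h1, h2, h3⟩ := ne_of_orient_ne_zero h.ne'
  rw [triangleArea_triple h.ne', abs_of_pos h, prodEdges_triple h1 h2 h3]
  have := circumradius_sq_mul_orient_sq (ho a (by simp)) (ho b (by simp)) (ho c (by simp))
  rw [show 4 * triangleCircumradius {a, b, c} ^ 2 * orient a b c ^ 2 =
    (2 * triangleCircumradius {a, b, c} * orient a b c) ^ 2 by ring,
    sq_eq_sq₀ (by positivity) (by positivity)] at this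
  linarith

/-- The weight `R ^ α * area` of a triangle. -/
noncomputable def radiusWeight (α : ℝ) (t : Finset Plane) : ℝ :=
  triangleCircumradius t ^ α * triangleArea t

theorem IsTriangle.radiusWeight_nonneg {t : Finset Plane} (ht : IsTriangle t) (α : ℝ) :
    0 ≤ radiusWeight α t :=
  mul_nonneg (Real.rpow_nonneg ht.circumradius_nonneg α) ht.area_pos.le

open Classical in
theorem radiusWeight_one {a b c : Plane} (h : orient a b c ≠ 0) :
    radiusWeight 1 {a, b, c} = 1 / 4 * (dist a b * dist b c * dist c a) := by
  obtain ⟨h1, h2, h3⟩ := ne_of_orient_ne_zero h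
  rw [radiusWeight, Real.rpow_one, (isTriangle_of_orient h).circumradius_mul_area,
    prodEdges_triple h1 h2 h3]

open Classical in
theorem radiusWeight_two {a b c : Plane} (h : orient a b c ≠ 0) :
    radiusWeight 2 {a, b, c} = (dist a b * dist b c * dist c a) ^ 2 / (8 * |orient a b c|) := by
  have h1 := radiusWeight_one h
  rw [radiusWeight, Real.rpow_one, triangleArea_triple h] at h1
  rw [radiusWeight, triangleArea_triple h, Real.rpow_two,
    show dist a b * dist b c * dist c a =
      4 * (triangleCircumradius {a, b, c} * (|orient a b c| / 2)) by rw [h1]; ring]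
  have : |orient a b c| ≠ 0 := abs_ne_zero.2 h
  field_simp
  ring

/-! ### A flip decreases R_1 and R_2. -/

/-- Read i/m, x/m as cosine and sine of an angle θ in (0, π), and j/n, y/n as those of φ. The
hypothesis `h` is sin(θ + φ) < 0, so θ + φ > π and cos θ + cos φ < 0. -/
theorem cos_sum_neg {m n i j x y : ℝ} (hm : 0 < m) (hn : 0 < n) (hx : 0 < x) (hy : 0 < y)
    (hmi : m ^ 2 = i ^ 2 + x ^ 2) (hnj : n ^ 2 = j ^ 2 + y ^ 2) (h : i * y + j * x < 0) :
    n * i + m * j < 0 := by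
  have aux : ∀ {m n i j x y : ℝ}, 0 < m → 0 < n → 0 < x → 0 < y → m ^ 2 = i ^ 2 + x ^ 2 →
      n ^ 2 = j ^ 2 + y ^ 2 → i * y + j * x < 0 → 0 < i → n * i + m * j < 0 := by
    intro m n i j x y hm hn hx hy hmi hnj h hi
    have hj : j < 0 := by
      by_contra hj
      push Not at hj
      have : 0 < i * y := by positivity
      have : 0 ≤ j * x := by positivity
      linarith
    have h1 : i * y < (-j) * x := by linarith
    have h2 : (i * y) ^ 2 < ((-j) * x) ^ 2 := by
      apply pow_lt_pow_left₀ h1 (by positivity) two_ne_zero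
    have h3 : (n * i) ^ 2 < (m * (-j)) ^ 2 := by
      rw [mul_pow, mul_pow, hmi, hnj]; nlinarith
    have h4 := lt_of_pow_lt_pow_left₀ 2 (mul_nonneg hm.le (by linarith)) h3
    linarith
  rcases lt_or_ge 0 i with hi | hi
  · exact aux hm hn hx hy hmi hnj h hi
  rcases lt_or_ge 0 j with hj | hj
  · have := aux hn hm hy hx hnj hmi (by linarith) hj
    linarith
  · have h1 : n * i ≤ 0 := mul_nonpos_of_nonneg_of_nonpos hn.le hi
    have h2 : m * j ≤ 0 := mul_nonpos_of_nonneg_of_nonpos hm.le hj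
    rcases eq_or_lt_of_le hi with hi | hi
    · rcases eq_or_lt_of_le hj with hj | hj
      · subst hi hj; simp at h
      · nlinarith
    · nlinarith

/-- In a quadrilateral with side lengths `p, q, r, s` and diagonals `e, f`, compare the sums of
products of the side lengths of the two triangulations. -/
theorem diagonal_products_lt {p q r s e f i₁ i₂ i₃ i₄ : ℝ} (hp : 0 < p) (hq : 0 < q) (hr : 0 < r)
    (hs : 0 < s) (he : 0 < e)
    (h1 : e ^ 2 = p ^ 2 + q ^ 2 - 2 * i₁) (h2 : e ^ 2 = r ^ 2 + s ^ 2 - 2 * i₂)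
    (h3 : f ^ 2 = p ^ 2 + s ^ 2 - 2 * i₃) (h4 : f ^ 2 = q ^ 2 + r ^ 2 - 2 * i₄)
    (h12 : (r * s) * i₁ + (p * q) * i₂ < 0) (h34 : 0 < (q * r) * i₃ + (p * s) * i₄) :
    f * (p * s + q * r) < e * (p * q + r * s) := by
  -- For a cyclic quadrilateral `e1` and `e2` are equalities, the classical formulas for the squared
  -- diagonals. Weighting the two laws of cosines for a diagonal by the products of opposite sides
  -- leaves an error governed by `h12`, respectively `h34`.
  have e1 : (p * r + q * s) * (p * s + q * r) < e ^ 2 * (p * q + r * s) := by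
    have : e ^ 2 * (p * q + r * s) = r * s * e ^ 2 + p * q * e ^ 2 := by ring
    rw [this]
    nth_rewrite 1 [h1]
    rw [h2]
    nlinarith
  have e2 : f ^ 2 * (p * s + q * r) < (p * r + q * s) * (p * q + r * s) := by
    have : f ^ 2 * (p * s + q * r) = q * r * f ^ 2 + p * s * f ^ 2 := by ring
    rw [this]
    nth_rewrite 1 [h3]
    rw [h4]
    nlinarith
  apply lt_of_pow_lt_pow_left₀ 2 (by positivity)
  calc (f * (p * s + q * r)) ^ 2 = f ^ 2 * (p * s + q * r) * (p * s + q * r) := by ring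
    _ < (p * r + q * s) * (p * q + r * s) * (p * s + q * r) := by gcongr
    _ = (p * r + q * s) * (p * s + q * r) * (p * q + r * s) := by ring
    _ < e ^ 2 * (p * q + r * s) * (p * q + r * s) := by gcongr
    _ = _ := by ring

/-- The data of a convex quadrilateral `a c b d` whose diagonals `a b` and `c d` cross in the
point `α a + β b = γ c + δ d`, such that `d` is inside the circle through `a, b, c`. -/
structure FlippableQuad (a b c d : Plane) (α β γ δ : ℝ) : Prop where
  hα : 0 < α
  hβ : 0 < β
  hγ : 0 < γ
  hδ : 0 < δ
  hαβ : α + β = 1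
  hγδ : γ + δ = 1
  cross : α • a + β • b = γ • c + δ • d
  orient_pos : 0 < orient a b c
  power_lt : γ * δ * dist c d ^ 2 < α * β * dist a b ^ 2

namespace FlippableQuad

variable {a b c d : Plane} {α β γ δ : ℝ}

/-- Coordinates based at the crossing point z of the diagonals, with u = a - b and v = c - d.
Substituting them turns the identities about the quadrilateral into polynomial ones that `ring` can
check. -/
theorem exists_coords (h : FlippableQuad a b c d α β γ δ) : ∃ z u v : Fin 2 → ℝ, ∀ i,
    a i = z i + β * u i ∧ b i = z i - α * u i ∧ c i = z i + δ * v i ∧ d i = z i - γ * v i := by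
  have hc := h.cross
  have h1 := h.hαβ
  have h2 := h.hγδ
  refine ⟨fun i => α * a i + β * b i, fun i => a i - b i, fun i => c i - d i, fun i => ?_⟩
  have e := congrArg (fun x : Plane => x i) hc
  simp only [PiLp.add_apply, PiLp.smul_apply, smul_eq_mul] at e
  refine ⟨?_, ?_, ?_, ?_⟩
  · linear_combination (-a i) * h1
  · linear_combination (-b i) * h1
  · linear_combination (-c i) * h2 - e
  · linear_combination (-d i) * h2 - e

/-- X is the cross product of the diagonals, twice the area of the quadrilateral; each triangle
takes the share given by the ratio in which the crossing point divides the other diagonal. The last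
equation is Lagrange's identity. -/
theorem orients (h : FlippableQuad a b c d α β γ δ) : ∃ X : ℝ, 0 < X ∧ orient a b c = δ * X ∧
    orient a b d = -(γ * X) ∧ orient a c d = -(β * X) ∧ orient b c d = α * X ∧
    X ^ 2 = dist a b ^ 2 * dist c d ^ 2 -
      ((a 0 - b 0) * (c 0 - d 0) + (a 1 - b 1) * (c 1 - d 1)) ^ 2 := by
  obtain ⟨z, u, v, huv⟩ := h.exists_coords
  obtain ⟨a0, b0, c0, d0⟩ := huv 0
  obtain ⟨a1, b1, c1, d1⟩ := huv 1
  have h1 := h.hαβ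
  have h2 := h.hγδ
  obtain rfl : α = 1 - β := by linarith
  obtain rfl : γ = 1 - δ := by linarith
  have key : orient a b c = δ * (v 0 * u 1 - v 1 * u 0) := by
    simp only [orient, a0, b0, c0, a1, b1, c1]; ring
  refine ⟨v 0 * u 1 - v 1 * u 0, ?_, key, ?_, ?_, ?_, ?_⟩
  · have := h.orient_pos
    rw [key] at this
    exact pos_of_mul_pos_right this h.hδ.le
  all_goals
    simp only [dist_sq_plane, orient, a0, b0, c0, d0, a1, b1, c1, d1]
    ring

open Classical in
theorem radiusWeight_two_lt (h : FlippableQuad a b c d α β γ δ) :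
    radiusWeight 2 {a, c, d} + radiusWeight 2 {b, c, d} <
      radiusWeight 2 {a, b, c} + radiusWeight 2 {a, b, d} := by
  obtain ⟨X, hX, h1, h2, h3, h4, hX2⟩ := h.orients
  obtain ⟨hα, hβ, hγ, hδ, hαβ, hγδ, -, -, hP⟩ := id h
  have p1 : 0 < δ * X := by positivity
  have p2 : 0 < γ * X := by positivity
  have p3 : 0 < β * X := by positivity
  have p4 : 0 < α * X := by positivity
  rw [radiusWeight_two (by rw [h3]; linarith), radiusWeight_two (by rw [h4]; exact p4.ne'),
    radiusWeight_two (by rw [h1]; exact p1.ne'), radiusWeight_two (by rw [h2]; linarith),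
    h1, h2, h3, h4, abs_neg, abs_neg, abs_of_pos p1, abs_of_pos p2, abs_of_pos p3, abs_of_pos p4]
  set P := α * β * dist a b ^ 2 with hPdef
  set Q := γ * δ * dist c d ^ 2 with hQdef
  have hP0 : 0 ≤ P := by positivity
  have hQ0 : 0 ≤ Q := by positivity
  -- Up to the factor 8αβγδX this is the difference of the weights before and after the flip. Its
  -- sign is the sign of P - Q.
  have key : α * β * dist a b ^ 2 * (γ * (dist b c * dist c a) ^ 2 + δ * (dist b d * dist d a) ^ 2) -
      γ * δ * dist c d ^ 2 * (α * (dist a c * dist d a) ^ 2 + β * (dist b c * dist d b) ^ 2) =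
      (P - Q) * ((P - Q) ^ 2 + 4 * (α * β * γ * δ) * X ^ 2) := by
    rw [hPdef, hQdef, hX2]
    obtain ⟨z, u, v, huv⟩ := h.exists_coords
    obtain ⟨a0, b0, c0, d0⟩ := huv 0
    obtain ⟨a1, b1, c1, d1⟩ := huv 1
    clear_value P Q
    simp only [mul_pow, dist_sq_plane, a0, b0, c0, d0, a1, b1, c1, d1]
    obtain rfl : α = 1 - β := by linarith
    obtain rfl : γ = 1 - δ := by linarith
    ring
  have hpos : 0 < (P - Q) * ((P - Q) ^ 2 + 4 * (α * β * γ * δ) * X ^ 2) := by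
    have : 0 < P - Q := by linarith
    positivity
  rw [← key] at hpos
  rw [← sub_pos]
  have : (dist a b * dist b c * dist c a) ^ 2 / (8 * (δ * X)) +
      (dist a b * dist b d * dist d a) ^ 2 / (8 * (γ * X)) -
      ((dist a c * dist c d * dist d a) ^ 2 / (8 * (β * X)) +
      (dist b c * dist c d * dist d b) ^ 2 / (8 * (α * X))) =
      (α * β * dist a b ^ 2 * (γ * (dist b c * dist c a) ^ 2 + δ * (dist b d * dist d a) ^ 2) -
      γ * δ * dist c d ^ 2 * (α * (dist a c * dist d a) ^ 2 + β * (dist b c * dist d b) ^ 2)) /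
        (8 * (α * β * γ * δ) * X) := by
    field_simp
  rw [this]
  positivity

open Classical in
theorem radiusWeight_one_lt (h : FlippableQuad a b c d α β γ δ) :
    radiusWeight 1 {a, c, d} + radiusWeight 1 {b, c, d} <
      radiusWeight 1 {a, b, c} + radiusWeight 1 {a, b, d} := by
  obtain ⟨X, hX, h1, h2, h3, h4, -⟩ := h.orients
  obtain ⟨hα, hβ, hγ, hδ, hαβ, hγδ, -, -, hP⟩ := id h
  have p1 : 0 < δ * X := by positivity
  have p2 : 0 < γ * X := by positivity
  have p3 : 0 < β * X := by positivity
  have p4 : 0 < α * X := by positivity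
  have n1 : orient a b c ≠ 0 := by rw [h1]; exact p1.ne'
  have n2 : orient a b d ≠ 0 := by rw [h2]; linarith
  have n3 : orient a c d ≠ 0 := by rw [h3]; linarith
  have n4 : orient b c d ≠ 0 := by rw [h4]; exact p4.ne'
  rw [radiusWeight_one n1, radiusWeight_one n2, radiusWeight_one n3, radiusWeight_one n4]
  have hab := dist_pos.2 (ne_of_orient_ne_zero n1).1
  have hac := dist_pos.2 (ne_of_orient_ne_zero n1).2.1
  have hbc := dist_pos.2 (ne_of_orient_ne_zero n1).2.2
  have had := dist_pos.2 (ne_of_orient_ne_zero n2).2.1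
  have hbd := dist_pos.2 (ne_of_orient_ne_zero n2).2.2
  obtain ⟨z, u, v, huv⟩ := h.exists_coords
  obtain ⟨a0, b0, c0, d0⟩ := huv 0
  obtain ⟨a1, b1, c1, d1⟩ := huv 1
  -- dot product and cross product at the apex
  have dot : ∀ x y w : Plane, dist x y ^ 2 = dist x w ^ 2 + dist y w ^ 2 -
      2 * ((x 0 - w 0) * (y 0 - w 0) + (x 1 - w 1) * (y 1 - w 1)) := fun x y w => by
    simp only [dist_sq_plane]; ring
  have lagr : ∀ x y w : Plane, (dist x w * dist y w) ^ 2 =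
      ((x 0 - w 0) * (y 0 - w 0) + (x 1 - w 1) * (y 1 - w 1)) ^ 2 + orient w x y ^ 2 :=
    fun x y w => by
      simp only [dist_sq_plane, mul_pow, orient]; ring
  have o1 : orient c a b ^ 2 = (δ * X) ^ 2 := by rw [← orient_rotate, h1]
  have o2 : orient d a b ^ 2 = (γ * X) ^ 2 := by rw [← orient_rotate, h2, neg_sq]
  have o3 : orient a c d ^ 2 = (β * X) ^ 2 := by rw [h3, neg_sq]
  have o4 : orient b c d ^ 2 = (α * X) ^ 2 := by rw [h4]
  have l1 := lagr a b c
  have l2 := lagr a b d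
  have l3 := lagr c d a
  have l4 := lagr c d b
  rw [o1] at l1
  rw [o2] at l2
  rw [o3] at l3
  rw [o4] at l4
  have k1 := dot a b c
  have k2 := dot a b d
  have k3 := dot c d a
  have k4 := dot c d b
  have hα1 : α = 1 - β := by linarith
  have hγ1 : γ = 1 - δ := by linarith
  have hXP := mul_lt_mul_of_pos_left hP hX
  rw [dist_sq_plane a b, dist_sq_plane c d] at hXP
  -- Both left sides equal X(Q - P), where P = αβ|ab|² and Q = γδ|cd|². This says that the angles at
  -- `c` and `d` add up to more than π, and, through the supplementary angles in `hs2`, that those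
  -- at `a` and `b` add up to less than π.
  have hs1 : ((a 0 - c 0) * (b 0 - c 0) + (a 1 - c 1) * (b 1 - c 1)) * (γ * X) +
      ((a 0 - d 0) * (b 0 - d 0) + (a 1 - d 1) * (b 1 - d 1)) * (δ * X) < 0 := by
    refine lt_of_eq_of_lt ?_ (sub_neg_of_lt hXP)
    simp only [a0, b0, c0, d0, a1, b1, c1, d1]
    rw [hα1, hγ1]
    ring
  have hs2 : -((c 0 - a 0) * (d 0 - a 0) + (c 1 - a 1) * (d 1 - a 1)) * (α * X) +
      -((c 0 - b 0) * (d 0 - b 0) + (c 1 - b 1) * (d 1 - b 1)) * (β * X) < 0 := by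
    refine lt_of_eq_of_lt ?_ (sub_neg_of_lt hXP)
    simp only [a0, b0, c0, d0, a1, b1, c1, d1]
    rw [hα1, hγ1]
    ring
  simp only [dist_comm d a, dist_comm c a, dist_comm d b, dist_comm c b] at *
  clear a0 b0 c0 d0 a1 b1 c1 d1 hXP hP
  generalize (a 0 - c 0) * (b 0 - c 0) + (a 1 - c 1) * (b 1 - c 1) = i₁ at *
  generalize (a 0 - d 0) * (b 0 - d 0) + (a 1 - d 1) * (b 1 - d 1) = i₂ at *
  generalize (c 0 - a 0) * (d 0 - a 0) + (c 1 - a 1) * (d 1 - a 1) = i₃ at *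
  generalize (c 0 - b 0) * (d 0 - b 0) + (c 1 - b 1) * (d 1 - b 1) = i₄ at *
  have s1 := cos_sum_neg (mul_pos hac hbc) (mul_pos had hbd) p1 p2 l1 l2 hs1
  have s2 := cos_sum_neg (mul_pos hac had) (mul_pos hbc hbd) p3 p4
    (by rw [l3, neg_sq]) (by rw [l4, neg_sq]) hs2
  have := diagonal_products_lt (i₂ := i₂) hac hbc hbd had hab k1 (by linarith) k3 k4
    (by linarith) (by linarith)
  linarith

end FlippableQuad

/-! ### Generic points and triangulations as sets of triangles. -/

open Filter Topology

/-- A point is generic with respect to `S` if it is on no line through two points of `S`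
(and is not itself a point of `S`). -/
def IsGeneric (S : Finset Plane) (x : Plane) : Prop :=
  ∀ p ∈ S, ∀ q ∈ S, x ∉ line[ℝ, p, q]

theorem IsGeneric.notMem_convexHull {S e : Finset Plane} {x : Plane} (h : IsGeneric S x)
    (he : e ⊆ S) (hc : e.card ≤ 2) : x ∉ convexHull ℝ (e : Set Plane) := by
  classical
  intro hx
  have hx' := convexHull_subset_affineSpan _ hx
  interval_cases hcard : e.card
  · rw [Finset.card_eq_zero] at hcard
    subst hcard
    simp at hx
  · obtain ⟨p, rfl⟩ := Finset.card_eq_one.1 hcard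
    have hp := he (Finset.mem_singleton_self p)
    refine h p hp p hp ?_
    simpa using hx'
  · obtain ⟨p, q, -, rfl⟩ := Finset.card_eq_two.1 hcard
    refine h p (he (by simp)) q (he (by simp)) ?_
    simpa using hx'

theorem line_ne_top (p q : Plane) : line[ℝ, p, q] ≠ ⊤ := by
  intro h
  have h1 : vectorSpan ℝ ({p, q} : Set Plane) = ⊤ := by
    rw [← direction_affineSpan, h, AffineSubspace.direction_top]
  have h2 := collinear_iff_finrank_le_one.1 (collinear_pair ℝ p q)
  rw [h1, finrank_top] at h2
  simp at h2

theorem volume_line (p q : Plane) :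
    MeasureTheory.volume ((affineSpan ℝ {p, q} : AffineSubspace ℝ Plane) : Set Plane) = 0 :=
  MeasureTheory.Measure.addHaar_affineSubspace _ _ (line_ne_top p q)

theorem volume_not_isGeneric (S : Finset Plane) :
    MeasureTheory.volume {x | ¬ IsGeneric S x} = 0 := by
  have : {x | ¬ IsGeneric S x} = ⋃ p ∈ S, ⋃ q ∈ S, (line[ℝ, p, q] : Set Plane) := by
    ext x
    simp [IsGeneric]
  rw [this]
  refine (MeasureTheory.measure_biUnion_null_iff S.countable_toSet).2 fun p _ =>
    (MeasureTheory.measure_biUnion_null_iff S.countable_toSet).2 fun q _ => ?_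
  exact volume_line p q

theorem volume_convexHull_pos {t : Finset Plane} (ht : IsTriangle t) :
    0 < MeasureTheory.volume (convexHull ℝ (t : Set Plane)) := by
  have h := ht.area_pos
  rw [triangleArea] at h
  by_contra h0
  rw [nonpos_iff_eq_zero.1 (not_lt.1 h0)] at h
  simp at h

theorem IsTriangle.exists_generic {t : Finset Plane} (ht : IsTriangle t) (S : Finset Plane) :
    ∃ x ∈ convexHull ℝ (t : Set Plane), IsGeneric S x := by
  by_contra! h
  have := MeasureTheory.measure_mono_null (fun x hx => h x hx) (volume_not_isGeneric S)
  exact (volume_convexHull_pos ht).ne' this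

/-- A line spanned by `S` that passes through `y` meets the segment only in `y`, as `x` is off the
line; a line missing `y` is closed and so stays away from a neighbourhood of `y`. -/
theorem IsGeneric.eventually_lineMap {S : Finset Plane} {x : Plane} (hx : IsGeneric S x)
    (y : Plane) : ∀ᶠ τ in 𝓝[>] (0 : ℝ), IsGeneric S (AffineMap.lineMap y x τ) := by
  simp only [IsGeneric, Finset.eventually_all]
  intro p hp q hq
  by_cases hy : y ∈ line[ℝ, p, q]
  · filter_upwards [self_mem_nhdsWithin] with τ hτ hmem
    apply hx p hp q hq
    have : x = AffineMap.lineMap y (AffineMap.lineMap y x τ : Plane) τ⁻¹ := by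
      have hτ' : τ ≠ 0 := ne_of_gt hτ
      simp only [AffineMap.lineMap_apply, vsub_eq_sub, vadd_eq_add, add_sub_cancel_right, smul_smul,
        inv_mul_cancel₀ hτ', one_smul, sub_add_cancel]
    rw [this]
    exact AffineMap.lineMap_mem _ hy hmem
  · have hcl : IsClosed (line[ℝ, p, q] : Set Plane) := AffineSubspace.closed_of_finiteDimensional _
    have hcont : Continuous (fun τ : ℝ => (AffineMap.lineMap y x τ : Plane)) :=
      AffineMap.lineMap_continuous
    have : ∀ᶠ τ in 𝓝 (0 : ℝ), (AffineMap.lineMap y x τ : Plane) ∈ (line[ℝ, p, q] : Set Plane)ᶜ := by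
      apply hcont.continuousAt.eventually
      apply hcl.isOpen_compl.mem_nhds
      simpa using hy
    exact this.filter_mono nhdsWithin_le_nhds

/-- A set of triangles which form a triangulation of the convex hull of `S`, up to the points
which are not generic. -/
structure IsTriangulation (S : Finset Plane) (T : Finset (Finset Plane)) : Prop where
  subset : ∀ t ∈ T, t ⊆ S
  isTriangle : ∀ t ∈ T, IsTriangle t
  inter : ∀ t ∈ T, ∀ t' ∈ T, convexHull ℝ (t : Set Plane) ∩ convexHull ℝ (t' : Set Plane) ⊆
    convexHull ℝ ((t : Set Plane) ∩ t')
  mem_of_mem_convexHull : ∀ t ∈ T, ∀ q ∈ S, q ∈ convexHull ℝ (t : Set Plane) → q ∈ t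
  cover : ∀ x ∈ convexHull ℝ (S : Set Plane), IsGeneric S x →
    ∃ t ∈ T, x ∈ convexHull ℝ (t : Set Plane)

theorem card_le_three_of_affineIndependent {t : Finset Plane}
    (ht : AffineIndependent ℝ ((↑) : t → Plane)) : t.card ≤ 3 := by
  have := ht.card_le_finrank_succ
  have h2 := Submodule.finrank_le (vectorSpan ℝ (Set.range ((↑) : t → Plane)))
  simp at this h2
  omega

theorem GeometricTriangulation.isTriangulation {S : Finset Plane} (K : GeometricTriangulation S) :
    IsTriangulation S K.triangles := by
  have hsub : ∀ t ∈ K.faces, t ⊆ S := fun t ht p hp => by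
    have hp' : p ∈ K.toSimplicialComplex.vertices :=
      K.down_closed ht (Finset.singleton_subset_iff.2 hp) (Finset.singleton_nonempty p)
    rw [K.vertices_eq] at hp'
    exact hp'
  refine ⟨fun t ht => hsub t ((K.mem_triangles t).1 ht).1, fun t ht => ?_, fun t ht t' ht' => ?_,
    fun t ht q hq hqt => ?_, fun x hx hgen => ?_⟩
  · obtain ⟨h1, h2⟩ := (K.mem_triangles t).1 ht
    exact ⟨h2, K.indep h1⟩
  · exact K.inter_subset_convexHull ((K.mem_triangles t).1 ht).1 ((K.mem_triangles t').1 ht').1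
  · have hq' : q ∈ K.toSimplicialComplex.vertices := by rw [K.vertices_eq]; exact hq
    have := K.inter_subset_convexHull hq' ((K.mem_triangles t).1 ht).1
      ⟨subset_convexHull ℝ _ (by simp), hqt⟩
    have hne : (convexHull ℝ ((({q} : Finset Plane) : Set Plane) ∩ t)).Nonempty := ⟨q, this⟩
    rw [convexHull_nonempty_iff] at hne
    obtain ⟨p, hp, hp'⟩ := hne
    simp only [Finset.coe_singleton, Set.mem_singleton_iff] at hp
    exact hp ▸ hp'
  · rw [← K.space_eq, Geometry.SimplicialComplex.mem_space_iff] at hx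
    obtain ⟨t, ht, hxt⟩ := hx
    have h3 := card_le_three_of_affineIndependent (K.indep ht)
    refine ⟨t, (K.mem_triangles t).2 ⟨ht, ?_⟩, hxt⟩
    by_contra h
    exact hgen.notMem_convexHull (hsub t ht) (by omega) hxt

namespace IsTriangulation

variable {S : Finset Plane} {T T' : Finset (Finset Plane)}

/-- Coverage of generic points implies coverage of all points: the union of the triangles is closed,
and `y` is a limit of generic points on the segment to `x`. -/
theorem exists_mem_of_generic (hT : IsTriangulation S T) {x : Plane}
    (hx : x ∈ convexHull ℝ (S : Set Plane)) (hgen : IsGeneric S x) {y : Plane}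
    (hy : y ∈ convexHull ℝ (S : Set Plane)) : ∃ t ∈ T, y ∈ convexHull ℝ (t : Set Plane) := by
  have hcl : IsClosed (⋃ t ∈ T, convexHull ℝ (t : Set Plane)) :=
    T.finite_toSet.isClosed_biUnion fun t _ => (t.finite_toSet.isCompact_convexHull ℝ).isClosed
  have hev : ∀ᶠ τ in 𝓝[>] (0 : ℝ), AffineMap.lineMap y x τ ∈ ⋃ t ∈ T, convexHull ℝ (t : Set Plane) := by
    filter_upwards [hgen.eventually_lineMap y, Ioo_mem_nhdsGT (zero_lt_one (α := ℝ))] with τ h1 h2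
    have := (convex_convexHull ℝ (S : Set Plane)).lineMap_mem hy hx ⟨h2.1.le, h2.2.le⟩
    obtain ⟨t, ht, hxt⟩ := hT.cover _ this h1
    exact Set.mem_biUnion ht hxt
  have hlim : Tendsto (fun τ : ℝ => (AffineMap.lineMap y x τ : Plane)) (𝓝[>] 0) (𝓝 y) := by
    have : Tendsto (fun τ : ℝ => (AffineMap.lineMap y x τ : Plane)) (𝓝 0) (𝓝 (AffineMap.lineMap y x (0 : ℝ))) :=
      AffineMap.lineMap_continuous.tendsto 0
    rw [AffineMap.lineMap_apply_zero] at this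
    exact this.mono_left nhdsWithin_le_nhds
  have := hcl.mem_of_tendsto hlim hev
  simpa using this

/-- The triangle `t` only serves to supply a generic point in the hull of `S`. For collinear `S` no
point of the hull is generic, and the empty family is a triangulation in this sense. -/
theorem exists_mem (hT : IsTriangulation S T) {t : Finset Plane} (ht : IsTriangle t) (hS : t ⊆ S)
    {y : Plane} (hy : y ∈ convexHull ℝ (S : Set Plane)) :
    ∃ t ∈ T, y ∈ convexHull ℝ (t : Set Plane) := by
  obtain ⟨x, hx, hgen⟩ := ht.exists_generic S
  exact hT.exists_mem_of_generic (convexHull_mono (by exact_mod_cast hS) hx) hgen hy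

theorem card_inter_lt {t t' : Finset Plane} (ht : IsTriangle t) (ht' : IsTriangle t') (hne : t ≠ t') :
    ∃ e ⊆ t, (e : Set Plane) = (t : Set Plane) ∩ t' ∧ e.card ≤ 2 := by
  classical
  refine ⟨t ∩ t', Finset.inter_subset_left, by simp, ?_⟩
  by_contra h
  push Not at h
  have h1 : t ∩ t' = t := Finset.eq_of_subset_of_card_le Finset.inter_subset_left (by rw [ht.1]; omega)
  have h2 : t ∩ t' = t' := Finset.eq_of_subset_of_card_le Finset.inter_subset_right (by rw [ht'.1]; omega)
  exact hne (h1.symm.trans h2)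

theorem eq_of_generic_mem (hT : IsTriangulation S T) {t t' : Finset Plane} (ht : t ∈ T) (ht' : t' ∈ T)
    {x : Plane} (hx : IsGeneric S x) (hxt : x ∈ convexHull ℝ (t : Set Plane))
    (hxt' : x ∈ convexHull ℝ (t' : Set Plane)) : t = t' := by
  by_contra hne
  obtain ⟨e, he, he', hc⟩ := card_inter_lt (hT.isTriangle t ht) (hT.isTriangle t' ht') hne
  have := hT.inter t ht t' ht' ⟨hxt, hxt'⟩
  rw [← he'] at this
  exact hx.notMem_convexHull (he.trans (hT.subset t ht)) hc this

open MeasureTheory in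
-- The pieces cover `t` and are pairwise disjoint apart from nongeneric points, which form a null
-- set. Applied to two triangulations, this gives their common refinement.
theorem area_eq_sum_inter (hT : IsTriangulation S T) {t : Finset Plane} (hS : t ⊆ S) :
    triangleArea t =
      ∑ t' ∈ T, volume.real (convexHull ℝ (t : Set Plane) ∩ convexHull ℝ (t' : Set Plane)) := by
  have hfin : ∀ s : Finset Plane, volume (convexHull ℝ (s : Set Plane)) ≠ ⊤ := fun s =>
    (s.finite_toSet.isCompact_convexHull ℝ).measure_lt_top.ne
  have hm : ∀ s : Finset Plane, MeasurableSet (convexHull ℝ (s : Set Plane)) := fun s =>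
    (s.finite_toSet.isCompact_convexHull ℝ).isClosed.measurableSet
  rw [← measureReal_biUnion_finset₀ (h := fun t' _ => measure_ne_top_of_subset Set.inter_subset_left (hfin t))]
  · rw [triangleArea, ← measureReal_def]
    refine measureReal_congr ?_
    have hae : ∀ᵐ x ∂(volume : Measure Plane), IsGeneric S x := volume_not_isGeneric S
    filter_upwards [hae] with x hx
    apply propext
    change x ∈ convexHull ℝ (t : Set Plane) ↔ x ∈ ⋃ t' ∈ T, (convexHull ℝ (t : Set Plane) ∩ convexHull ℝ (t' : Set Plane))
    simp only [Set.mem_iUnion, Set.mem_inter_iff, exists_prop]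
    constructor
    · intro h
      obtain ⟨t', ht', h'⟩ := hT.cover x (convexHull_mono (by exact_mod_cast hS) h) hx
      exact ⟨t', ht', h, h'⟩
    · rintro ⟨t', -, h, -⟩
      exact h
  · intro t₁ h₁ t₂ h₂ hne
    refine measure_mono_null ?_ (volume_not_isGeneric S)
    rintro x ⟨⟨-, hx1⟩, -, hx2⟩ hgen
    exact hne (hT.eq_of_generic_mem h₁ h₂ hgen hx1 hx2)
  · exact fun t' _ => ((hm t).inter (hm t')).nullMeasurableSet

/-- Two triangulations have the same weighted area if the weights agree on overlapping triangles. -/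
theorem sum_eq_sum (hT : IsTriangulation S T) (hT' : IsTriangulation S T') (f : Finset Plane → ℝ)
    (h : ∀ t ∈ T, ∀ t' ∈ T', ∀ x, IsGeneric S x → x ∈ convexHull ℝ (t : Set Plane) →
      x ∈ convexHull ℝ (t' : Set Plane) → f t = f t') :
    ∑ t ∈ T, f t * triangleArea t = ∑ t ∈ T', f t * triangleArea t := by
  have h1 : ∀ t ∈ T, f t * triangleArea t = ∑ t' ∈ T', f t * MeasureTheory.volume.real
      (convexHull ℝ (t : Set Plane) ∩ convexHull ℝ (t' : Set Plane)) := fun t ht => by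
    rw [hT'.area_eq_sum_inter (hT.subset t ht), Finset.mul_sum]
  have h2 : ∀ t' ∈ T', f t' * triangleArea t' = ∑ t ∈ T, f t' * MeasureTheory.volume.real
      (convexHull ℝ (t' : Set Plane) ∩ convexHull ℝ (t : Set Plane)) := fun t ht => by
    rw [hT.area_eq_sum_inter (hT'.subset t ht), Finset.mul_sum]
  rw [Finset.sum_congr rfl h1, Finset.sum_congr rfl h2, Finset.sum_comm]
  refine Finset.sum_congr rfl fun t' ht' => Finset.sum_congr rfl fun t ht => ?_
  rw [Set.inter_comm]
  -- Without a generic common point the intersection is null, and the weights of the two triangles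
  -- do not matter.
  by_cases hx : ∃ x ∈ convexHull ℝ (t' : Set Plane) ∩ convexHull ℝ (t : Set Plane), IsGeneric S x
  · obtain ⟨x, ⟨hx1, hx2⟩, hgen⟩ := hx
    rw [h t ht t' ht' x hgen hx2 hx1]
  · push Not at hx
    have : MeasureTheory.volume.real
      (convexHull ℝ (t' : Set Plane) ∩ convexHull ℝ (t : Set Plane)) = 0 := by
      rw [MeasureTheory.measureReal_def, MeasureTheory.measure_mono_null hx (volume_not_isGeneric S)]
      rfl
    rw [this, mul_zero, mul_zero]

end IsTriangulation

/-! ### Powers of points and the comparison of Delaunay triangulations. -/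

/-- The power of a point with respect to a circle is an affine function plus a function which
does not depend on the circle. -/
theorem sum_power_sub_power {ι : Type*} (s : Finset ι) (w : ι → ℝ) (p : ι → Plane) (x o o' : Plane)
    (r r' : ℝ) (h1 : ∑ i ∈ s, w i = 1) (hx : ∑ i ∈ s, w i • p i = x) :
    ∑ i ∈ s, w i * ((dist (p i) o ^ 2 - r ^ 2) - (dist (p i) o' ^ 2 - r' ^ 2)) =
      (dist x o ^ 2 - r ^ 2) - (dist x o' ^ 2 - r' ^ 2) := by
  have h0 : ∑ i ∈ s, w i * p i 0 = x 0 := by rw [← hx]; simp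
  have h2 : ∑ i ∈ s, w i * p i 1 = x 1 := by rw [← hx]; simp
  have key : ∀ y : Plane, (dist y o ^ 2 - r ^ 2) - (dist y o' ^ 2 - r' ^ 2) =
      (o 0 ^ 2 + o 1 ^ 2 - r ^ 2 - o' 0 ^ 2 - o' 1 ^ 2 + r' ^ 2) + 2 * (o' 0 - o 0) * y 0 +
        2 * (o' 1 - o 1) * y 1 := fun y => by
    simp only [dist_sq_plane]; ring
  generalize hk : o 0 ^ 2 + o 1 ^ 2 - r ^ 2 - o' 0 ^ 2 - o' 1 ^ 2 + r' ^ 2 = k at key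
  simp only [key, mul_add, Finset.sum_add_distrib]
  rw [← Finset.sum_mul, h1, one_mul, ← h0, ← h2, Finset.mul_sum, Finset.mul_sum]
  congr 1
  · congr 1
    exact Finset.sum_congr rfl fun i _ => by ring
  · exact Finset.sum_congr rfl fun i _ => by ring

/-- Two triangles with empty circumcircles which share a generic point are cocircular. -/
theorem dist_eq_of_common_point {S t t' : Finset Plane} {o o' : Plane} {r r' : ℝ}
    (ht'3 : t'.card = 3) (htS' : t' ⊆ S) (h : ∀ p ∈ t, dist p o = r)
    (h' : ∀ p ∈ t', dist p o' = r') (he : ∀ p ∈ t', r ≤ dist p o) (he' : ∀ p ∈ t, r' ≤ dist p o')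
    {x : Plane} (hgen : IsGeneric S x) (hx : x ∈ convexHull ℝ (t : Set Plane))
    (hx' : x ∈ convexHull ℝ (t' : Set Plane)) : ∀ p ∈ t', dist p o = r := by
  classical
  have hxx := hx'
  rw [Finset.mem_convexHull'] at hx hx'
  obtain ⟨w, hw0, hw1, hwx⟩ := hx
  obtain ⟨w', hw0', hw1', hwx'⟩ := hx'
  have hne : t.Nonempty := by
    by_contra hne
    rw [Finset.not_nonempty_iff_eq_empty] at hne
    simp [hne] at hw1
  have hne' : t'.Nonempty := Finset.card_pos.1 (by omega)
  have hr : 0 ≤ r := by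
    obtain ⟨p, hp⟩ := hne
    exact h p hp ▸ dist_nonneg
  have hr' : 0 ≤ r' := by
    obtain ⟨p, hp⟩ := hne'
    exact h' p hp ▸ dist_nonneg
  have e1 := sum_power_sub_power t w (fun p => p) x o o' r r' hw1 hwx
  have e2 := sum_power_sub_power t' w' (fun p => p) x o o' r r' hw1' hwx'
  -- The difference of the powers with respect to the two circles is affine, at most 0 on the
  -- vertices of `t` and at least 0 on those of `t'`. So it vanishes at `x`, and every term of the
  -- sum over `t'` vanishes.
  have f1 : ∑ i ∈ t, w i * ((dist i o ^ 2 - r ^ 2) - (dist i o' ^ 2 - r' ^ 2)) ≤ 0 := by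
    refine Finset.sum_nonpos fun p hp => mul_nonpos_of_nonneg_of_nonpos (hw0 p hp) ?_
    have := pow_le_pow_left₀ hr' (he' p hp) 2
    rw [h p hp]
    linarith
  have f2 : ∀ p ∈ t', 0 ≤ w' p * ((dist p o ^ 2 - r ^ 2) - (dist p o' ^ 2 - r' ^ 2)) := by
    refine fun p hp => mul_nonneg (hw0' p hp) ?_
    have := pow_le_pow_left₀ hr (he p hp) 2
    rw [h' p hp]
    linarith
  have f3 : ∑ i ∈ t', w' i * ((dist i o ^ 2 - r ^ 2) - (dist i o' ^ 2 - r' ^ 2)) = 0 :=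
    le_antisymm (by rw [e2, ← e1]; exact f1) (Finset.sum_nonneg f2)
  rw [Finset.sum_eq_zero_iff_of_nonneg f2] at f3
  intro p hp
  -- A zero weight would put `x` on an edge of `t'`, against genericity.
  have hwp : w' p ≠ 0 := by
    intro h0
    refine hgen.notMem_convexHull (e := t'.erase p) ((Finset.erase_subset _ _).trans htS')
      (by rw [Finset.card_erase_of_mem hp]; omega) ?_
    rw [Finset.mem_convexHull']
    refine ⟨w', fun y hy => hw0' y (Finset.mem_of_mem_erase hy), ?_, ?_⟩
    · rw [← hw1', ← Finset.add_sum_erase _ _ hp, h0, zero_add]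
    · rw [← hwx', ← Finset.add_sum_erase _ _ hp, h0, zero_smul, zero_add]
  have := (mul_eq_zero.1 (f3 p hp)).resolve_left hwp
  rw [h' p hp] at this
  rw [← sq_eq_sq₀ dist_nonneg hr]
  linarith

theorem mem_delaunayTriangles {S t : Finset Plane} :
    t ∈ delaunayTriangles S ↔ t ⊆ S ∧ IsTriangle t ∧
      ∃ (c : Plane) (r : ℝ), (∀ p ∈ t, dist p c = r) ∧ ∀ q ∈ S, r ≤ dist q c := by
  classical
  simp only [delaunayTriangles, Finset.mem_filter, Finset.mem_powersetCard, IsTriangle]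
  tauto

theorem exists_circle_of_common_point {S t t' : Finset Plane} (ht : t ∈ delaunayTriangles S)
    (ht' : t' ∈ delaunayTriangles S) {x : Plane} (hgen : IsGeneric S x)
    (hx : x ∈ convexHull ℝ (t : Set Plane)) (hx' : x ∈ convexHull ℝ (t' : Set Plane)) :
    ∃ (c : Plane) (r : ℝ), (∀ p ∈ t, dist p c = r) ∧ ∀ p ∈ t', dist p c = r := by
  obtain ⟨hS, -, o, r, h, he⟩ := mem_delaunayTriangles.1 ht
  obtain ⟨hS', h3', o', r', h', he'⟩ := mem_delaunayTriangles.1 ht'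
  exact ⟨o, r, h, dist_eq_of_common_point h3'.1 hS' h h' (fun p hp => he p (hS' hp))
    (fun p hp => he' p (hS hp)) hgen hx hx'⟩

/-- Overlapping triangles of the two triangulations are cocircular and so have the same
circumradius. Both sums are then integrals of one function on the common refinement. -/
theorem sum_radiusWeight_eq_of_delaunay {S : Finset Plane} {T T' : Finset (Finset Plane)}
    (hT : IsTriangulation S T) (hT' : IsTriangulation S T') (hD : T ⊆ delaunayTriangles S)
    (hD' : T' ⊆ delaunayTriangles S) (α : ℝ) :
    ∑ t ∈ T, radiusWeight α t = ∑ t ∈ T', radiusWeight α t := by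
  refine hT.sum_eq_sum hT' (fun t => triangleCircumradius t ^ α) fun t ht t' ht' x hgen hx hx' => ?_
  obtain ⟨c, r, h, h'⟩ := exists_circle_of_common_point (hD ht) (hD' ht') hgen hx hx'
  rw [(hT.isTriangle t ht).circumradius_eq h, (hT'.isTriangle t' ht').circumradius_eq h']

/-- A generic point of an empty-circle triangle `t` lies in some `t'` of `T`. The two triangles lie
on one circle, so their union has at most three points and they coincide. -/
theorem triangles_eq_delaunayTriangles {S : Finset Plane} (hS : NoFourCocircular S)
    {T : Finset (Finset Plane)} (hT : IsTriangulation S T) (hD : T ⊆ delaunayTriangles S) :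
    T = delaunayTriangles S := by
  classical
  refine Finset.Subset.antisymm hD fun t ht => ?_
  obtain ⟨hS', h3, -⟩ := mem_delaunayTriangles.1 ht
  obtain ⟨x, hx, hgen⟩ := h3.exists_generic S
  obtain ⟨t', ht', hx'⟩ := hT.cover x (convexHull_mono (by exact_mod_cast hS') hx) hgen
  obtain ⟨c, r, h, h'⟩ := exists_circle_of_common_point ht (hD ht') hgen hx hx'
  have := hS c r (t ∪ t') (Finset.union_subset hS' (hT.subset t' ht')) (fun p hp => by
    rcases Finset.mem_union.1 hp with hp | hp
    exacts [h p hp, h' p hp])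
  have e1 : t = t ∪ t' := Finset.eq_of_subset_of_card_le Finset.subset_union_left (by rw [h3.1]; exact this)
  have e2 : t' = t ∪ t' := Finset.eq_of_subset_of_card_le Finset.subset_union_right
    (by rw [(hT.isTriangle t' ht').1]; exact this)
  rw [e1, ← e2]
  exact ht'

/-! ### A triangulation that is not Delaunay has a flippable edge. -/

theorem eventually_orient_nonneg {u v y q : Plane} (hu : 0 ≤ orient u v y)
    (huv : orient u v y = 0 → 0 ≤ orient u v q) :
    ∀ᶠ ε in 𝓝[>] (0 : ℝ), 0 ≤ orient u v (AffineMap.lineMap y q ε) := by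
  simp only [orient_lineMap]
  rcases hu.eq_or_lt with hu | hu
  · filter_upwards [self_mem_nhdsWithin] with ε hε
    rw [← hu, mul_zero, zero_add]
    exact mul_nonneg (le_of_lt hε) (huv hu.symm)
  · have hc : Tendsto (fun ε : ℝ => (1 - ε) * orient u v y + ε * orient u v q) (𝓝 0)
        (𝓝 ((1 - 0) * orient u v y + 0 * orient u v q)) := by
      apply Continuous.tendsto (f := fun ε : ℝ => (1 - ε) * orient u v y + ε * orient u v q)
      fun_prop
    have : (0 : ℝ) < (1 - 0) * orient u v y + 0 * orient u v q := by simpa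
    exact ((hc.eventually (lt_mem_nhds this)).mono fun ε hε => le_of_lt hε).filter_mono
      nhdsWithin_le_nhds

/-- If the segment from `y` to `q` crossed outward none of the edge lines through `y`, all three
inequalities defining the triangle would persist for a short time. -/
theorem exists_exit_edge {t : Finset Plane} (ht : IsTriangle t) {y q : Plane}
    (hy : y ∈ convexHull ℝ (t : Set Plane))
    (hexit : ¬ ∀ᶠ ε in 𝓝[>] (0 : ℝ), AffineMap.lineMap y q ε ∈ convexHull ℝ (t : Set Plane)) :
    ∃ a b c : Plane, (t : Set Plane) = {a, b, c} ∧ 0 < orient a b c ∧ orient a b y = 0 ∧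
      orient a b q < 0 := by
  obtain ⟨a, b, c, rfl, h⟩ := ht.exists_orient_pos
  by_contra! hcon
  apply hexit
  simp only [Finset.coe_insert, Finset.coe_singleton] at hy hcon ⊢
  rw [mem_convexHull_triple_iff_orient h] at hy
  obtain ⟨h1, h2, h3⟩ := hy
  have r1 : ({a, b, c} : Set Plane) = {b, c, a} := by ext z; simp; tauto
  have r2 : ({a, b, c} : Set Plane) = {c, a, b} := by ext z; simp; tauto
  have k1 := eventually_orient_nonneg (u := b) (v := c) (by rwa [orient_rotate])
    (fun h0 => hcon b c a r1 (by rwa [orient_rotate]) h0)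
  have k2 := eventually_orient_nonneg (u := c) (v := a) (by rwa [← orient_rotate])
    (fun h0 => hcon c a b r2 (by rwa [← orient_rotate]) h0)
  have k3 := eventually_orient_nonneg h3 (fun h0 => hcon a b c rfl h h0)
  filter_upwards [k1, k2, k3] with ε e1 e2 e3
  rw [mem_convexHull_triple_iff_orient h]
  exact ⟨by rwa [← orient_rotate], by rw [orient_rotate c a]; exact e2, e3⟩

theorem IsGeneric.lineMap_notMem {S : Finset Plane} {x q : Plane} (hx : IsGeneric S x) (hq : q ∈ S)
    {τ : ℝ} (hτ : τ < 1) : AffineMap.lineMap x q τ ∉ S := by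
  intro hy
  apply hx _ hy q hq
  have hτ' : 1 - τ ≠ 0 := by linarith
  have : x = AffineMap.lineMap q (AffineMap.lineMap x q τ : Plane) (1 - τ)⁻¹ := by
    rw [AffineMap.lineMap_apply_module, AffineMap.lineMap_apply_module, smul_add, smul_smul, smul_smul,
      inv_mul_cancel₀ hτ', one_smul]
    rw [add_left_comm, ← add_smul]
    have : (1 - (1 - τ)⁻¹ + (1 - τ)⁻¹ * τ) = 0 := by field_simp; ring
    rw [this, zero_smul, add_zero]
  have hmem : AffineMap.lineMap q (AffineMap.lineMap x q τ : Plane) (1 - τ)⁻¹ ∈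
      line[ℝ, (AffineMap.lineMap x q τ : Plane), q] :=
    AffineMap.lineMap_mem _ (right_mem_affineSpan_pair ℝ _ _) (left_mem_affineSpan_pair ℝ _ _)
  rwa [← this] at hmem

theorem dist_sq_combination (a b o : Plane) {α β : ℝ} (h : α + β = 1) :
    dist (α • a + β • b) o ^ 2 = α * dist a o ^ 2 + β * dist b o ^ 2 - α * β * dist a b ^ 2 := by
  obtain rfl : α = 1 - β := by linarith
  simp only [dist_sq_plane, PiLp.add_apply, PiLp.smul_apply, smul_eq_mul]
  ring

/-- An edge whose opposite vertices violate the circle condition is a diagonal of a convex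
quadrilateral. -/
theorem exists_flippableQuad {a b c d o : Plane} {r : ℝ} (hc : 0 < orient a b c)
    (hd : orient a b d < 0) (ha' : dist a o = r) (hb' : dist b o = r) (hc' : dist c o = r)
    (hd' : dist d o < r) : ∃ α β γ δ : ℝ, FlippableQuad a b c d α β γ δ := by
  set γ := -orient a b d / (orient a b c - orient a b d) with hγ
  set δ := orient a b c / (orient a b c - orient a b d) with hδ
  have hpos : 0 < orient a b c - orient a b d := by linarith
  have hγ0 : 0 < γ := div_pos (by linarith) hpos
  have hδ0 : 0 < δ := div_pos hc hpos
  have hγδ : γ + δ = 1 := by rw [hγ, hδ]; field_simp; ring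
  set z : Plane := γ • c + δ • d with hz
  have hz0 : orient a b z = 0 := by
    have := orient_combination₃ (p := a) (q := b) (a := a) (b := c) (c := d) (x := z)
      (α := 0) (β := γ) (γ := δ) (by linarith) (by simp [hz])
    rw [this, hγ, hδ]
    field_simp
    ring
  set α := orient z b c / orient a b c with hα
  set β := orient a z c / orient a b c with hβ
  have hcomb := orient_combination_eq z hc.ne'
  rw [hz0, zero_div, zero_smul, add_zero, ← hα, ← hβ] at hcomb
  have hαβ : α + β = 1 := by
    rw [hα, hβ, ← add_div, div_eq_one_iff_eq hc.ne', ← orient_add a b c z, hz0, add_zero]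
  -- The power of `z` is -αβ|ab|² when computed on the chord through `a`, `b`. Computed on `c d` it
  -- is less than -γδ|cd|², since `d` has negative power.
  have hpow : γ * δ * dist c d ^ 2 < α * β * dist a b ^ 2 := by
    have e1 := dist_sq_combination a b o hαβ
    have e2 := dist_sq_combination c d o hγδ
    rw [hcomb, ha', hb'] at e1
    rw [← hz, e1, hc'] at e2
    have h2 : dist d o ^ 2 < r ^ 2 := pow_lt_pow_left₀ hd' dist_nonneg two_ne_zero
    have h3 : α * r ^ 2 + β * r ^ 2 = r ^ 2 := by rw [← add_mul, hαβ, one_mul]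
    have h4 : γ * r ^ 2 + δ * r ^ 2 = r ^ 2 := by rw [← add_mul, hγδ, one_mul]
    have h5 := mul_lt_mul_of_pos_left h2 hδ0
    linarith
  -- Convexity is a consequence of `hpow`: the product αβ is positive and α + β = 1, so `z` lies
  -- strictly between `a` and `b`.
  have hαβ0 : 0 < α * β := by
    have : 0 < α * β * dist a b ^ 2 := lt_of_le_of_lt (by positivity) hpow
    exact pos_of_mul_pos_left this (by positivity)
  have hα0 : 0 < α := by
    by_contra h
    have : β < 0 := by
      by_contra h'
      nlinarith
    linarith
  exact ⟨α, β, γ, δ, hα0, pos_of_mul_pos_right hαβ0 hα0.le, hγ0, hδ0, hαβ, hγδ, hcomb, hc, hpow⟩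

namespace IsTriangulation

variable {S : Finset Plane} {T : Finset (Finset Plane)}

/-- A segment which leaves a triangle of a triangulation, and stays in the convex hull, enters
another triangle. -/
theorem exists_frequently_mem (hT : IsTriangulation S T) {t : Finset Plane} (ht : t ∈ T) {y q : Plane}
    (hy : y ∈ convexHull ℝ (S : Set Plane)) (hq : q ∈ convexHull ℝ (S : Set Plane)) :
    ∃ t' ∈ T, y ∈ convexHull ℝ (t' : Set Plane) ∧
      ∃ᶠ ε in 𝓝[>] (0 : ℝ), AffineMap.lineMap y q ε ∈ convexHull ℝ (t' : Set Plane) := by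
  have h1 : ∃ t' ∈ T, ∃ᶠ ε in 𝓝[>] (0 : ℝ), AffineMap.lineMap y q ε ∈ convexHull ℝ (t' : Set Plane) := by
    by_contra! h
    rw [← Finset.eventually_all] at h
    obtain ⟨ε, hε, h2⟩ := (h.and (Ioo_mem_nhdsGT (zero_lt_one (α := ℝ)))).exists
    obtain ⟨t', ht', hx⟩ := hT.exists_mem (hT.isTriangle t ht) (hT.subset t ht)
      ((convex_convexHull ℝ (S : Set Plane)).lineMap_mem hy hq ⟨h2.1.le, h2.2.le⟩)
    exact hε t' ht' hx
  obtain ⟨t', ht', hf⟩ := h1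
  refine ⟨t', ht', ?_, hf⟩
  have hlim : Tendsto (fun τ : ℝ => (AffineMap.lineMap y q τ : Plane)) (𝓝[>] 0) (𝓝 y) := by
    have : Tendsto (fun τ : ℝ => (AffineMap.lineMap y q τ : Plane)) (𝓝 0) (𝓝 (AffineMap.lineMap y q (0 : ℝ))) :=
      AffineMap.lineMap_continuous.tendsto 0
    rw [AffineMap.lineMap_apply_zero] at this
    exact this.mono_left nhdsWithin_le_nhds
  exact (t'.finite_toSet.isCompact_convexHull ℝ).isClosed.mem_of_frequently_of_tendsto hf hlim

open Classical in
-- Take `q` inside the circumcircle of some triangle and let `A` be the union of the triangles whose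
-- circumcircle gives `q` the least power. This power is negative, so `q` is a vertex of none of
-- them and is not in `A`. Walk from a generic point of `A` straight to `q`, and let `y` be the last
-- point in `A`. There the walk leaves a triangle `t` of `A` through an edge `a b` and enters a
-- triangle `t'` giving `q` a larger power. By genericity `y` is not a vertex, so `t'` contains `a`
-- and `b`. The difference of the two powers vanishes on the line `a b` and is positive at `q`,
-- hence also at the third vertex `d` of `t'` on the same side; so `d` is inside the circumcircle of
-- `t`.
theorem exists_flippable (hT : IsTriangulation S T) (hnd : ¬ T ⊆ delaunayTriangles S) :
    ∃ (a b c d : Plane) (α β γ δ : ℝ), FlippableQuad a b c d α β γ δ ∧ {a, b, c} ∈ T ∧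
      {a, b, d} ∈ T := by
  have hcirc : ∀ t ∈ T, ∃ o : Plane, ∀ p ∈ t, dist p o = triangleCircumradius t :=
    fun t ht => (hT.isTriangle t ht).exists_circumcircle
  choose! o ho using hcirc
  obtain ⟨t₀, ht₀, hbad⟩ := Finset.not_subset.1 hnd
  have hbad' : ∃ q ∈ S, dist q (o t₀) < triangleCircumradius t₀ := by
    by_contra! h
    exact hbad (mem_delaunayTriangles.2 ⟨hT.subset t₀ ht₀, hT.isTriangle t₀ ht₀, o t₀, _, ho t₀ ht₀, h⟩)
  obtain ⟨q, hqS, hq⟩ := hbad'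
  set pw : Finset Plane → ℝ := fun t => dist q (o t) ^ 2 - triangleCircumradius t ^ 2 with hpw
  obtain ⟨tm, htm, hmin⟩ := T.exists_min_image pw ⟨t₀, ht₀⟩
  have hneg : pw tm < 0 := by
    refine lt_of_le_of_lt (hmin t₀ ht₀) ?_
    have := pow_lt_pow_left₀ hq dist_nonneg two_ne_zero
    simp only [hpw]
    linarith
  set A : Set Plane := ⋃ t ∈ T.filter (fun t => pw t = pw tm), convexHull ℝ (t : Set Plane) with hA
  have hAcl : IsClosed A :=
    (Finset.finite_toSet _).isClosed_biUnion fun t _ => (t.finite_toSet.isCompact_convexHull ℝ).isClosed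
  have hmemA : ∀ z, z ∈ A ↔ ∃ t ∈ T, pw t = pw tm ∧ z ∈ convexHull ℝ (t : Set Plane) := fun z => by
    simp [hA, and_assoc]
  have hqA : q ∉ A := by
    rw [hmemA]
    rintro ⟨t, ht, ht2, hqt⟩
    have := ho t ht q (hT.mem_of_mem_convexHull t ht q hqS hqt)
    simp only [hpw] at ht2 hneg
    rw [this, sub_self] at ht2
    linarith
  obtain ⟨x, hx, hgen⟩ := (hT.isTriangle tm htm).exists_generic S
  have hconv : ∀ t ∈ T, convexHull ℝ (t : Set Plane) ⊆ convexHull ℝ (S : Set Plane) :=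
    fun t ht => convexHull_mono (by exact_mod_cast hT.subset t ht)
  have hqS' : q ∈ convexHull ℝ (S : Set Plane) := subset_convexHull ℝ _ hqS
  have hcont : Continuous (fun τ : ℝ => (AffineMap.lineMap x q τ : Plane)) :=
    AffineMap.lineMap_continuous
  have hK : IsCompact (Set.Icc (0 : ℝ) 1 ∩ (fun τ : ℝ => (AffineMap.lineMap x q τ : Plane)) ⁻¹' A) :=
    isCompact_Icc.inter_right (hAcl.preimage hcont)
  obtain ⟨τ, ⟨hτ, hτA⟩, hτmax⟩ := hK.exists_isGreatest
    ⟨0, ⟨le_rfl, zero_le_one⟩, by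
      simp only [Set.mem_preimage, AffineMap.lineMap_apply_zero]
      exact (hmemA x).2 ⟨tm, htm, rfl, hx⟩⟩
  have hτ1 : τ < 1 := by
    refine lt_of_le_of_ne hτ.2 ?_
    rintro rfl
    simp only [Set.mem_preimage, AffineMap.lineMap_apply_one] at hτA
    exact hqA hτA
  set y : Plane := AffineMap.lineMap x q τ with hy
  have hyS : y ∉ S := hgen.lineMap_notMem hqS hτ1
  have hyq : ∀ ε : ℝ, 0 < ε → ε ≤ 1 → AffineMap.lineMap y q ε ∉ A := by
    intro ε h0 h1 hmem
    have e : (AffineMap.lineMap y q ε : Plane) = AffineMap.lineMap x q (τ + ε * (1 - τ)) := by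
      simp only [hy, AffineMap.lineMap_apply_module]
      module
    rw [e] at hmem
    have := hτmax ⟨⟨by nlinarith [hτ.1], by nlinarith⟩, hmem⟩
    nlinarith
  obtain ⟨t, ht, htpw, hyt⟩ := (hmemA y).1 hτA
  have hex : ¬ ∀ᶠ ε in 𝓝[>] (0 : ℝ), AffineMap.lineMap y q ε ∈ convexHull ℝ (t : Set Plane) := by
    intro h
    obtain ⟨ε, hε, h2⟩ := (h.and (Ioo_mem_nhdsGT (zero_lt_one (α := ℝ)))).exists
    exact hyq ε h2.1 h2.2.le ((hmemA _).2 ⟨t, ht, htpw, hε⟩)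
  obtain ⟨a, b, c, habc, hor, hy0, hq0⟩ := exists_exit_edge (hT.isTriangle t ht) hyt hex
  have habc' : t = {a, b, c} := by
    apply Finset.coe_injective
    simpa using habc
  obtain ⟨t', ht', hyt', hfreq⟩ := hT.exists_frequently_mem ht (hconv t ht hyt) hqS'
  have hpw' : pw tm < pw t' := by
    refine lt_of_le_of_ne (hmin t' ht') fun h => ?_
    obtain ⟨ε, hε, h2⟩ := (hfreq.and_eventually (Ioo_mem_nhdsGT (zero_lt_one (α := ℝ)))).exists
    exact hyq ε h2.1 h2.2.le ((hmemA _).2 ⟨t', ht', h.symm, hε⟩)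
  have hyint := hT.inter t ht t' ht' ⟨hyt, hyt'⟩
  have haS : ∀ p ∈ t, p ∈ S := fun p hp => hT.subset t ht hp
  have hyt2 := hyt
  rw [habc, mem_convexHull_triple_iff_orient hor] at hyt2
  have hcomb := orient_combination_eq y hor.ne'
  have hadd := orient_add a b c y
  rw [hy0, add_zero] at hadd
  rw [hy0, zero_div, zero_smul, add_zero] at hcomb
  have hybc : orient y b c ≠ 0 := by
    intro h0
    rw [h0, zero_add] at hadd
    rw [h0, hadd, zero_div, zero_smul, zero_add, div_self hor.ne', one_smul] at hcomb
    exact hyS (hcomb ▸ haS b (by simp [habc']))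
  have hyac : orient a y c ≠ 0 := by
    intro h0
    rw [h0, add_zero] at hadd
    rw [h0, hadd, zero_div, zero_smul, add_zero, div_self hor.ne', one_smul] at hcomb
    exact hyS (hcomb ▸ haS a (by simp [habc']))
  have hat' : a ∈ t' := by
    by_contra hn
    have : y ∈ convexHull ℝ ({b, b, c} : Set Plane) := by
      refine convexHull_mono ?_ hyint
      rintro p ⟨hp, hp'⟩
      rw [habc] at hp
      simp only [Set.mem_insert_iff, Set.mem_singleton_iff] at hp ⊢
      rcases hp with rfl | hp
      · exact absurd hp' hn
      · exact Or.inr hp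
    obtain ⟨u, v, w, -, -, -, h1, hx⟩ := mem_convexHull_triple.1 this
    have := orient_combination₃ (p := b) (q := c) h1 hx
    rw [orient_rotate] at this
    apply hybc
    rw [this, orient_self_mid, orient_self_right]
    ring
  have hbt' : b ∈ t' := by
    by_contra hn
    have : y ∈ convexHull ℝ ({a, a, c} : Set Plane) := by
      refine convexHull_mono ?_ hyint
      rintro p ⟨hp, hp'⟩
      rw [habc] at hp
      simp only [Set.mem_insert_iff, Set.mem_singleton_iff] at hp ⊢
      rcases hp with rfl | rfl | hp
      · exact Or.inl rfl
      · exact absurd hp' hn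
      · exact Or.inr (Or.inr hp)
    obtain ⟨u, v, w, -, -, -, h1, hx⟩ := mem_convexHull_triple.1 this
    have := orient_combination₃ (p := c) (q := a) h1 hx
    apply hyac
    rw [orient_rotate c a, this, orient_self_right, orient_self_mid]
    ring
  have hab : a ≠ b := (ne_of_orient_ne_zero hor.ne').1
  have hd : ∃ d, t' = {a, b, d} := by
    have hc1 : ((t'.erase a).erase b).card = 1 := by
      rw [Finset.card_erase_of_mem (Finset.mem_erase.2 ⟨hab.symm, hbt'⟩), Finset.card_erase_of_mem hat',
        (hT.isTriangle t' ht').1]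
    obtain ⟨d, hd⟩ := Finset.card_eq_one.1 hc1
    refine ⟨d, ?_⟩
    rw [← hd, Finset.insert_erase (Finset.mem_erase.2 ⟨hab.symm, hbt'⟩), Finset.insert_erase hat']
  obtain ⟨d, rfl⟩ := hd
  have hd0 : orient a b d < 0 := by
    obtain ⟨ε, hε, h2⟩ := (hfreq.and_eventually (Ioo_mem_nhdsGT (zero_lt_one (α := ℝ)))).exists
    simp only [Finset.coe_insert, Finset.coe_singleton] at hε
    obtain ⟨u, v, w, -, -, hw, h1, hx⟩ := mem_convexHull_triple.1 hε
    have e := orient_combination₃ (p := a) (q := b) h1 hx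
    rw [orient_lineMap, hy0, orient_self_mid, orient_self_right] at e
    by_contra hn
    push Not at hn
    have h3 : 0 ≤ w * orient a b d := mul_nonneg hw hn
    have h4 : ε * orient a b q < 0 := mul_neg_of_pos_of_neg h2.1 hq0
    linarith
  have hcirc := ho t ht
  have hcirc' := ho _ ht'
  have hin : dist d (o t) < triangleCircumradius t := by
    -- Barycentric coordinates of `q` in `a b d`, possibly negative. Only the one of `d` matters,
    -- because the difference of powers is zero at `a` and `b`.
    have hw1 : orient q b d / orient a b d + orient a q d / orient a b d + orient a b q / orient a b d = 1 := by
      rw [← add_div, ← add_div, orient_add, div_self hd0.ne]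
    have := sum_power_sub_power Finset.univ
      ![orient q b d / orient a b d, orient a q d / orient a b d, orient a b q / orient a b d]
      ![a, b, d] q (o {a, b, d}) (o t) (triangleCircumradius {a, b, d}) (triangleCircumradius t)
      (by simpa [Fin.sum_univ_three] using hw1)
      (by simpa [Fin.sum_univ_three] using orient_combination_eq q hd0.ne)
    simp only [Fin.sum_univ_three, Matrix.cons_val_zero, Matrix.cons_val_one, Matrix.cons_val] at this
    rw [hcirc a (by simp [habc']), hcirc b (by simp [habc']), hcirc' a (by simp), hcirc' b (by simp),
      hcirc' d (by simp)] at this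
    have hpos : 0 < (dist q (o {a, b, d}) ^ 2 - triangleCircumradius {a, b, d} ^ 2) -
        (dist q (o t) ^ 2 - triangleCircumradius t ^ 2) := by
      have : pw t < pw {a, b, d} := htpw ▸ hpw'
      simp only [hpw] at this
      linarith
    rw [← this] at hpos
    have hpos' : 0 < orient a b q / orient a b d * (triangleCircumradius t ^ 2 - dist d (o t) ^ 2) := by
      linarith
    have h5 : 0 < orient a b q / orient a b d := div_pos_of_neg_of_neg hq0 hd0
    have h6 := pos_of_mul_pos_right hpos' h5.le
    exact lt_of_pow_lt_pow_left₀ 2 (hT.isTriangle t ht).circumradius_nonneg (by linarith)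
  obtain ⟨α, β, γ, δ, hquad⟩ := exists_flippableQuad hor hd0 (hcirc a (by simp [habc']))
    (hcirc b (by simp [habc'])) (hcirc c (by simp [habc'])) hin
  exact ⟨a, b, c, d, α, β, γ, δ, hquad, habc' ▸ ht, ht'⟩

end IsTriangulation

/-! ### A flip preserves triangulations. -/

namespace FlippableQuad

variable {a b c d : Plane} {α β γ δ : ℝ}

theorem symm (h : FlippableQuad a b c d α β γ δ) : FlippableQuad b a d c β α δ γ := by
  obtain ⟨X, hX, -, h2, -⟩ := h.orients
  refine ⟨h.hβ, h.hα, h.hδ, h.hγ, by rw [add_comm, h.hαβ], by rw [add_comm, h.hγδ], ?_, ?_, ?_⟩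
  · rw [add_comm, h.cross, add_comm]
  · rw [orient_swap, h2, neg_neg]
    exact mul_pos h.hγ hX
  · rw [dist_comm d, dist_comm b, mul_comm δ, mul_comm β]
    exact h.power_lt

/-- The orientations of the four triangles, in positive order. -/
theorem orient_pos' (h : FlippableQuad a b c d α β γ δ) :
    0 < orient a b c ∧ 0 < orient b a d ∧ 0 < orient a d c ∧ 0 < orient b c d := by
  obtain ⟨X, hX, h1, h2, h3, h4, -⟩ := h.orients
  refine ⟨h.orient_pos, h.symm.orient_pos, ?_, ?_⟩
  · have : orient a d c = -orient a c d := by unfold orient; ring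
    rw [this, h3, neg_neg]
    exact mul_pos h.hβ hX
  · rw [h4]; exact mul_pos h.hα hX

/-- The line `c d` decides which new triangle contains `x`. The remaining inequality is affine and
nonnegative on all three old vertices. -/
theorem mem_or_mem_of_mem_old (h : FlippableQuad a b c d α β γ δ) {x : Plane}
    (hx : x ∈ convexHull ℝ ({a, b, c} : Set Plane)) :
    x ∈ convexHull ℝ ({a, d, c} : Set Plane) ∨ x ∈ convexHull ℝ ({b, c, d} : Set Plane) := by
  obtain ⟨p1, p2, p3, p4⟩ := h.orient_pos'
  rw [mem_convexHull_triple_iff_orient p3, mem_convexHull_triple_iff_orient p4]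
  have hx' := hx
  rw [mem_convexHull_triple_iff_orient p1] at hx'
  obtain ⟨s1, s2, s3⟩ := hx'
  obtain ⟨u, v, w, hu, hv, hw, h1, hx⟩ := mem_convexHull_triple.1 hx
  have e1 := orient_combination₃ (p := a) (q := d) h1 hx
  have e2 := orient_combination₃ (p := d) (q := b) h1 hx
  rcases le_total 0 (orient x d c) with hm | hm
  · left
    refine ⟨hm, s2, ?_⟩
    rw [e1, orient_self_mid, orient_rotate b a d]
    have := mul_nonneg hv p2.le
    have := mul_nonneg hw p3.le
    linarith
  · right
    refine ⟨?_, ?_, by rwa [orient_rotate]⟩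
    · have : orient x c d = -orient x d c := by unfold orient; ring
      linarith
    · rw [orient_rotate d b x, e2, orient_self_right, ← orient_rotate d b a, ← orient_rotate d b c]
      have := mul_nonneg hu p2.le
      have := mul_nonneg hw p4.le
      linarith

theorem mem_or_mem_of_mem_new (h : FlippableQuad a b c d α β γ δ) {x : Plane}
    (hx : x ∈ convexHull ℝ ({a, d, c} : Set Plane)) :
    x ∈ convexHull ℝ ({a, b, c} : Set Plane) ∨ x ∈ convexHull ℝ ({b, a, d} : Set Plane) := by
  obtain ⟨p1, p2, p3, p4⟩ := h.orient_pos'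
  rw [mem_convexHull_triple_iff_orient p1, mem_convexHull_triple_iff_orient p2]
  have hx' := hx
  rw [mem_convexHull_triple_iff_orient p3] at hx'
  obtain ⟨s1, s2, s3⟩ := hx'
  obtain ⟨u, v, w, hu, hv, hw, h1, hx⟩ := mem_convexHull_triple.1 hx
  have e1 := orient_combination₃ (p := b) (q := c) h1 hx
  have e2 := orient_combination₃ (p := d) (q := b) h1 hx
  rcases le_total 0 (orient a b x) with hm | hm
  · left
    refine ⟨?_, s2, hm⟩
    rw [← orient_rotate, e1, orient_self_right, orient_rotate a b c]
    have := mul_nonneg hu p1.le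
    have := mul_nonneg hv p4.le
    linarith
  · right
    refine ⟨by rwa [← orient_rotate], ?_, by rw [orient_swap]; linarith⟩
    rw [orient_rotate d b x, e2, orient_self_mid, ← orient_rotate d b a, ← orient_rotate d b c]
    have := mul_nonneg hu p2.le
    have := mul_nonneg hw p4.le
    linarith

theorem eventually_mem {e q z : Plane} (he : 0 < orient a b e) (hz : orient a b z = 0)
    (hz1 : 0 < orient z b e) (hz2 : 0 < orient a z e) (hq : 0 < orient a b q) :
    ∀ᶠ ε in 𝓝[>] (0 : ℝ), AffineMap.lineMap z q ε ∈ convexHull ℝ ({a, b, e} : Set Plane) := by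
  simp only [mem_convexHull_triple_iff_orient he]
  have k1 := eventually_orient_nonneg (u := b) (v := e) (y := z) (q := q)
    (by rw [orient_rotate z b e]; exact hz1.le) (fun h0 => by rw [orient_rotate z b e] at h0; linarith)
  have k2 := eventually_orient_nonneg (u := e) (v := a) (y := z) (q := q)
    (by rw [← orient_rotate e a z]; exact hz2.le) (fun h0 => by rw [← orient_rotate e a z] at h0; linarith)
  have k3 := eventually_orient_nonneg (u := a) (v := b) (y := z) (q := q) hz.ge (fun _ => hq.le)
  filter_upwards [k1, k2, k3] with ε e1 e2 e3
  exact ⟨by rw [← orient_rotate]; exact e1, by rw [orient_rotate e a]; exact e2, e3⟩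

end FlippableQuad

namespace IsTriangulation

variable {S : Finset Plane} {T : Finset (Finset Plane)} {a b c d : Plane} {α β γ δ : ℝ}

open Classical in
-- Two triangles on the same side of `a b` overlap: a short step from the crossing point towards `c`
-- stays in both and leaves the line `a b`. If they were different, they could meet only in the
-- edge.
theorem eq_of_orient_pos (hT : IsTriangulation S T) (h : FlippableQuad a b c d α β γ δ)
    (ht : {a, b, c} ∈ T) {e : Plane} (hr : {a, b, e} ∈ T) (he : 0 < orient a b e) :
    ({a, b, e} : Finset Plane) = {a, b, c} := by
  by_contra hne
  set z : Plane := α • a + β • b with hz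
  have hpt : ∀ p q : Plane, orient p q z = α * orient p q a + β * orient p q b := fun p q => by
    have := orient_combination₃ (p := p) (q := q) (a := a) (b := b) (c := b) (x := z)
      (α := α) (β := β) (γ := 0) (by linarith [h.hαβ]) (by simp [hz])
    linarith
  have hz0 : orient a b z = 0 := by rw [hpt, orient_self_mid, orient_self_right]; ring
  have hz1 : 0 < orient z b e := by
    rw [← orient_rotate, hpt, orient_self_mid, orient_rotate a b e]
    have := mul_pos h.hα he
    linarith
  have hz2 : 0 < orient a z e := by
    rw [orient_rotate e a z, hpt, orient_self_right, ← orient_rotate e a b]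
    have := mul_pos h.hβ he
    linarith
  obtain ⟨ε, hε, h2⟩ := ((FlippableQuad.eventually_mem he hz0 hz1 hz2 h.orient_pos).and
    (Ioo_mem_nhdsGT (zero_lt_one (α := ℝ)))).exists
  have hzt : z ∈ convexHull ℝ ({a, b, c} : Set Plane) :=
    mem_convexHull_triple.2 ⟨α, β, 0, h.hα.le, h.hβ.le, le_rfl, by linarith [h.hαβ], by simp [hz]⟩
  have hct : c ∈ convexHull ℝ ({a, b, c} : Set Plane) := subset_convexHull ℝ _ (by simp)
  have hε' := (convex_convexHull ℝ ({a, b, c} : Set Plane)).lineMap_mem hzt hct ⟨h2.1.le, h2.2.le⟩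
  have hint := hT.inter _ ht _ hr ⟨by simpa using hε', by simpa using hε⟩
  have hsub : ((({a, b, c} : Finset Plane) : Set Plane) ∩ (({a, b, e} : Finset Plane) : Set Plane)) ⊆ {a, b, b} := by
    rintro p ⟨hp, hp'⟩
    simp only [Finset.coe_insert, Finset.coe_singleton, Set.mem_insert_iff, Set.mem_singleton_iff] at hp hp' ⊢
    rcases hp with rfl | rfl | rfl
    · simp
    · simp
    · rcases hp' with rfl | rfl | rfl
      · simp
      · simp
      · exact absurd rfl hne
  obtain ⟨u, v, w, -, -, -, h1, hx⟩ := mem_convexHull_triple.1 (convexHull_mono hsub hint)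
  have e1 := orient_combination₃ (p := a) (q := b) h1 hx
  rw [orient_lineMap, hz0, orient_self_mid, orient_self_right] at e1
  have := mul_pos h2.1 h.orient_pos
  linarith

open Classical in
/-- No third triangle contains the edge `a b`. -/
theorem eq_or_eq_of_mem_edge (hT : IsTriangulation S T) (h : FlippableQuad a b c d α β γ δ)
    (ht : {a, b, c} ∈ T) (ht' : {a, b, d} ∈ T) {r : Finset Plane} (hr : r ∈ T) (har : a ∈ r)
    (hbr : b ∈ r) : r = {a, b, c} ∨ r = {a, b, d} := by
  have hab : a ≠ b := (ne_of_orient_ne_zero h.orient_pos.ne').1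
  have hd : ∃ e, r = {a, b, e} := by
    have hc1 : ((r.erase a).erase b).card = 1 := by
      rw [Finset.card_erase_of_mem (Finset.mem_erase.2 ⟨hab.symm, hbr⟩), Finset.card_erase_of_mem har,
        (hT.isTriangle r hr).1]
    obtain ⟨e, he⟩ := Finset.card_eq_one.1 hc1
    refine ⟨e, ?_⟩
    rw [← he, Finset.insert_erase (Finset.mem_erase.2 ⟨hab.symm, hbr⟩), Finset.insert_erase har]
  obtain ⟨e, rfl⟩ := hd
  have hne : orient a b e ≠ 0 := by
    have h3 := hT.isTriangle _ hr
    obtain ⟨x, y, z, hx, hy, hz, hxyz⟩ := Finset.card_eq_three.1 h3.1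
    have hae : a ≠ e := by
      rintro rfl
      have := h3.1
      rw [show ({a, b, a} : Finset Plane) = {a, b} by ext p; simp; tauto, Finset.card_pair hab] at this
      omega
    have hbe : b ≠ e := by
      rintro rfl
      have := h3.1
      rw [show ({a, b, b} : Finset Plane) = {a, b} by ext p; simp, Finset.card_pair hab] at this
      omega
    exact (affineIndependent_triple_iff hab hae hbe).1 h3.2
  rcases lt_or_gt_of_ne hne with he | he
  · right
    rw [Finset.insert_comm a b {e}] at hr ⊢
    rw [Finset.insert_comm a b {d}] at ht' ⊢
    exact hT.eq_of_orient_pos h.symm ht' hr (by rw [orient_swap]; linarith)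
  · left
    exact hT.eq_of_orient_pos h ht hr he

/-- Transfers a point from the old triangle `a b e` to the new triangle `a d c`. If `b` is not in
`r`, all vertices involved belong to the new triangle. Otherwise `a` is not in `r` and `x` is on the
segment from `b` to `e`; as `b` is strictly beyond the line `d c` and `x` is not, `x = e`. -/
theorem mem_convexHull_inter_of_mem {r : Set Plane} {e x : Plane} (hneg : orient b d c < 0)
    (hx : x ∈ convexHull ℝ (({a, b, e} : Set Plane) ∩ r)) (hr : ¬ (a ∈ r ∧ b ∈ r))
    (hx0 : 0 ≤ orient x d c) (he : e = c ∨ e = d) : x ∈ convexHull ℝ (({a, d, c} : Set Plane) ∩ r) := by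
  have hmem : ∀ p, p = a ∨ p = e → p ∈ ({a, d, c} : Set Plane) := by
    rintro p (rfl | rfl)
    · simp
    · rcases he with rfl | rfl <;> simp
  have hoe : orient e d c = 0 := by rcases he with rfl | rfl <;> (unfold orient; ring)
  by_cases hb : b ∈ r
  · have ha : a ∉ r := fun ha => hr ⟨ha, hb⟩
    have hsub : ({a, b, e} : Set Plane) ∩ r ⊆ {b, b, e} := by
      rintro p ⟨hp, hp'⟩
      simp only [Set.mem_insert_iff, Set.mem_singleton_iff] at hp ⊢
      rcases hp with rfl | rfl | rfl
      · exact absurd hp' ha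
      · simp
      · simp
    by_cases her : e ∈ r
    · obtain ⟨u, v, w, hu, hv, hw, h1, hx'⟩ := mem_convexHull_triple.1 (convexHull_mono hsub hx)
      have e1 := orient_combination₃ (p := d) (q := c) h1 hx'
      rw [orient_rotate x d c, orient_rotate b d c, orient_rotate e d c, hoe] at e1
      have huv : u + v = 0 := by
        by_contra hne
        have : 0 < u + v := lt_of_le_of_ne (by linarith) (Ne.symm hne)
        have := mul_neg_of_pos_of_neg this hneg
        linarith
      obtain rfl : u = 0 := by linarith
      obtain rfl : v = 0 := by linarith
      obtain rfl : w = 1 := by linarith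
      simp only [zero_smul, one_smul, zero_add] at hx'
      subst hx'
      exact subset_convexHull ℝ _ ⟨hmem e (Or.inr rfl), her⟩
    · have hsub' : ({a, b, e} : Set Plane) ∩ r ⊆ {b} := by
        rintro p ⟨hp, hp'⟩
        simp only [Set.mem_insert_iff, Set.mem_singleton_iff] at hp ⊢
        rcases hp with rfl | rfl | rfl
        · exact absurd hp' ha
        · rfl
        · exact absurd hp' her
      have := convexHull_mono hsub' hx
      rw [convexHull_singleton, Set.mem_singleton_iff] at this
      subst this
      linarith
  · refine convexHull_mono ?_ hx
    rintro p ⟨hp, hp'⟩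
    simp only [Set.mem_insert_iff, Set.mem_singleton_iff] at hp
    refine ⟨hmem p ?_, hp'⟩
    rcases hp with rfl | rfl | rfl
    · exact Or.inl rfl
    · exact absurd hp' hb
    · exact Or.inr rfl

open Classical in
theorem inter_flip (hT : IsTriangulation S T) (h : FlippableQuad a b c d α β γ δ)
    (ht : {a, b, c} ∈ T) (ht' : {a, b, d} ∈ T) {r : Finset Plane} (hr : r ∈ T)
    (hr1 : r ≠ {a, b, c}) (hr2 : r ≠ {a, b, d}) :
    convexHull ℝ (({a, d, c} : Finset Plane) : Set Plane) ∩ convexHull ℝ (r : Set Plane) ⊆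
      convexHull ℝ ((({a, d, c} : Finset Plane) : Set Plane) ∩ r) := by
  rintro x ⟨hx, hxr⟩
  have hab : ¬ (a ∈ (r : Set Plane) ∧ b ∈ (r : Set Plane)) := fun ⟨h1, h2⟩ => by
    rcases hT.eq_or_eq_of_mem_edge h ht ht' hr h1 h2 with h3 | h3
    exacts [hr1 h3, hr2 h3]
  obtain ⟨p1, p2, p3, p4⟩ := h.orient_pos'
  have hneg : orient b d c < 0 := by
    have : orient b d c = -orient b c d := by unfold orient; ring
    linarith
  simp only [Finset.coe_insert, Finset.coe_singleton] at hx ⊢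
  have hx0 := ((mem_convexHull_triple_iff_orient p3).1 hx).1
  rcases h.mem_or_mem_of_mem_new hx with hx1 | hx1
  · have := hT.inter _ ht _ hr ⟨by simpa using hx1, hxr⟩
    simp only [Finset.coe_insert, Finset.coe_singleton] at this
    exact mem_convexHull_inter_of_mem hneg this hab hx0 (Or.inl rfl)
  · rw [Set.insert_comm] at hx1
    have := hT.inter _ ht' _ hr ⟨by simpa using hx1, hxr⟩
    simp only [Finset.coe_insert, Finset.coe_singleton] at this
    exact mem_convexHull_inter_of_mem hneg this hab hx0 (Or.inr rfl)

open Classical in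
/-- Replacing one diagonal of a convex quadrilateral by the other. -/
theorem flip (hT : IsTriangulation S T) (h : FlippableQuad a b c d α β γ δ)
    (ht : {a, b, c} ∈ T) (ht' : {a, b, d} ∈ T) :
    IsTriangulation S
      (insert {a, d, c} (insert {b, c, d} ((T.erase {a, b, c}).erase {a, b, d}))) := by
  obtain ⟨p1, p2, p3, p4⟩ := h.orient_pos'
  have hsw : ({b, a, d} : Finset Plane) = {a, b, d} := Finset.insert_comm _ _ _
  have hsw' : ({b, a, c} : Finset Plane) = {a, b, c} := Finset.insert_comm _ _ _
  have haS : a ∈ S := hT.subset _ ht (by simp)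
  have hbS : b ∈ S := hT.subset _ ht (by simp)
  have hcS : c ∈ S := hT.subset _ ht (by simp)
  have hdS : d ∈ S := hT.subset _ ht' (by simp)
  have hnew : ∀ r, r ∈ (T.erase {a, b, c}).erase {a, b, d} ↔ r ≠ {a, b, d} ∧ r ≠ {a, b, c} ∧ r ∈ T :=
    fun r => by simp
  have hi1 : ∀ r ∈ (T.erase {a, b, c}).erase {a, b, d}, convexHull ℝ (({a, d, c} : Finset Plane) : Set Plane) ∩
      convexHull ℝ (r : Set Plane) ⊆ convexHull ℝ ((({a, d, c} : Finset Plane) : Set Plane) ∩ r) := fun r hr => by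
    obtain ⟨h1, h2, h3⟩ := (hnew r).1 hr
    exact hT.inter_flip h ht ht' h3 h2 h1
  have hi2 : ∀ r ∈ (T.erase {a, b, c}).erase {a, b, d}, convexHull ℝ (({b, c, d} : Finset Plane) : Set Plane) ∩
      convexHull ℝ (r : Set Plane) ⊆ convexHull ℝ ((({b, c, d} : Finset Plane) : Set Plane) ∩ r) := fun r hr => by
    obtain ⟨h1, h2, h3⟩ := (hnew r).1 hr
    -- The symmetry exchanging `a` with `b` and `c` with `d` carries one new triangle to the other.
    exact hT.inter_flip h.symm (hsw ▸ ht') (hsw' ▸ ht) h3 (hsw ▸ h1) (hsw' ▸ h2)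
  have hi3 : convexHull ℝ (({a, d, c} : Finset Plane) : Set Plane) ∩
      convexHull ℝ (({b, c, d} : Finset Plane) : Set Plane) ⊆
        convexHull ℝ ((({a, d, c} : Finset Plane) : Set Plane) ∩ (({b, c, d} : Finset Plane) : Set Plane)) := by
    rintro x ⟨hx, hx'⟩
    simp only [Finset.coe_insert, Finset.coe_singleton] at hx hx' ⊢
    -- The new triangles lie on opposite sides of the line `c d`, so a common point is on it and has
    -- no `a`-component.
    have s1 := ((mem_convexHull_triple_iff_orient p3).1 hx).1
    have s2 := ((mem_convexHull_triple_iff_orient p4).1 hx').1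
    have s3 : orient x c d = -orient x d c := by unfold orient; ring
    have s4 : orient x d c = 0 := by linarith
    have hcomb := orient_combination_eq x p3.ne'
    have hadd := orient_add a d c x
    rw [s4, zero_div, zero_smul, zero_add] at hcomb
    rw [s4, zero_add] at hadd
    obtain ⟨-, s5, s6⟩ := (mem_convexHull_triple_iff_orient p3).1 hx
    have hsub : ({d, c} : Set Plane) ⊆ ({a, d, c} : Set Plane) ∩ {b, c, d} := by
      rintro p (rfl | rfl) <;> simp
    apply convexHull_mono hsub
    rw [convexHull_pair]
    exact ⟨_, _, div_nonneg s5 p3.le, div_nonneg s6 p3.le, by rw [← add_div, hadd, div_self p3.ne'], hcomb⟩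
  have hold : ∀ {x : Plane}, x ∈ convexHull ℝ (({a, d, c} : Finset Plane) : Set Plane) →
      x ∈ convexHull ℝ (({a, b, c} : Finset Plane) : Set Plane) ∨
        x ∈ convexHull ℝ (({a, b, d} : Finset Plane) : Set Plane) := fun hx => by
    rw [← hsw]
    simp only [Finset.coe_insert, Finset.coe_singleton] at hx ⊢
    exact h.mem_or_mem_of_mem_new hx
  have hold' : ∀ {x : Plane}, x ∈ convexHull ℝ (({b, c, d} : Finset Plane) : Set Plane) →
      x ∈ convexHull ℝ (({a, b, c} : Finset Plane) : Set Plane) ∨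
        x ∈ convexHull ℝ (({a, b, d} : Finset Plane) : Set Plane) := fun hx => by
    rw [← hsw]
    simp only [Finset.coe_insert, Finset.coe_singleton] at hx ⊢
    exact (h.symm.mem_or_mem_of_mem_new hx).symm
  have hvert : ∀ q ∈ S, (q ∈ convexHull ℝ (({a, b, c} : Finset Plane) : Set Plane) ∨
      q ∈ convexHull ℝ (({a, b, d} : Finset Plane) : Set Plane)) → q = a ∨ q = b ∨ q = c ∨ q = d := by
    rintro q hq (h' | h')
    · have := hT.mem_of_mem_convexHull _ ht q hq h'
      simp only [Finset.mem_insert, Finset.mem_singleton] at this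
      tauto
    · have := hT.mem_of_mem_convexHull _ ht' q hq h'
      simp only [Finset.mem_insert, Finset.mem_singleton] at this
      tauto
  refine ⟨?_, ?_, ?_, ?_, ?_⟩
  · intro t ht2 p hp
    rw [Finset.mem_insert, Finset.mem_insert, hnew] at ht2
    rcases ht2 with rfl | rfl | ⟨-, -, h3⟩
    · simp only [Finset.mem_insert, Finset.mem_singleton] at hp
      rcases hp with rfl | rfl | rfl <;> assumption
    · simp only [Finset.mem_insert, Finset.mem_singleton] at hp
      rcases hp with rfl | rfl | rfl <;> assumption
    · exact hT.subset t h3 hp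
  · intro t ht2
    rw [Finset.mem_insert, Finset.mem_insert, hnew] at ht2
    rcases ht2 with rfl | rfl | ⟨-, -, h3⟩
    · exact isTriangle_of_orient p3.ne'
    · exact isTriangle_of_orient p4.ne'
    · exact hT.isTriangle t h3
  · intro t h1 t' h2
    rw [Finset.mem_insert, Finset.mem_insert] at h1 h2
    rcases h1 with rfl | rfl | h1 <;> rcases h2 with rfl | rfl | h2
    · rw [Set.inter_self, Set.inter_self]
    · exact hi3
    · exact hi1 _ h2
    · rw [Set.inter_comm, Set.inter_comm (({b, c, d} : Finset Plane) : Set Plane)]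
      exact hi3
    · rw [Set.inter_self, Set.inter_self]
    · exact hi2 _ h2
    · rw [Set.inter_comm, Set.inter_comm (t : Set Plane)]
      exact hi1 _ h1
    · rw [Set.inter_comm, Set.inter_comm (t : Set Plane)]
      exact hi2 _ h1
    · exact hT.inter t ((hnew t).1 h1).2.2 t' ((hnew t').1 h2).2.2
  · intro t ht2 q hq hqt
    rw [Finset.mem_insert, Finset.mem_insert, hnew] at ht2
    rcases ht2 with rfl | rfl | ⟨-, -, h3⟩
    · rcases hvert q hq (hold hqt) with rfl | rfl | rfl | rfl
      · simp
      · exfalso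
        simp only [Finset.coe_insert, Finset.coe_singleton] at hqt
        have s1 := ((mem_convexHull_triple_iff_orient p3).1 hqt).1
        have : orient q d c = -orient q c d := by unfold orient; ring
        linarith
      · simp
      · simp
    · rcases hvert q hq (hold' hqt) with rfl | rfl | rfl | rfl
      · exfalso
        simp only [Finset.coe_insert, Finset.coe_singleton] at hqt
        have s1 := ((mem_convexHull_triple_iff_orient p4).1 hqt).1
        have : orient q d c = -orient q c d := by unfold orient; ring
        linarith
      · simp
      · simp
      · simp
    · exact hT.mem_of_mem_convexHull t h3 q hq hqt
  · intro x hx hgen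
    obtain ⟨r, hr, hxr⟩ := hT.cover x hx hgen
    have hnew' : x ∈ convexHull ℝ (({a, d, c} : Finset Plane) : Set Plane) ∨
        x ∈ convexHull ℝ (({b, c, d} : Finset Plane) : Set Plane) → ∃ t ∈ insert {a, d, c}
          (insert {b, c, d} ((T.erase {a, b, c}).erase {a, b, d})), x ∈ convexHull ℝ (t : Set Plane) := by
      rintro (h' | h')
      · exact ⟨_, by simp, h'⟩
      · exact ⟨_, Finset.mem_insert_of_mem (Finset.mem_insert_self _ _), h'⟩
    by_cases h1 : r = {a, b, c}
    · apply hnew'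
      rw [h1] at hxr
      simp only [Finset.coe_insert, Finset.coe_singleton] at hxr ⊢
      exact h.mem_or_mem_of_mem_old hxr
    by_cases h2 : r = {a, b, d}
    · apply hnew'
      rw [h2, ← hsw] at hxr
      simp only [Finset.coe_insert, Finset.coe_singleton] at hxr ⊢
      exact (h.symm.mem_or_mem_of_mem_old hxr).symm
    exact ⟨r, Finset.mem_insert_of_mem (Finset.mem_insert_of_mem ((hnew r).2 ⟨h2, h1, hr⟩)), hxr⟩

/-! ### Minimization over all triangulations. -/

open Classical in
theorem sum_flip_lt (h : FlippableQuad a b c d α β γ δ)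
    (ht : {a, b, c} ∈ T) (ht' : {a, b, d} ∈ T) {w : Finset Plane → ℝ} (hw : ∀ t, IsTriangle t → 0 ≤ w t)
    (hlt : w {a, c, d} + w {b, c, d} < w {a, b, c} + w {a, b, d}) :
    ∑ t ∈ insert {a, d, c} (insert {b, c, d} ((T.erase {a, b, c}).erase {a, b, d})), w t <
      ∑ t ∈ T, w t := by
  obtain ⟨p1, p2, p3, p4⟩ := h.orient_pos'
  -- An upper bound suffices, so it need not be checked that the new triangles are absent from `T`.
  have hins : ∀ (s : Finset Plane) (E : Finset (Finset Plane)), IsTriangle s →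
      ∑ t ∈ insert s E, w t ≤ w s + ∑ t ∈ E, w t := fun s E hs => by
    by_cases hsE : s ∈ E
    · rw [Finset.insert_eq_of_mem hsE]
      linarith [hw s hs]
    · rw [Finset.sum_insert hsE]
  have hne : ({a, b, d} : Finset Plane) ≠ {a, b, c} := fun heq => by
    have hd : d ∈ ({a, b, c} : Finset Plane) := heq ▸ by simp
    simp only [Finset.mem_insert, Finset.mem_singleton] at hd
    have hd2 := ne_of_orient_ne_zero p2.ne'
    have hd3 := ne_of_orient_ne_zero p3.ne'
    rcases hd with rfl | rfl | rfl
    · exact hd2.2.2 rfl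
    · exact hd2.2.1 rfl
    · exact hd3.2.2 rfl
  have e1 := hins {a, d, c} (insert {b, c, d} ((T.erase {a, b, c}).erase {a, b, d})) (isTriangle_of_orient p3.ne')
  have e2 := hins {b, c, d} ((T.erase {a, b, c}).erase {a, b, d}) (isTriangle_of_orient p4.ne')
  have e3 := Finset.add_sum_erase T w ht
  have e4 := Finset.add_sum_erase (T.erase {a, b, c}) w (Finset.mem_erase.2 ⟨hne, ht'⟩)
  rw [show ({a, d, c} : Finset Plane) = {a, c, d} by rw [Finset.pair_comm]] at e1 ⊢
  linarith

open Classical in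
/-- Among all triangulations of `S`, those which minimize a weight which is decreased by flips are
Delaunay triangulations. -/
theorem exists_delaunay_sum_le (hT : IsTriangulation S T) {w : Finset Plane → ℝ}
    (hw : ∀ t, IsTriangle t → 0 ≤ w t)
    (hlt : ∀ {a b c d : Plane} {α β γ δ : ℝ}, FlippableQuad a b c d α β γ δ →
      w {a, c, d} + w {b, c, d} < w {a, b, c} + w {a, b, d}) :
    ∃ T', IsTriangulation S T' ∧ T' ⊆ delaunayTriangles S ∧ ∑ t ∈ T', w t ≤ ∑ t ∈ T, w t := by
  set F := (S.powersetCard 3).powerset.filter (IsTriangulation S) with hF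
  have hmem : ∀ T', T' ∈ F ↔ IsTriangulation S T' := fun T' => by
    rw [hF, Finset.mem_filter, Finset.mem_powerset]
    refine ⟨fun h => h.2, fun h => ⟨fun t ht => ?_, h⟩⟩
    exact Finset.mem_powersetCard.2 ⟨h.subset t ht, (h.isTriangle t ht).1⟩
  obtain ⟨T', hT', hmin⟩ := F.exists_min_image (fun T' => ∑ t ∈ T', w t) ⟨T, (hmem T).2 hT⟩
  rw [hmem] at hT'
  refine ⟨T', hT', ?_, hmin T ((hmem T).2 hT)⟩
  by_contra hnd
  obtain ⟨a, b, c, d, α, β, γ, δ, hq, h1, h2⟩ := hT'.exists_flippable hnd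
  exact absurd (hmin _ ((hmem _).2 (hT'.flip hq h1 h2))) (not_le.2 (sum_flip_lt hq h1 h2 hw (hlt hq)))

/-- Some Delaunay triangulation does at least as well as `T`, and all of them have the same sum. -/
theorem delaunay_sum_le {T' : Finset (Finset Plane)} (hT : IsTriangulation S T)
    (hT' : IsTriangulation S T') (hD : T' ⊆ delaunayTriangles S) :
    ∑ t ∈ T', radiusWeight 2 t ≤ ∑ t ∈ T, radiusWeight 2 t ∧
      ∑ t ∈ T', radiusWeight 1 t ≤ ∑ t ∈ T, radiusWeight 1 t := by
  constructor
  · obtain ⟨T'', h1, h2, h3⟩ := hT.exists_delaunay_sum_le (w := radiusWeight 2)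
      (fun t ht => ht.radiusWeight_nonneg 2) (fun h => h.radiusWeight_two_lt)
    rwa [sum_radiusWeight_eq_of_delaunay hT' h1 hD h2]
  · obtain ⟨T'', h1, h2, h3⟩ := hT.exists_delaunay_sum_le (w := radiusWeight 1)
      (fun t ht => ht.radiusWeight_nonneg 1) (fun h => h.radiusWeight_one_lt)
    rwa [sum_radiusWeight_eq_of_delaunay hT' h1 hD h2]

end IsTriangulation

/-! ### Existence of Delaunay triangulations by lifting. -/

/-- The affine function `k + m x₀ + n x₁` on the plane. -/
def affineFun (u : ℝ × ℝ × ℝ) (x : Plane) : ℝ := u.1 + u.2.1 * x 0 + u.2.2 * x 1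

theorem affineFun_sum (u : ℝ × ℝ × ℝ) (s : Finset Plane) (w : Plane → ℝ) {x : Plane}
    (h1 : ∑ p ∈ s, w p = 1) (hx : ∑ p ∈ s, w p • p = x) :
    affineFun u x = ∑ p ∈ s, w p * affineFun u p := by
  have h0 : ∑ i ∈ s, w i * i 0 = x 0 := by rw [← hx]; simp
  have h2 : ∑ i ∈ s, w i * i 1 = x 1 := by rw [← hx]; simp
  simp only [affineFun, mul_add, Finset.sum_add_distrib]
  rw [← Finset.sum_mul, h1, one_mul, ← h0, ← h2, Finset.mul_sum, Finset.mul_sum]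
  congr 1
  · congr 1
    exact Finset.sum_congr rfl fun i _ => by ring
  · exact Finset.sum_congr rfl fun i _ => by ring

theorem IsTriangle.exists_affineFun {t : Finset Plane} (ht : IsTriangle t) (h : Plane → ℝ) :
    ∃ u, ∀ p ∈ t, affineFun u p = h p := by
  obtain ⟨a, b, c, rfl, hor⟩ := ht.exists_orient_pos
  set m := ((h b - h a) * (c 1 - a 1) - (h c - h a) * (b 1 - a 1)) / orient a b c with hm
  set n := ((h c - h a) * (b 0 - a 0) - (h b - h a) * (c 0 - a 0)) / orient a b c with hn
  have hor' := hor.ne'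
  refine ⟨(h a - m * a 0 - n * a 1, m, n), fun p hp => ?_⟩
  simp only [Finset.mem_insert, Finset.mem_singleton] at hp
  rcases hp with rfl | rfl | rfl
  · simp only [affineFun]; ring
  all_goals
    simp only [affineFun, hm, hn]
    field_simp
    unfold orient
    ring

theorem sum_triple {M : Type*} [AddCommMonoid M] {a b c : Plane} (hab : a ≠ b) (hac : a ≠ c) (hbc : b ≠ c)
    [DecidableEq Plane] (f : Plane → M) : ∑ p ∈ ({a, b, c} : Finset Plane), f p = f a + f b + f c := by
  rw [Finset.sum_insert (by simp [hab, hac]), Finset.sum_pair hbc, add_assoc]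

open Classical in
theorem IsTriangle.exists_weights {t : Finset Plane} (ht : IsTriangle t) (q : Plane) :
    ∃ κ : Plane → ℝ, ∑ p ∈ t, κ p = 1 ∧ ∑ p ∈ t, κ p • p = q := by
  obtain ⟨a, b, c, rfl, hor⟩ := ht.exists_orient_pos
  obtain ⟨h1, h2, h3⟩ := ne_of_orient_ne_zero hor.ne'
  refine ⟨fun p => if p = a then orient q b c / orient a b c else
    if p = b then orient a q c / orient a b c else orient a b q / orient a b c, ?_, ?_⟩
  · rw [sum_triple h1 h2 h3]
    simp only [h1.symm, h2.symm, h3.symm, if_true, if_false]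
    rw [← add_div, ← add_div, orient_add, div_self hor.ne']
  · rw [sum_triple h1 h2 h3]
    simp only [h1.symm, h2.symm, h3.symm, if_true, if_false]
    exact orient_combination_eq q hor.ne'

/-- The heights `h` are generic: lifted points on a common nonvertical plane project to affinely
independent points. -/
def IsGenericHeight (S : Finset Plane) (h : Plane → ℝ) : Prop :=
  ∀ Q ⊆ S, (∃ u, ∀ q ∈ Q, affineFun u q = h q) → AffineIndependent ℝ ((↑) : Q → Plane)

open Classical in
/-- The triangles which lift to faces of the lower convex hull of the graph of `h` over `S`. -/
noncomputable def regularTriangles (S : Finset Plane) (h : Plane → ℝ) : Finset (Finset Plane) :=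
  {t ∈ S.powersetCard 3 | IsTriangle t ∧
    ∃ u, (∀ p ∈ t, affineFun u p = h p) ∧ ∀ q ∈ S, affineFun u q ≤ h q}

theorem mem_regularTriangles {S t : Finset Plane} {h : Plane → ℝ} :
    t ∈ regularTriangles S h ↔ t ⊆ S ∧ IsTriangle t ∧
      ∃ u, (∀ p ∈ t, affineFun u p = h p) ∧ ∀ q ∈ S, affineFun u q ≤ h q := by
  classical
  simp only [regularTriangles, Finset.mem_filter, Finset.mem_powersetCard]
  exact ⟨fun h => ⟨h.1.1, h.2⟩, fun h => ⟨⟨h.1, h.2.1.1⟩, h.2⟩⟩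

/-- The supporting functions u of `t` and u' of `t'` agree at a common point `x`, since each
dominates on its own triangle. Hence the vertices of `t'` with nonzero weight at `x` lie on the
plane of u. Together with `t` they are affinely independent by genericity of the heights, and hulls
of subsets of an affinely independent set meet in the hull of the intersection. -/
theorem inter_of_mem_regularTriangles {S : Finset Plane} {h : Plane → ℝ} (hh : IsGenericHeight S h)
    {t t' : Finset Plane} (ht : t ∈ regularTriangles S h) (ht' : t' ∈ regularTriangles S h) :
    convexHull ℝ (t : Set Plane) ∩ convexHull ℝ (t' : Set Plane) ⊆
      convexHull ℝ ((t : Set Plane) ∩ t') := by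
  classical
  rintro x ⟨hx, hx'⟩
  obtain ⟨hS, -, u, hu, hu2⟩ := mem_regularTriangles.1 ht
  obtain ⟨hS', -, u', hu', hu2'⟩ := mem_regularTriangles.1 ht'
  have hxt := hx
  rw [Finset.mem_convexHull'] at hx hx'
  obtain ⟨w, hw0, hw1, hwx⟩ := hx
  obtain ⟨w', hw0', hw1', hwx'⟩ := hx'
  have e1 : affineFun u' x ≤ affineFun u x := by
    rw [affineFun_sum u t w hw1 hwx, affineFun_sum u' t w hw1 hwx]
    refine Finset.sum_le_sum fun p hp => mul_le_mul_of_nonneg_left ?_ (hw0 p hp)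
    rw [hu p hp]
    exact hu2' p (hS hp)
  have hnn : ∀ p ∈ t', 0 ≤ w' p * (affineFun u' p - affineFun u p) := fun p hp => by
    refine mul_nonneg (hw0' p hp) ?_
    rw [hu' p hp]
    linarith [hu2 p (hS' hp)]
  have e2 : ∑ p ∈ t', w' p * (affineFun u' p - affineFun u p) = 0 := by
    refine le_antisymm ?_ (Finset.sum_nonneg hnn)
    simp only [mul_sub, Finset.sum_sub_distrib]
    rw [← affineFun_sum u t' w' hw1' hwx', ← affineFun_sum u' t' w' hw1' hwx']
    linarith
  rw [Finset.sum_eq_zero_iff_of_nonneg hnn] at e2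
  set s := t'.filter (fun p => w' p ≠ 0) with hs
  have hxs : x ∈ convexHull ℝ (s : Set Plane) := by
    rw [Finset.mem_convexHull']
    refine ⟨w', fun y hy => hw0' y (Finset.mem_of_mem_filter y hy), ?_, ?_⟩
    · rw [hs, Finset.sum_filter_ne_zero]
      exact hw1'
    · rw [hs, Finset.sum_filter_of_ne, hwx']
      intro p _ hp h0
      rw [h0, zero_smul] at hp
      exact hp rfl
  have hind := hh (t ∪ s) (Finset.union_subset hS ((Finset.filter_subset _ _).trans hS')) ⟨u, fun q hq => by
    rcases Finset.mem_union.1 hq with hq | hq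
    · exact hu q hq
    · obtain ⟨hq1, hq2⟩ := Finset.mem_filter.1 hq
      have := (mul_eq_zero.1 (e2 q hq1)).resolve_left hq2
      rw [hu' q hq1] at this
      linarith⟩
  have := hind.convexHull_inter (t₁ := t) (t₂ := s) Finset.subset_union_left Finset.subset_union_right
  have hmem : x ∈ convexHull ℝ ((t : Set Plane) ∩ s) := by
    rw [this]
    exact ⟨hxt, hxs⟩
  exact convexHull_mono (Set.inter_subset_inter_right _ (by exact_mod_cast Finset.filter_subset _ _)) hmem

open Classical in
-- Among the triangles containing `x`, take one whose lifted plane is lowest over `x`. If a point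
-- `q` were lifted below this plane, a simplex pivot would replace a vertex by `q`, keep `x` in the
-- triangle and lower the height.
theorem cover_regularTriangles {S : Finset Plane} (h : Plane → ℝ) {x : Plane}
    (hx : x ∈ convexHull ℝ (S : Set Plane)) (hgen : IsGeneric S x) :
    ∃ t ∈ regularTriangles S h, x ∈ convexHull ℝ (t : Set Plane) := by
  have hint : ∀ t : Finset Plane, ∃ u, IsTriangle t → ∀ p ∈ t, affineFun u p = h p := fun t => by
    by_cases ht : IsTriangle t
    · obtain ⟨u, hu⟩ := ht.exists_affineFun h
      exact ⟨u, fun _ => hu⟩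
    · exact ⟨0, fun h => absurd h ht⟩
  choose u hu using hint
  set C := (S.powersetCard 3).filter (fun t => IsTriangle t ∧ x ∈ convexHull ℝ (t : Set Plane)) with hC
  have hmem : ∀ t, t ∈ C ↔ t ⊆ S ∧ IsTriangle t ∧ x ∈ convexHull ℝ (t : Set Plane) := fun t => by
    rw [hC, Finset.mem_filter, Finset.mem_powersetCard]
    exact ⟨fun h => ⟨h.1.1, h.2⟩, fun h => ⟨⟨h.1, h.2.1.1⟩, h.2⟩⟩
  have hne : C.Nonempty := by
    rw [convexHull_eq_union] at hx
    simp only [Set.mem_iUnion, exists_prop] at hx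
    obtain ⟨t, ht, hind, hxt⟩ := hx
    have htS : t ⊆ S := by exact_mod_cast ht
    refine ⟨t, (hmem t).2 ⟨htS, ⟨?_, hind⟩, hxt⟩⟩
    have := card_le_three_of_affineIndependent hind
    by_contra hc
    exact hgen.notMem_convexHull htS (by omega) hxt
  obtain ⟨t, htC, hmin⟩ := C.exists_min_image (fun t => affineFun (u t) x) hne
  obtain ⟨htS, ht, hxt⟩ := (hmem t).1 htC
  refine ⟨t, mem_regularTriangles.2 ⟨htS, ht, u t, hu t ht, fun q hq => ?_⟩, hxt⟩
  by_contra! hlt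
  obtain ⟨κ, hκ1, hκq⟩ := ht.exists_weights q
  rw [Finset.mem_convexHull'] at hxt
  obtain ⟨w, hw0, hw1, hwx⟩ := hxt
  have hwpos : ∀ p ∈ t, 0 < w p := fun p hp => by
    refine lt_of_le_of_ne (hw0 p hp) fun h0 => ?_
    refine hgen.notMem_convexHull (e := t.erase p) ((Finset.erase_subset _ _).trans htS)
      (by rw [Finset.card_erase_of_mem hp, ht.1]) ?_
    rw [Finset.mem_convexHull']
    refine ⟨w, fun y hy => hw0 y (Finset.mem_of_mem_erase hy), ?_, ?_⟩
    · rw [← hw1, ← Finset.add_sum_erase _ _ hp, ← h0, zero_add]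
    · rw [← hwx, ← Finset.add_sum_erase _ _ hp, ← h0, zero_smul, zero_add]
  have hpos : (t.filter (fun p => 0 < κ p)).Nonempty := by
    by_contra hne
    rw [Finset.not_nonempty_iff_eq_empty, Finset.filter_eq_empty_iff] at hne
    have := Finset.sum_nonpos (fun p hp => not_lt.1 (hne hp) : ∀ p ∈ t, κ p ≤ 0)
    linarith
  -- The ratio test: the vertex whose weight first reaches 0 as weight θ is moved to `q`. Since all
  -- weights of the generic `x` are positive, θ > 0.
  obtain ⟨p₀, hp₀, hp₀min⟩ := (t.filter (fun p => 0 < κ p)).exists_min_image (fun p => w p / κ p) hpos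
  obtain ⟨hp₀t, hκ0⟩ := Finset.mem_filter.1 hp₀
  set θ := w p₀ / κ p₀ with hθ
  have hθ0 : 0 < θ := div_pos (hwpos p₀ hp₀t) hκ0
  have hθle : ∀ p ∈ t, 0 ≤ w p - θ * κ p := fun p hp => by
    rcases lt_or_ge 0 (κ p) with hk | hk
    · have := hp₀min p (Finset.mem_filter.2 ⟨hp, hk⟩)
      rw [le_div_iff₀ hk] at this
      linarith
    · have := mul_nonpos_of_nonneg_of_nonpos hθ0.le hk
      linarith [hw0 p hp]
  have hθ₀ : w p₀ - θ * κ p₀ = 0 := by rw [hθ]; field_simp; ring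
  obtain ⟨a, b, rfl, hor⟩ := ht.exists_orient_pos_of_mem hp₀t
  obtain ⟨hab, hac, hbc⟩ := ne_of_orient_ne_zero hor.ne'
  rw [sum_triple hab hac hbc] at hκ1 hκq hw1 hwx
  have hor' : 0 < orient a b q := by
    rw [orient_combination₃ hκ1 hκq, orient_self_mid, orient_self_right]
    have := mul_pos hκ0 hor
    linarith
  have ht' : IsTriangle {a, b, q} := isTriangle_of_orient hor'.ne'
  obtain ⟨hab', haq, hbq⟩ := ne_of_orient_ne_zero hor'.ne'
  have ha := hθle a (by simp)
  have hb := hθle b (by simp)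
  have hsum : (w a - θ * κ a) + (w b - θ * κ b) + θ = 1 := by
    linear_combination hw1 - θ * hκ1 - hθ₀
  have hcomb : (w a - θ * κ a) • a + (w b - θ * κ b) • b + θ • q = x := by
    rw [← hκq, ← hwx]
    have : w p₀ = θ * κ p₀ := by linarith
    rw [this]
    module
  have hxt' : x ∈ convexHull ℝ (({a, b, q} : Finset Plane) : Set Plane) := by
    simp only [Finset.coe_insert, Finset.coe_singleton]
    exact mem_convexHull_triple.2 ⟨_, _, _, ha, hb, hθ0.le, hsum, hcomb⟩
  have hC' : {a, b, q} ∈ C := by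
    refine (hmem _).2 ⟨?_, ht', hxt'⟩
    intro p hp
    simp only [Finset.mem_insert, Finset.mem_singleton] at hp
    rcases hp with rfl | rfl | rfl
    exacts [htS (by simp), htS (by simp), hq]
  have hle := hmin _ hC'
  have hu1 := hu {a, b, q} ht'
  have hu2 := hu {a, b, p₀} ht
  have key : ∀ v, affineFun v x = (w a - θ * κ a) * affineFun v a + (w b - θ * κ b) * affineFun v b +
      θ * affineFun v q := fun v => by
    rw [← hcomb]
    simp only [affineFun, PiLp.add_apply, PiLp.smul_apply, smul_eq_mul]
    linear_combination (-v.1) * hsum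
  rw [key, key (u {a, b, q}), hu1 a (by simp), hu1 b (by simp), hu1 q (by simp), hu2 a (by simp),
    hu2 b (by simp)] at hle
  have := mul_lt_mul_of_pos_left hlt hθ0
  linarith

/-- Comparing with the circle of radius 0 about `q`, the weighted sum of the |p - q|² is r² - |q -
c|², at most 0. A vertex of nonzero weight therefore equals `q`. -/
theorem mem_of_mem_convexHull_of_delaunay {S t : Finset Plane} (ht : t ∈ delaunayTriangles S) {q : Plane}
    (hq : q ∈ S) (hqt : q ∈ convexHull ℝ (t : Set Plane)) : q ∈ t := by
  obtain ⟨-, h3, c, r, hc, he⟩ := mem_delaunayTriangles.1 ht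
  rw [Finset.mem_convexHull'] at hqt
  obtain ⟨w, hw0, hw1, hwq⟩ := hqt
  have hr : 0 ≤ r := by
    obtain ⟨p, hp⟩ := Finset.card_pos.1 (by rw [h3.1]; norm_num : 0 < t.card)
    exact hc p hp ▸ dist_nonneg
  have h1 := sum_power_sub_power t w (fun p => p) q c q r 0 hw1 hwq
  have h2 : ∑ p ∈ t, w p * dist p q ^ 2 ≤ 0 := by
    have e : ∑ p ∈ t, w p * ((dist p c ^ 2 - r ^ 2) - (dist p q ^ 2 - 0 ^ 2)) = -∑ p ∈ t, w p * dist p q ^ 2 := by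
      rw [← Finset.sum_neg_distrib]
      refine Finset.sum_congr rfl fun p hp => ?_
      rw [hc p hp]
      ring
    rw [e, dist_self] at h1
    have := pow_le_pow_left₀ hr (he q hq) 2
    linarith
  have hnn : ∀ p ∈ t, 0 ≤ w p * dist p q ^ 2 := fun p hp => mul_nonneg (hw0 p hp) (by positivity)
  have h0 := (Finset.sum_eq_zero_iff_of_nonneg hnn).1 (le_antisymm h2 (Finset.sum_nonneg hnn))
  obtain ⟨p, hp, hwp⟩ := Finset.exists_ne_zero_of_sum_ne_zero (by rw [hw1]; exact one_ne_zero : ∑ p ∈ t, w p ≠ 0)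
  have := (mul_eq_zero.1 (h0 p hp)).resolve_left hwp
  rw [sq_eq_zero_iff, dist_eq_zero] at this
  exact this ▸ hp

theorem isTriangulation_regularTriangles {S : Finset Plane} {h : Plane → ℝ} (hh : IsGenericHeight S h)
    (hD : regularTriangles S h ⊆ delaunayTriangles S) : IsTriangulation S (regularTriangles S h) :=
  ⟨fun _ ht => (mem_regularTriangles.1 ht).1, fun _ ht => (mem_regularTriangles.1 ht).2.1,
    fun _ ht _ ht' => inter_of_mem_regularTriangles hh ht ht',
    fun _ ht _ hq hqt => mem_of_mem_convexHull_of_delaunay (hD ht) hq hqt,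
    fun _ hx hgen => cover_regularTriangles h hx hgen⟩

theorem dense_sum_ne_zero (Q : Finset Plane) (f : Plane → ℝ) (hf : ∃ x ∈ Q, f x ≠ 0) :
    IsOpen {h : Plane → ℝ | ∑ q ∈ Q, f q * h q ≠ 0} ∧
      Dense {h : Plane → ℝ | ∑ q ∈ Q, f q * h q ≠ 0} := by
  have hcont : Continuous (fun h : Plane → ℝ => ∑ q ∈ Q, f q * h q) := by fun_prop
  refine ⟨isOpen_ne_fun hcont continuous_const, fun h => ?_⟩
  by_cases h0 : ∑ q ∈ Q, f q * h q = 0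
  · have hpos : 0 < ∑ q ∈ Q, f q * f q := by
      obtain ⟨x, hx, hfx⟩ := hf
      exact Finset.sum_pos' (fun q _ => mul_self_nonneg _) ⟨x, hx, mul_self_pos.2 hfx⟩
    have hlim : Tendsto (fun ε : ℝ => h + ε • f) (𝓝[>] 0) (𝓝 h) := by
      have : Tendsto (fun ε : ℝ => h + ε • f) (𝓝 0) (𝓝 (h + (0 : ℝ) • f)) := by
        apply Continuous.tendsto (f := fun ε : ℝ => h + ε • f)
        fun_prop
      rw [zero_smul, add_zero] at this
      exact this.mono_left nhdsWithin_le_nhds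
    refine mem_closure_of_tendsto hlim ?_
    filter_upwards [self_mem_nhdsWithin] with ε hε
    have : ∑ q ∈ Q, f q * (h + ε • f) q = ε * ∑ q ∈ Q, f q * f q := by
      simp only [Pi.add_apply, Pi.smul_apply, smul_eq_mul, mul_add, Finset.sum_add_distrib, h0, zero_add,
        Finset.mul_sum]
      exact Finset.sum_congr rfl fun q _ => by ring
    change ∑ q ∈ Q, f q * (h + ε • f) q ≠ 0
    rw [this]
    exact (mul_pos hε hpos).ne'
  · exact subset_closure h0

/-- Each affinely dependent subset of `S` carries a nontrivial affine relation, which annihilates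
affine heights. It suffices to avoid finitely many hyperplanes, whose complements are open and
dense. -/
theorem exists_isGenericHeight_mem (S : Finset Plane) {U : Set (Plane → ℝ)} (hU : IsOpen U)
    (hne : U.Nonempty) : ∃ h ∈ U, IsGenericHeight S h := by
  classical
  have hrel : ∀ Q : Finset Plane, ∃ f : Plane → ℝ, ¬ AffineIndependent ℝ ((↑) : Q → Plane) →
      ∑ e ∈ Q, f e • e = 0 ∧ ∑ e ∈ Q, f e = 0 ∧ ∃ x ∈ Q, f x ≠ 0 := fun Q => by
    by_cases h : AffineIndependent ℝ ((↑) : Q → Plane)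
    · exact ⟨0, fun h' => absurd h h'⟩
    · obtain ⟨f, hf⟩ := exists_nontrivial_relation_sum_zero_of_not_affine_ind h
      exact ⟨f, fun _ => hf⟩
  choose f hf using hrel
  set B : Finset (Finset Plane) := S.powerset.filter (fun Q : Finset Plane => ¬ AffineIndependent ℝ ((↑) : Q → Plane)) with hB
  have hdense : ∀ F : Finset (Finset Plane), (∀ Q ∈ F, ¬ AffineIndependent ℝ ((↑) : Q → Plane)) →
      IsOpen (⋂ Q ∈ F, {h : Plane → ℝ | ∑ q ∈ Q, f Q q * h q ≠ 0}) ∧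
        Dense (⋂ Q ∈ F, {h : Plane → ℝ | ∑ q ∈ Q, f Q q * h q ≠ 0}) := by
    intro F
    induction F using Finset.induction_on with
    | empty => intro _; simp
    | insert Q F _ ih =>
      intro hF
      obtain ⟨i1, i2⟩ := ih fun Q' hQ' => hF Q' (Finset.mem_insert_of_mem hQ')
      obtain ⟨d1, d2⟩ := dense_sum_ne_zero Q (f Q) (hf Q (hF Q (Finset.mem_insert_self _ _))).2.2
      rw [Finset.set_biInter_insert]
      exact ⟨d1.inter i1, d2.inter_of_isOpen_left i2 d1⟩
  obtain ⟨h, hh, hhU⟩ := (hdense B fun Q hQ => (Finset.mem_filter.1 hQ).2).2.exists_mem_open hU hne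
  refine ⟨h, hhU, fun Q hQ ⟨u, hu⟩ => ?_⟩
  by_contra hind
  have hQB : Q ∈ B := Finset.mem_filter.2 ⟨Finset.mem_powerset.2 hQ, hind⟩
  have hne := Set.mem_iInter₂.1 hh Q hQB
  apply hne
  obtain ⟨h1, h2, -⟩ := hf Q hind
  have e0 : ∑ q ∈ Q, f Q q * q 0 = 0 := by
    have := congrArg (fun z : Plane => z 0) h1
    simpa using this
  have e1 : ∑ q ∈ Q, f Q q * q 1 = 0 := by
    have := congrArg (fun z : Plane => z 1) h1
    simpa using this
  calc ∑ q ∈ Q, f Q q * h q = ∑ q ∈ Q, f Q q * affineFun u q :=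
        Finset.sum_congr rfl fun q hq => by rw [hu q hq]
    _ = u.1 * ∑ q ∈ Q, f Q q + u.2.1 * ∑ q ∈ Q, f Q q * q 0 + u.2.2 * ∑ q ∈ Q, f Q q * q 1 := by
        rw [Finset.mul_sum, Finset.mul_sum, Finset.mul_sum, ← Finset.sum_add_distrib,
          ← Finset.sum_add_distrib]
        exact Finset.sum_congr rfl fun q _ => by unfold affineFun; ring
    _ = 0 := by rw [h2, e0, e1]; ring

/-- For the heights |p|², a point strictly inside the circumcircle of `t` is lifted strictly below
the plane over `t`. Choosing one such point for each bad triangle gives finitely many strict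
inequalities, an open set `U` of heights that contains generic ones. -/
theorem exists_delaunay_height (S : Finset Plane) :
    ∃ h, IsGenericHeight S h ∧ regularTriangles S h ⊆ delaunayTriangles S := by
  classical
  set F := (S.powersetCard 3).filter (fun t => IsTriangle t ∧ t ∉ delaunayTriangles S) with hF
  have hbad : ∀ t : Finset Plane, ∃ (q : Plane) (κ : Plane → ℝ), t ∈ F → q ∈ S ∧ ∑ p ∈ t, κ p = 1 ∧
      ∑ p ∈ t, κ p • p = q ∧ dist q 0 ^ 2 < ∑ p ∈ t, κ p * dist p 0 ^ 2 := fun t => by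
    by_cases htF : t ∈ F
    · obtain ⟨h1, h2, h3⟩ := Finset.mem_filter.1 htF
      obtain ⟨o, ho⟩ := h2.exists_circumcircle
      have hq : ∃ q ∈ S, dist q o < triangleCircumradius t := by
        by_contra! h
        exact h3 (mem_delaunayTriangles.2 ⟨(Finset.mem_powersetCard.1 h1).1, h2, o, _, ho, h⟩)
      obtain ⟨q, hqS, hq⟩ := hq
      obtain ⟨κ, hκ1, hκq⟩ := h2.exists_weights q
      refine ⟨q, κ, fun _ => ⟨hqS, hκ1, hκq, ?_⟩⟩
      have e1 := sum_power_sub_power t κ (fun p => p) q o 0 (triangleCircumradius t) 0 hκ1 hκq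
      have e2 : ∑ p ∈ t, κ p * ((dist p o ^ 2 - triangleCircumradius t ^ 2) - (dist p 0 ^ 2 - 0 ^ 2)) =
          -∑ p ∈ t, κ p * dist p 0 ^ 2 := by
        rw [← Finset.sum_neg_distrib]
        refine Finset.sum_congr rfl fun p hp => ?_
        rw [ho p hp]
        ring
      rw [e2] at e1
      have := pow_lt_pow_left₀ hq dist_nonneg two_ne_zero
      linarith
    · exact ⟨0, 0, fun h => absurd h htF⟩
  choose q κ hqκ using hbad
  set U : Set (Plane → ℝ) := ⋂ t ∈ F, {h | h (q t) < ∑ p ∈ t, κ t p * h p} with hU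
  have hUo : IsOpen U := by
    refine isOpen_biInter_finset fun t _ => ?_
    refine isOpen_lt ?_ ?_ <;> fun_prop
  obtain ⟨h, hhU, hgen⟩ := exists_isGenericHeight_mem S hUo
    ⟨fun p => dist p 0 ^ 2, Set.mem_iInter₂.2 fun t ht => (hqκ t ht).2.2.2⟩
  refine ⟨h, hgen, fun t ht => ?_⟩
  obtain ⟨htS, h3, u, hu1, hu2⟩ := mem_regularTriangles.1 ht
  by_contra hnd
  have htF : t ∈ F := Finset.mem_filter.2 ⟨Finset.mem_powersetCard.2 ⟨htS, h3.1⟩, h3, hnd⟩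
  obtain ⟨hqS, hκ1, hκq, -⟩ := hqκ t htF
  have hlt : h (q t) < ∑ p ∈ t, κ t p * h p := Set.mem_iInter₂.1 hhU t htF
  have e1 := affineFun_sum u t (κ t) hκ1 hκq
  have e2 : ∑ p ∈ t, κ t p * affineFun u p = ∑ p ∈ t, κ t p * h p :=
    Finset.sum_congr rfl fun p hp => by rw [hu1 p hp]
  have := hu2 _ hqS
  linarith

/-- The simplicial complex of all faces of the triangles of a triangulation. -/
def IsTriangulation.toGeometric {S : Finset Plane} {T : Finset (Finset Plane)} (hT : IsTriangulation S T)
    {t₀ : Finset Plane} (h₀ : IsTriangle t₀) (h₀S : t₀ ⊆ S) : GeometricTriangulation S where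
  faces := {f | f.Nonempty ∧ ∃ t ∈ T, f ⊆ t}
  isRelLowerSet_faces := fun _ ha => ⟨ha.1, fun _ hb hne => ⟨hne, ha.2.imp fun _ ht => ⟨ht.1, hb.trans ht.2⟩⟩⟩
  indep := by
    rintro f ⟨-, t, ht, hft⟩
    exact (hT.isTriangle t ht).2.mono (s := (f : Set Plane)) (t := (t : Set Plane)) (by exact_mod_cast hft)
  inter_subset_convexHull := by
    classical
    rintro f f' ⟨-, t, ht, hft⟩ ⟨-, t', ht', hft'⟩ x ⟨hx, hx'⟩
    have h1 := hT.inter t ht t' ht' ⟨convexHull_mono (by exact_mod_cast hft) hx,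
      convexHull_mono (by exact_mod_cast hft') hx'⟩
    rw [← Finset.coe_inter] at h1
    -- The point is in the hull of `t ∩ t'`. Intersecting with `f` inside `t`, then with `f'` inside
    -- `t'`, uses only affine independence of the two triangles.
    have h2 := (hT.isTriangle t ht).2.convexHull_inter (t₁ := f) (t₂ := t ∩ t') hft Finset.inter_subset_left
    have h3 : x ∈ convexHull ℝ ((f : Set Plane) ∩ ((t ∩ t' : Finset Plane) : Set Plane)) := by
      rw [h2]; exact ⟨hx, h1⟩
    rw [← Finset.coe_inter] at h3
    have h4 := (hT.isTriangle t' ht').2.convexHull_inter (t₁ := f ∩ (t ∩ t')) (t₂ := f')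
      (Finset.inter_subset_right.trans Finset.inter_subset_right) hft'
    have h5 : x ∈ convexHull ℝ (((f ∩ (t ∩ t') : Finset Plane) : Set Plane) ∩ f') := by
      rw [h4]; exact ⟨h3, hx'⟩
    refine convexHull_mono ?_ h5
    rintro p ⟨hp, hp'⟩
    exact ⟨Finset.mem_of_mem_inter_left hp, hp'⟩
  vertices_eq := by
    ext p
    constructor
    · rintro ⟨-, t, ht, hpt⟩
      exact hT.subset t ht (Finset.singleton_subset_iff.1 hpt)
    · intro hp
      obtain ⟨t, ht, hpt⟩ := hT.exists_mem h₀ h₀S (subset_convexHull ℝ _ hp)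
      exact ⟨Finset.singleton_nonempty p, t, ht,
        Finset.singleton_subset_iff.2 (hT.mem_of_mem_convexHull t ht p hp hpt)⟩
  space_eq := by
    ext x
    rw [Geometry.SimplicialComplex.mem_space_iff]
    constructor
    · rintro ⟨f, ⟨-, t, ht, hft⟩, hx⟩
      exact convexHull_mono (by exact_mod_cast hft.trans (hT.subset t ht)) hx
    · intro hx
      obtain ⟨t, ht, hxt⟩ := hT.exists_mem h₀ h₀S hx
      refine ⟨t, ⟨Finset.card_pos.1 ?_, t, ht, Finset.Subset.refl t⟩, hxt⟩
      rw [(hT.isTriangle t ht).1]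
      norm_num

theorem exists_delaunay_of_triangle {S t₀ : Finset Plane} (h₀ : IsTriangle t₀) (h₀S : t₀ ⊆ S) :
    ∃ D : GeometricTriangulation S, D.IsDelaunay := by
  obtain ⟨h, hgen, hD⟩ := exists_delaunay_height S
  have hT := isTriangulation_regularTriangles hgen hD
  refine ⟨hT.toGeometric h₀ h₀S, fun f hf => ?_⟩
  obtain ⟨⟨-, t, ht, hft⟩, hc⟩ := (GeometricTriangulation.mem_triangles _ f).1 hf
  have : f = t := Finset.eq_of_subset_of_card_le hft (by rw [hc, (hT.isTriangle t ht).1])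
  exact this ▸ hD ht

/-! ### Collinear point sets. -/

/-- A triangulation of `S ∪ {p}`, with `p` outside the affine span of `S`, restricts to `S`. -/
theorem exists_delaunay_of_insert [DecidableEq Plane] {S : Finset Plane} {p : Plane}
    (hp : p ∉ affineSpan ℝ (S : Set Plane))
    (h : ∃ D : GeometricTriangulation (insert p S), D.IsDelaunay) :
    ∃ D : GeometricTriangulation S, D.IsDelaunay := by
  obtain ⟨D, hD⟩ := h
  have hpS : p ∉ S := fun h => hp (subset_affineSpan ℝ _ h)
  have hsub : ∀ f ∈ D.faces, f ⊆ insert p S := fun f hf q hq => by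
    have hq' : q ∈ D.toSimplicialComplex.vertices :=
      D.down_closed hf (Finset.singleton_subset_iff.2 hq) (Finset.singleton_nonempty q)
    rw [D.vertices_eq] at hq'
    exact hq'
  let K : Geometry.SimplicialComplex ℝ Plane :=
    { faces := {f | f ∈ D.faces ∧ f ⊆ S}
      isRelLowerSet_faces := fun _ ha => ⟨D.nonempty_of_mem_faces ha.1, fun _ hb hne =>
        ⟨D.down_closed ha.1 hb hne, hb.trans ha.2⟩⟩
      indep := fun hs => D.indep hs.1
      inter_subset_convexHull := fun hs ht => D.inter_subset_convexHull hs.1 ht.1 }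
  have hv : K.vertices = (S : Set Plane) := by
    ext q
    constructor
    · rintro ⟨-, hq⟩
      exact Finset.singleton_subset_iff.1 hq
    · intro hq
      have : q ∈ D.toSimplicialComplex.vertices := by
        rw [D.vertices_eq]
        exact Finset.mem_insert_of_mem hq
      exact ⟨this, Finset.singleton_subset_iff.2 hq⟩
  have hsp : K.space = convexHull ℝ (S : Set Plane) := by
    ext x
    rw [Geometry.SimplicialComplex.mem_space_iff]
    constructor
    · rintro ⟨f, ⟨-, hf⟩, hx⟩
      exact convexHull_mono (by exact_mod_cast hf) hx
    · intro hx
      have hxS := convexHull_subset_affineSpan _ hx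
      have hx' : x ∈ D.toSimplicialComplex.space := by
        rw [D.space_eq]
        exact convexHull_mono (by simp) hx
      obtain ⟨f, hf, hxf⟩ := Geometry.SimplicialComplex.mem_space_iff.1 hx'
      have hfS : f.erase p ⊆ S := fun q hq => by
        obtain ⟨h1, h2⟩ := Finset.mem_erase.1 hq
        exact (Finset.mem_insert.1 (hsub f hf h2)).resolve_left h1
      -- If `p` had a positive weight at `x`, it would lie on the line through `x` and a point `y`
      -- of the opposite face, or equal `x`; both put `p` into the affine span of `S`.
      have hxe : x ∈ convexHull ℝ ((f.erase p : Finset Plane) : Set Plane) := by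
        by_cases hpf : p ∈ f
        · rcases (f.erase p).eq_empty_or_nonempty with he | hne
          · have : f = {p} := by rw [← Finset.insert_erase hpf, he]; rfl
            rw [this, Finset.coe_singleton, convexHull_singleton, Set.mem_singleton_iff] at hxf
            exact absurd (hxf ▸ hxS) hp
          · rw [← Finset.insert_erase hpf, Finset.coe_insert, convexHull_insert (by exact_mod_cast hne),
              mem_convexJoin] at hxf
            obtain ⟨p', hp', y, hy, hxy⟩ := hxf
            rw [Set.mem_singleton_iff] at hp'
            subst hp'
            have hyS : y ∈ affineSpan ℝ (S : Set Plane) :=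
              convexHull_subset_affineSpan _ (convexHull_mono (by exact_mod_cast hfS) hy)
            by_cases hxy' : x = y
            · exact hxy' ▸ hy
            · exfalso
              apply hp
              rw [segment_eq_image_lineMap] at hxy
              obtain ⟨θ, -, rfl⟩ := hxy
              have hθ : 1 - θ ≠ 0 := fun h0 => hxy' (by
                rw [show θ = 1 by linarith, AffineMap.lineMap_apply_one])
              have : p' = AffineMap.lineMap y (AffineMap.lineMap p' y θ : Plane) (1 - θ)⁻¹ := by
                rw [AffineMap.lineMap_apply_module, AffineMap.lineMap_apply_module, smul_add, smul_smul,
                  smul_smul, inv_mul_cancel₀ hθ, one_smul, add_left_comm, ← add_smul]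
                have : (1 - (1 - θ)⁻¹ + (1 - θ)⁻¹ * θ) = 0 := by field_simp; ring
                rw [this, zero_smul, add_zero]
              rw [this]
              exact AffineMap.lineMap_mem _ hyS hxS
        · rwa [Finset.erase_eq_of_notMem hpf]
      have hne : (f.erase p).Nonempty := by
        rw [← Finset.coe_nonempty]
        exact convexHull_nonempty_iff.1 ⟨x, hxe⟩
      exact ⟨f.erase p, ⟨D.down_closed hf (Finset.erase_subset _ _) hne, hfS⟩, hxe⟩
  refine ⟨{ toSimplicialComplex := K, vertices_eq := hv, space_eq := hsp }, fun f hf => ?_⟩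
  obtain ⟨⟨hf1, hf2⟩, hc⟩ := (GeometricTriangulation.mem_triangles _ f).1 hf
  obtain ⟨-, h3, c, r, h4, h5⟩ := mem_delaunayTriangles.1 (hD ((D.mem_triangles f).2 ⟨hf1, hc⟩))
  exact mem_delaunayTriangles.2 ⟨hf2, h3, c, r, h4, fun q hq => h5 q (Finset.mem_insert_of_mem hq)⟩

theorem orient_ne_zero_of_notMem_line {a b p : Plane} (hab : a ≠ b) (hp : p ∉ line[ℝ, a, b]) :
    orient a b p ≠ 0 := by
  rw [Ne, ← collinear_iff_orient]
  intro h
  exact hp (h.mem_affineSpan_of_mem_of_ne (by simp) (by simp) (by simp) hab)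

theorem exists_notMem_line (a b : Plane) : ∃ p, p ∉ line[ℝ, a, b] := by
  by_contra! h
  exact line_ne_top a b (by ext p; simp [h p])

theorem exists_delaunay_of_ne {S : Finset Plane} {a b : Plane} (ha : a ∈ S) (hb : b ∈ S) (hab : a ≠ b) :
    ∃ D : GeometricTriangulation S, D.IsDelaunay := by
  classical
  by_cases h : ∃ c ∈ S, c ∉ line[ℝ, a, b]
  · obtain ⟨c, hc, hcl⟩ := h
    refine exists_delaunay_of_triangle (isTriangle_of_orient (orient_ne_zero_of_notMem_line hab hcl)) ?_
    intro p hp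
    simp only [Finset.mem_insert, Finset.mem_singleton] at hp
    rcases hp with rfl | rfl | rfl <;> assumption
  · push Not at h
    obtain ⟨p, hp⟩ := exists_notMem_line a b
    refine exists_delaunay_of_insert (p := p) (fun hpS => hp (affineSpan_le.2 (fun c hc => h c hc) hpS)) ?_
    refine exists_delaunay_of_triangle (isTriangle_of_orient (orient_ne_zero_of_notMem_line hab hp)) ?_
    intro q hq
    simp only [Finset.mem_insert, Finset.mem_singleton] at hq ⊢
    rcases hq with rfl | rfl | rfl <;> simp [*]

theorem exists_delaunay (S : Finset Plane) : ∃ D : GeometricTriangulation S, D.IsDelaunay := by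
  classical
  rcases S.eq_empty_or_nonempty with rfl | ⟨a, ha⟩
  · let K : Geometry.SimplicialComplex ℝ Plane :=
      { faces := ∅
        isRelLowerSet_faces := (fun _ h => absurd h (Set.notMem_empty _))
        indep := (fun h => absurd h (Set.notMem_empty _))
        inter_subset_convexHull := (fun h => absurd h (Set.notMem_empty _)) }
    refine ⟨{ toSimplicialComplex := K, vertices_eq := ?_, space_eq := ?_ }, ?_⟩
    · ext p
      simp [Geometry.SimplicialComplex.vertices, K]
    · ext p
      simp [Geometry.SimplicialComplex.space, K]
    · intro f hf
      exact absurd ((GeometricTriangulation.mem_triangles _ f).1 hf).1 (Set.notMem_empty _)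
  · by_cases h : ∃ b ∈ S, a ≠ b
    · obtain ⟨b, hb, hab⟩ := h
      exact exists_delaunay_of_ne ha hb hab
    · push Not at h
      obtain ⟨p, hp⟩ := exists_notMem_line a a
      have hap : p ≠ a := fun h => hp (h ▸ left_mem_affineSpan_pair ℝ _ _)
      refine exists_delaunay_of_insert (p := p) (fun hpS => hp (affineSpan_le.2 (fun c hc => ?_) hpS)) ?_
      · rw [← h c hc]
        exact left_mem_affineSpan_pair ℝ _ _
      · exact exists_delaunay_of_ne (Finset.mem_insert_self p S) (Finset.mem_insert_of_mem ha) hap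

/-! ### The Voronoi functional of an acute triangle. -/

theorem inner_pos_of_angle_lt {a b c : Plane} (h : EuclideanGeometry.angle a b c < Real.pi / 2) :
    0 < (a 0 - b 0) * (c 0 - b 0) + (a 1 - b 1) * (c 1 - b 1) := by
  rw [EuclideanGeometry.angle, InnerProductGeometry.angle, Real.arccos_lt_pi_div_two] at h
  have h' : 0 < inner ℝ (a -ᵥ b) (c -ᵥ b) := by
    by_contra hn
    exact absurd h (not_lt.2 (div_nonpos_of_nonpos_of_nonneg (not_lt.1 hn) (by positivity)))
  rw [EuclideanSpace.inner_eq_star_dotProduct] at h'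
  simp [dotProduct, Fin.sum_univ_two] at h'
  linarith

/-- Shows that the circumcenter is on the inner side of `b c` exactly when the angle at `a` is
acute. -/
theorem orient_circumcenter_mul {a b c o : Plane} {r : ℝ} (ha : dist a o = r) (hb : dist b o = r)
    (hc : dist c o = r) :
    2 * orient o b c * orient a b c =
      dist b c ^ 2 * ((b 0 - a 0) * (c 0 - a 0) + (b 1 - a 1) * (c 1 - a 1)) := by
  have ha' := dist_sq_plane a o
  have hb' := dist_sq_plane b o
  have hc' := dist_sq_plane c o
  rw [ha] at ha'
  rw [hb] at hb'
  rw [hc] at hc'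
  rw [dist_sq_plane]
  unfold orient
  linear_combination
    (((b 0 - a 0) * (c 0 - a 0) + (b 1 - a 1) * (c 1 - a 1)) - ((b 0 - a 0) ^ 2 + (b 1 - a 1) ^ 2)) *
      (hc' - ha') +
    (((b 0 - a 0) * (c 0 - a 0) + (b 1 - a 1) * (c 1 - a 1)) - ((c 0 - a 0) ^ 2 + (c 1 - a 1) ^ 2)) *
      (hb' - ha')

theorem orient_circumcenter_pos {a b c o : Plane} {r : ℝ} (ha : dist a o = r) (hb : dist b o = r)
    (hc : dist c o = r) (h : 0 < orient a b c)
    (hA : 0 < (b 0 - a 0) * (c 0 - a 0) + (b 1 - a 1) * (c 1 - a 1)) : 0 < orient o b c := by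
  have hbc : 0 < dist b c := dist_pos.2 (ne_of_orient_ne_zero h.ne').2.2
  have := orient_circumcenter_mul ha hb hc
  have h2 : 0 < 2 * orient o b c * orient a b c := by rw [this]; positivity
  have := pos_of_mul_pos_left h2 h.le
  linarith

theorem aedisjoint_of_orient {p q : Plane} (hpq : p ≠ q) {s t : Set Plane}
    (hs : ∀ x ∈ s, 0 ≤ orient p q x) (ht : ∀ x ∈ t, orient p q x ≤ 0) :
    MeasureTheory.AEDisjoint MeasureTheory.volume s t := by
  refine MeasureTheory.measure_mono_null (fun x hx => ?_) (volume_line p q)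
  by_contra hl
  exact orient_ne_zero_of_notMem_line hpq hl (le_antisymm (ht x hx.2) (hs x hx.1))

theorem isCompact_triangle (a b c : Plane) : IsCompact (convexHull ℝ ({a, b, c} : Set Plane)) :=
  Set.Finite.isCompact_convexHull ℝ (Set.toFinite _)

theorem setIntegral_union_compact {s t : Set Plane} (hs : IsCompact s) (ht : IsCompact t)
    (hst : MeasureTheory.AEDisjoint MeasureTheory.volume s t) {f : Plane → ℝ} (hf : Continuous f) :
    ∫ x in s ∪ t, f x = (∫ x in s, f x) + ∫ x in t, f x :=
  MeasureTheory.setIntegral_union₀ hst ht.measurableSet.nullMeasurableSet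
    (hf.continuousOn.integrableOn_compact hs) (hf.continuousOn.integrableOn_compact ht)

theorem setIntegral_triangle_midpoint {a b o m : Plane} (h : 0 < orient a b o)
    (h0 : m 0 = (a 0 + b 0) / 2) (h1 : m 1 = (a 1 + b 1) / 2) {f : Plane → ℝ} (hf : Continuous f) :
    ∫ x in convexHull ℝ ({a, b, o} : Set Plane), f x =
      (∫ x in convexHull ℝ ({a, m, o} : Set Plane), f x) +
        ∫ x in convexHull ℝ ({b, m, o} : Set Plane), f x := by
  have hma : orient a m o = orient a b o / 2 := by unfold orient; rw [h0, h1]; ring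
  have hmb : orient m b o = orient a b o / 2 := by unfold orient; rw [h0, h1]; ring
  have hpa : 0 < orient a m o := by linarith
  have hpb : 0 < orient m b o := by linarith
  have e : ({b, m, o} : Set Plane) = {m, b, o} := Set.insert_comm _ _ _
  rw [e]
  have key : ∀ x, orient x m o = -orient x o m ∧ orient m x o = orient x o m := fun x => by
    unfold orient; constructor <;> ring
  have ea : ∀ x, orient a m x = orient a b x / 2 := fun x => by unfold orient; rw [h0, h1]; ring
  have eb : ∀ x, orient m b x = orient a b x / 2 := fun x => by unfold orient; rw [h0, h1]; ring
  have es : ∀ x, orient x b o - orient a x o = 2 * orient x m o := fun x => by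
    unfold orient; rw [h0, h1]; ring
  have eo : ∀ x, orient o m x = orient x o m := fun x => by unfold orient; ring
  have hom : o ≠ m := (ne_of_orient_ne_zero hpa.ne').2.2.symm
  have hU : convexHull ℝ ({a, b, o} : Set Plane) =
      convexHull ℝ ({a, m, o} : Set Plane) ∪ convexHull ℝ ({m, b, o} : Set Plane) := by
    ext x
    rw [Set.mem_union, mem_convexHull_triple_iff_orient h, mem_convexHull_triple_iff_orient hpa,
      mem_convexHull_triple_iff_orient hpb, ea, eb, (key x).1, (key x).2]
    have := es x
    rw [(key x).1] at this
    constructor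
    · rintro ⟨h1, h2, h3⟩
      rcases le_total 0 (orient x o m) with h | h
      · exact Or.inr ⟨h1, h, by linarith⟩
      · exact Or.inl ⟨by linarith, h2, by linarith⟩
    · rintro (⟨h1, h2, h3⟩ | ⟨h1, h2, h3⟩)
      · exact ⟨by linarith, by linarith, by linarith⟩
      · exact ⟨by linarith, by linarith, by linarith⟩
  rw [hU]
  refine setIntegral_union_compact (isCompact_triangle _ _ _) (isCompact_triangle _ _ _) ?_ hf
  refine (aedisjoint_of_orient hom (fun x hx => ?_) (fun x hx => ?_)).symm
  · rw [eo, ← (key x).2]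
    exact ((mem_convexHull_triple_iff_orient hpb).1 hx).2.1
  · rw [eo]
    linarith [((mem_convexHull_triple_iff_orient hpa).1 hx).1, (key x).1]

theorem setIntegral_triangle_interior {a b c o : Plane} (hab : 0 < orient a b o)
    (hbc : 0 < orient b c o) (hca : 0 < orient c a o) {f : Plane → ℝ} (hf : Continuous f) :
    ∫ x in convexHull ℝ ({a, b, c} : Set Plane), f x =
      (∫ x in convexHull ℝ ({a, b, o} : Set Plane), f x) +
        (∫ x in convexHull ℝ ({b, c, o} : Set Plane), f x) +
        ∫ x in convexHull ℝ ({c, a, o} : Set Plane), f x := by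
  have hs : orient a b c = orient a b o + orient b c o + orient c a o := by unfold orient; ring
  have h : 0 < orient a b c := by linarith
  have side : ∀ {p q x : Plane}, 0 < orient p q o → x ∈ convexHull ℝ ({p, q, o} : Set Plane) →
      0 ≤ orient p q x ∧ 0 ≤ orient o p x ∧ orient o q x ≤ 0 := by
    intro p q x hpq hx
    obtain ⟨h1, h2, h3⟩ := (mem_convexHull_triple_iff_orient hpq).1 hx
    have e1 : orient x q o = -orient o q x := by unfold orient; ring
    have e2 : orient p x o = orient o p x := by unfold orient; ring
    exact ⟨h3, by linarith, by linarith⟩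
  have side' : ∀ {p q x : Plane}, 0 < orient p q o → 0 ≤ orient p q x → 0 ≤ orient o p x →
      orient o q x ≤ 0 → x ∈ convexHull ℝ ({p, q, o} : Set Plane) := by
    intro p q x hpq h1 h2 h3
    have e1 : orient x q o = -orient o q x := by unfold orient; ring
    have e2 : orient p x o = orient o p x := by unfold orient; ring
    exact (mem_convexHull_triple_iff_orient hpq).2 ⟨by linarith, by linarith, h1⟩
  have ho : o ∈ convexHull ℝ ({a, b, c} : Set Plane) := by
    refine (mem_convexHull_triple_iff_orient h).2 ⟨?_, ?_, hab.le⟩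
    · rw [← orient_rotate]; exact hbc.le
    · rw [← orient_rotate, ← orient_rotate] ; exact hca.le
  have hU : convexHull ℝ ({a, b, c} : Set Plane) =
      convexHull ℝ ({a, b, o} : Set Plane) ∪ convexHull ℝ ({b, c, o} : Set Plane) ∪
        convexHull ℝ ({c, a, o} : Set Plane) := by
    refine Set.Subset.antisymm (fun x hx => ?_) ?_
    · obtain ⟨h1, h2, h3⟩ := (mem_convexHull_triple_iff_orient h).1 hx
      have e1 : orient x b c = orient b c x := by unfold orient; ring
      have e2 : orient a x c = orient c a x := by unfold orient; ring
      rw [e1] at h1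
      rw [e2] at h2
      -- From the barycentric coordinates of `o`: a positive combination of the three orientations
      -- is zero, so they do not all have one strict sign. Hence in cyclic order some value ≥ 0 is
      -- followed by one ≤ 0, which picks the sector containing `x`.
      have hz : orient b c o * orient o a x + orient c a o * orient o b x +
          orient a b o * orient o c x = 0 := by unfold orient; ring
      have h4 : ¬ (0 < orient o a x ∧ 0 < orient o b x ∧ 0 < orient o c x) := by
        rintro ⟨ha, hb, hc⟩
        have := mul_pos hbc ha
        have := mul_pos hca hb
        have := mul_pos hab hc
        linarith
      have h5 : ¬ (orient o a x < 0 ∧ orient o b x < 0 ∧ orient o c x < 0) := by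
        rintro ⟨ha, hb, hc⟩
        have := mul_neg_of_pos_of_neg hbc ha
        have := mul_neg_of_pos_of_neg hca hb
        have := mul_neg_of_pos_of_neg hab hc
        linarith
      by_cases A : 0 ≤ orient o a x ∧ orient o b x ≤ 0
      · exact Or.inl (Or.inl (side' hab h3 A.1 A.2))
      by_cases B : 0 ≤ orient o b x ∧ orient o c x ≤ 0
      · exact Or.inl (Or.inr (side' hbc h1 B.1 B.2))
      refine Or.inr (side' hca h2 ?_ ?_) <;> grind
    · refine Set.union_subset (Set.union_subset ?_ ?_) ?_ <;>
      · refine convexHull_min ?_ (convex_convexHull ℝ _)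
        rintro x (rfl | rfl | rfl)
        · exact subset_convexHull ℝ _ (by simp)
        · exact subset_convexHull ℝ _ (by simp)
        · exact ho
  have hoa : o ≠ a := (ne_of_orient_ne_zero hab.ne').2.1.symm
  have hob : o ≠ b := (ne_of_orient_ne_zero hab.ne').2.2.symm
  have hoc : o ≠ c := (ne_of_orient_ne_zero hbc.ne').2.2.symm
  rw [hU, setIntegral_union_compact ((isCompact_triangle _ _ _).union (isCompact_triangle _ _ _))
      (isCompact_triangle _ _ _) ?_ hf,
    setIntegral_union_compact (isCompact_triangle _ _ _) (isCompact_triangle _ _ _) ?_ hf]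
  · exact (aedisjoint_of_orient hob (fun x hx => (side hbc hx).2.1)
      (fun x hx => (side hab hx).2.2)).symm
  · refine MeasureTheory.AEDisjoint.union_left ?_ ?_
    · exact aedisjoint_of_orient hoa (fun x hx => (side hab hx).2.1) (fun x hx => (side hca hx).2.2)
    · exact (aedisjoint_of_orient hoc (fun x hx => (side hca hx).2.1)
        (fun x hx => (side hbc hx).2.2)).symm

/-- The differences |x - b|² - |x - a|² and |x - c|² - |x - a|² are affine in `x`, so it suffices
that they are nonnegative at `a`, `m` and `o`. The only nontrivial value is the second one at the
midpoint `m`: it is the inner product at `c`, nonnegative when that angle is not obtuse. -/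
theorem infDist_eq_of_mem_triangle {a b c o m x : Plane} {r : ℝ} (ha : dist a o = r)
    (hb : dist b o = r) (hc : dist c o = r) (h0 : m 0 = (a 0 + b 0) / 2)
    (h1 : m 1 = (a 1 + b 1) / 2) (hC : 0 ≤ (a 0 - c 0) * (b 0 - c 0) + (a 1 - c 1) * (b 1 - c 1))
    (hx : x ∈ convexHull ℝ ({a, m, o} : Set Plane)) :
    Metric.infDist x ({a, b, c} : Set Plane) = dist x a := by
  obtain ⟨α, β, γ, hα, hβ, hγ, hs, rfl⟩ := mem_convexHull_triple.1 hx
  have ha' := dist_sq_plane a o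
  have hb' := dist_sq_plane b o
  have hc' := dist_sq_plane c o
  rw [ha] at ha'
  rw [hb] at hb'
  rw [hc] at hc'
  set x := α • a + β • m + γ • o with hxd
  have x0 : x 0 = α * a 0 + β * m 0 + γ * o 0 := by simp [hxd]
  have x1 : x 1 = α * a 1 + β * m 1 + γ * o 1 := by simp [hxd]
  have hα' : α = 1 - β - γ := by linarith
  have hxb : dist x a ≤ dist x b := by
    refine le_of_sq_le_sq ?_ dist_nonneg
    have : dist x b ^ 2 - dist x a ^ 2 = α * dist a b ^ 2 := by
      simp only [dist_sq_plane, x0, x1, h0, h1]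
      subst hα'
      linear_combination γ * (ha' - hb')
    have : 0 ≤ α * dist a b ^ 2 := by positivity
    linarith
  have hxc : dist x a ≤ dist x c := by
    refine le_of_sq_le_sq ?_ dist_nonneg
    have : dist x c ^ 2 - dist x a ^ 2 =
        α * dist a c ^ 2 + β * ((a 0 - c 0) * (b 0 - c 0) + (a 1 - c 1) * (b 1 - c 1)) := by
      simp only [dist_sq_plane, x0, x1, h0, h1]
      subst hα'
      linear_combination γ * (ha' - hc')
    have : 0 ≤ α * dist a c ^ 2 := by positivity
    have := mul_nonneg hβ hC
    linarith
  refine le_antisymm (Metric.infDist_le_dist_of_mem (by simp)) ?_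
  rw [Metric.le_infDist ⟨a, by simp⟩]
  rintro y (rfl | rfl | rfl)
  · exact le_rfl
  · exact hxb
  · exact hxc

theorem setIntegral_infDist_half {a b c o m : Plane} {r : ℝ} (ha : dist a o = r)
    (hb : dist b o = r) (hc : dist c o = r) (h0 : m 0 = (a 0 + b 0) / 2)
    (h1 : m 1 = (a 1 + b 1) / 2) (hC : 0 ≤ (a 0 - c 0) * (b 0 - c 0) + (a 1 - c 1) * (b 1 - c 1))
    (h : orient a b o ≠ 0) :
    ∫ x in convexHull ℝ ({a, m, o} : Set Plane), Metric.infDist x ({a, b, c} : Set Plane) ^ 2 =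
      |orient a b o| / 24 * (dist a b ^ 2 / 2 + r ^ 2) := by
  have hma : orient a m o = orient a b o / 2 := by unfold orient; rw [h0, h1]; ring
  have hne : orient a m o ≠ 0 := by rw [hma]; exact div_ne_zero h two_ne_zero
  rw [MeasureTheory.setIntegral_congr_fun (isCompact_triangle _ _ _).measurableSet
    (g := fun x => dist x a ^ 2)
    (fun x hx => by rw [infDist_eq_of_mem_triangle ha hb hc h0 h1 hC hx]),
    setIntegral_triangle_dist_sq _ _ _ hne, hma, abs_div, abs_two]
  have ha' := dist_sq_plane a o
  have hb' := dist_sq_plane b o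
  rw [ha] at ha'
  rw [hb] at hb'
  rw [dist_comm o a, ha]
  have : dist m a ^ 2 + r ^ 2 + ((m 0 - a 0) * (o 0 - a 0) + (m 1 - a 1) * (o 1 - a 1)) =
      dist a b ^ 2 / 2 + r ^ 2 := by
    simp only [dist_sq_plane, h0, h1]
    linear_combination (hb' - ha') / 4
  rw [this]
  ring

theorem setIntegral_infDist_isosceles {a b c o : Plane} {r : ℝ} (ha : dist a o = r)
    (hb : dist b o = r) (hc : dist c o = r)
    (hC : 0 ≤ (a 0 - c 0) * (b 0 - c 0) + (a 1 - c 1) * (b 1 - c 1)) (h : 0 < orient a b o) :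
    ∫ x in convexHull ℝ ({a, b, o} : Set Plane), Metric.infDist x ({a, b, c} : Set Plane) ^ 2 =
      orient a b o / 12 * (dist a b ^ 2 / 2 + r ^ 2) := by
  obtain ⟨m, h0, h1⟩ : ∃ m : Plane, m 0 = (a 0 + b 0) / 2 ∧ m 1 = (a 1 + b 1) / 2 :=
    ⟨!₂[(a 0 + b 0) / 2, (a 1 + b 1) / 2], by simp, by simp⟩
  have e : ({a, b, c} : Set Plane) = {b, a, c} := Set.insert_comm _ _ _
  have hba : orient b a o = -orient a b o := orient_swap _ _ _
  rw [setIntegral_triangle_midpoint h h0 h1 (f := fun x => Metric.infDist x ({a, b, c} : Set Plane) ^ 2)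
      ((Metric.continuous_infDist_pt _).pow 2),
    setIntegral_infDist_half ha hb hc h0 h1 hC h.ne', e,
    setIntegral_infDist_half hb ha hc (by rw [h0]; ring) (by rw [h1]; ring) (by linarith)
      (by rw [hba]; exact neg_ne_zero.2 h.ne'), hba, abs_neg, abs_of_pos h, dist_comm b a]
  ring

theorem setIntegral_infDist_acute {a b c o : Plane} {r : ℝ} (h : 0 < orient a b c)
    (ha : dist a o = r) (hb : dist b o = r) (hc : dist c o = r)
    (hA : 0 < (b 0 - a 0) * (c 0 - a 0) + (b 1 - a 1) * (c 1 - a 1))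
    (hB : 0 < (c 0 - b 0) * (a 0 - b 0) + (c 1 - b 1) * (a 1 - b 1))
    (hC : 0 < (a 0 - c 0) * (b 0 - c 0) + (a 1 - c 1) * (b 1 - c 1)) :
    ∫ x in convexHull ℝ ({a, b, c} : Set Plane), Metric.infDist x ({a, b, c} : Set Plane) ^ 2 =
      orient a b c / 24 * (dist a b ^ 2 + dist b c ^ 2 + dist c a ^ 2 - 4 * r ^ 2) := by
  have h1 : orient b c a = orient a b c := by unfold orient; ring
  have h2 : orient c a b = orient a b c := by unfold orient; ring
  have hbc : 0 < orient b c o := by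
    rw [orient_rotate]; exact orient_circumcenter_pos ha hb hc h hA
  have hca : 0 < orient c a o := by
    rw [orient_rotate]; exact orient_circumcenter_pos hb hc ha (by rwa [h1]) hB
  have hab : 0 < orient a b o := by
    rw [orient_rotate]; exact orient_circumcenter_pos hc ha hb (by rwa [h2]) hC
  have e1 : ({a, b, c} : Set Plane) = {b, c, a} := by
    rw [Set.insert_comm a b, Set.pair_comm a c]
  have e2 : ({a, b, c} : Set Plane) = {c, a, b} := by
    rw [Set.pair_comm b c, Set.insert_comm a c]
  rw [setIntegral_triangle_interior hab hbc hca (f := fun x => Metric.infDist x ({a, b, c} : Set Plane) ^ 2)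
      ((Metric.continuous_infDist_pt _).pow 2),
    setIntegral_infDist_isosceles ha hb hc hC.le hab]
  nth_rewrite 1 [e1]
  rw [setIntegral_infDist_isosceles hb hc ha hA.le hbc, e2,
    setIntegral_infDist_isosceles hc ha hb hB.le hca]
  have ha' := dist_sq_plane a o
  have hb' := dist_sq_plane b o
  have hc' := dist_sq_plane c o
  rw [ha] at ha'
  rw [hb] at hb'
  rw [hc] at hc'
  simp only [dist_sq_plane]
  linear_combination (norm := (unfold orient; ring1)) (orient a b c + 3 * orient b c o) / 24 * ha' +
    (orient a b c + 3 * orient c a o) / 24 * hb' + (orient a b c + 3 * orient a b o) / 24 * hc'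

theorem IsTriangle.integral_infDist_eq {t : Finset Plane} (ht : IsTriangle t) (hacute : IsAcute t) :
    ∫ x in convexHull ℝ (t : Set Plane), Metric.infDist x (t : Set Plane) ^ 2 =
      triangleArea t / 12 * (sumSqEdges t - 4 * triangleCircumradius t ^ 2) := by
  classical
  obtain ⟨o, ho⟩ := ht.exists_circumcircle
  obtain ⟨a, b, c, rfl, h⟩ := ht.exists_orient_pos
  obtain ⟨hab, hac, hbc⟩ := ne_of_orient_ne_zero h.ne'
  have ha := ho a (by simp)
  have hb := ho b (by simp)
  have hc := ho c (by simp)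
  have hA := inner_pos_of_angle_lt (hacute b (by simp) a (by simp) c (by simp) hab.symm hac hbc.symm)
  have hB := inner_pos_of_angle_lt (hacute c (by simp) b (by simp) a (by simp) hbc.symm hab.symm hac)
  have hC := inner_pos_of_angle_lt (hacute a (by simp) c (by simp) b (by simp) hac hbc.symm hab.symm)
  rw [triangleArea_triple h.ne', sumSqEdges_triple hab hac hbc, abs_of_pos h, Finset.coe_insert,
    Finset.coe_insert, Finset.coe_singleton, setIntegral_infDist_acute h ha hb hc hA hB hC]
  ring

/-- Both branches of the definition have the same value, and 3 Rf - 3 Vf = R² · area follows by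
subtraction. -/
theorem IsTriangle.voronoiTriangle_eq {t : Finset Plane} (ht : IsTriangle t) :
    voronoiTriangle t =
      triangleArea t / 12 * (sumSqEdges t - 4 * triangleCircumradius t ^ 2) := by
  unfold voronoiTriangle
  split_ifs with h
  · exact ht.integral_infDist_eq h
  · rfl

theorem IsTriangle.radiusWeight_two_eq {t : Finset Plane} (ht : IsTriangle t) :
    radiusWeight 2 t = 3 * rajanTriangle t - 3 * voronoiTriangle t := by
  rw [ht.voronoiTriangle_eq, radiusWeight, rajanTriangle, Real.rpow_two]
  ring

theorem mainTheorem7 (S : Finset Plane) :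
    -- a Delaunay triangulation exists, and its triangles are unique in general position
    (∃ D : GeometricTriangulation S, D.IsDelaunay) ∧
    (NoFourCocircular S → ∀ D : GeometricTriangulation S, D.IsDelaunay →
      D.triangles = delaunayTriangles S) ∧
    -- it minimizes `R_2` and `R_1` among all geometric triangulations
    (∀ D : GeometricTriangulation S, D.IsDelaunay → ∀ K : GeometricTriangulation S,
      D.radiusFunctional 2 ≤ K.radiusFunctional 2 ∧
      D.radiusFunctional 1 ≤ K.radiusFunctional 1) ∧
    -- the identities for `R_2` and `R_1`
    (∀ K : GeometricTriangulation S,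
      K.radiusFunctional 2 = 3 * K.rajan - 3 * K.voronoi ∧
      K.radiusFunctional 1 = 1 / 4 * ∑ t ∈ K.triangles, prodEdges t) := by
  refine ⟨exists_delaunay S, fun hS D hD => triangles_eq_delaunayTriangles hS D.isTriangulation hD,
    fun D hD K => K.isTriangulation.delaunay_sum_le D.isTriangulation hD, fun K => ⟨?_, ?_⟩⟩
  · rw [GeometricTriangulation.rajan, GeometricTriangulation.voronoi, Finset.mul_sum,
      Finset.mul_sum, ← Finset.sum_sub_distrib]
    exact Finset.sum_congr rfl fun t ht => (K.isTriangulation.isTriangle t ht).radiusWeight_two_eq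
  · rw [GeometricTriangulation.radiusFunctional, Finset.mul_sum]
    refine Finset.sum_congr rfl fun t ht => ?_
    rw [Real.rpow_one, (K.isTriangulation.isTriangle t ht).circumradius_mul_area]
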